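/- A convex $n$-polytope $P\subset\mathbb{R}^n$ is a bounded intersection of finitely many closed half-spaces with non-empty interior; two polytopes are combinatorially equivalent if their face lattices are isomorphic. $P$ is simple if exactly $n$ facets meet at each vertex. A $(\mathbb{Z}/2)^n$-coloring of a simple $n$-polytope $P$ is a map $\tau$ from the set of facets of $P$ to $(\mathbb{Z}/2)^n\setminus\{0\}$ such that the colors of the $n$ facets meeting at each vertex are linearly independent. The small cover $M(P,\tau)$ is the quotient space of $P\times(\mathbb{Z}/2)^n$ by the relation $$(x,g)\sim(y,h)\iff x=y\ \text{ and }\ g-h\in\operatorname{span}\{\tau(F): F \text{ a facet of } P,\ x\in F\}.$$ Let $P^3(3)$ denote any convex $3$-polytope combinatorially equivalent to the triangular prism $\Delta^2\times[0,1]$, and let $P^3_-(3)$ denote any convex $3$-polytope combinatorially equivalent to the truncated prism, that is, to the polytope obtained from a triangular prism by cutting off one vertex; both are simple. Corollary. For every $(\mathbb{Z}/2)^3$-coloring $\tau$ of $P^3(3)$, the small cover $M(P^3(3),\tau)$ is homeomorphic to $\mathbb{RP}^3\#\mathbb{RP}^3$ or to $S^1\times\mathbb{RP}^2$. Furthermore,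 for every $(\mathbb{Z}/2)^3$-coloring $\tau$ of $P^3_-(3)$, the small cover $M(P^3_-(3),\tau)$ is homeomorphic to $\mathbb{RP}^3\#\mathbb{RP}^3\#\mathbb{RP}^3$ or to $(S^1\times\mathbb{RP}^2)\#\mathbb{RP}^3$. -/

import Mathlib

namespace SmallCovers

/-- Euclidean `n`-space. -/
abbrev E (n : ℕ) : Type := EuclideanSpace ℝ (Fin n)

/-- A full-dimensional convex polytope in `ℝⁿ`, presented as a bounded intersection of half-spaces
`⟪normal i, x⟫ ≤ offset i`, none of them redundant, so that the index type `ι` is exactly the set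
of facets. Each facet has a point lying on no other facet, and the interior is non-empty. -/
structure ConvexPolytope (n : ℕ) (ι : Type*) where
  normal : ι → E n
  offset : ι → ℝ
  bounded : Bornology.IsBounded {x : E n | ∀ i, inner ℝ (normal i) x ≤ offset i}
  exists_interior_point : ∃ x : E n, ∀ i, inner ℝ (normal i) x < offset i
  exists_facet_point : ∀ i, ∃ x : E n,
    inner ℝ (normal i) x = offset i ∧ ∀ j, j ≠ i → inner ℝ (normal j) x < offset j

namespace ConvexPolytope

variable {n : ℕ} {ι : Type*} (P : ConvexPolytope n ι)

/-- The polytope as a set of points. -/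
def carrier : Set (E n) := {x | ∀ i, inner ℝ (P.normal i) x ≤ P.offset i}

/-- The `i`-th facet. -/
def facet (i : ι) : Set (E n) := {x | x ∈ P.carrier ∧ inner ℝ (P.normal i) x = P.offset i}

/-- The faces of a polytope are the intersections of its facets; the polytope itself is the
intersection of no facets, and the empty face is the intersection of all of them. -/
def IsFace (G : Set (E n)) : Prop :=
  ∃ S : Set ι, G = {x | x ∈ P.carrier ∧ ∀ i ∈ S, x ∈ P.facet i}

/-- Combinatorial equivalence: the face lattices, ordered by inclusion, are isomorphic. -/
def CombEquiv {m : ℕ} {κ : Type*} (P : ConvexPolytope n ι) (Q : ConvexPolytope m κ) : Prop :=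
  Nonempty ({G : Set (E n) // P.IsFace G} ≃o {G : Set (E m) // Q.IsFace G})

/-- A `(ℤ/2)ⁿ`-coloring: the facets are given non-zero colors, and the colors of the facets
meeting at each vertex are linearly independent. -/
def IsColoring (c : ι → (Fin n → ZMod 2)) : Prop :=
  (∀ i, c i ≠ 0) ∧
    ∀ v ∈ P.carrier.extremePoints ℝ,
      LinearIndependent (ZMod 2) (fun i : {i : ι // v ∈ P.facet i} => c i)

/-- The subgroup of `(ℤ/2)ⁿ` spanned by the colors of the facets containing `x`, i.e. of the
facets whose intersection is the face with `x` in its relative interior. It is trivial if `x` is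
an interior point of the polytope. -/
def colorSpan (c : ι → (Fin n → ZMod 2)) (x : E n) : Submodule (ZMod 2) (Fin n → ZMod 2) :=
  Submodule.span (ZMod 2) (c '' {i | x ∈ P.facet i})

/-- The gluing relation on `P × (ℤ/2)ⁿ`. -/
def gluing (c : ι → (Fin n → ZMod 2)) : Setoid (P.carrier × (Fin n → ZMod 2)) where
  r p q := p.1 = q.1 ∧ p.2 - q.2 ∈ P.colorSpan c p.1
  iseqv :=
    { refl := fun p => ⟨rfl, by simp⟩
      symm := by
        rintro ⟨x, g⟩ ⟨y, h⟩ ⟨hxy, hgh⟩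
        obtain rfl : x = y := hxy
        exact ⟨rfl, by simpa using neg_mem hgh⟩
      trans := by
        rintro ⟨x, g⟩ ⟨y, h⟩ ⟨z, k⟩ ⟨hxy, hgh⟩ ⟨hyz, hhk⟩
        obtain rfl : x = y := hxy
        obtain rfl : x = z := hyz
        exact ⟨rfl, by simpa using add_mem hgh hhk⟩ }

/-- The small cover `M(P, c)`, with the quotient topology. -/
def SmallCover (c : ι → (Fin n → ZMod 2)) : Type := Quotient (P.gluing c)

instance (c : ι → (Fin n → ZMod 2)) : TopologicalSpace (P.SmallCover c) :=
  inferInstanceAs (TopologicalSpace (Quotient (P.gluing c)))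

end ConvexPolytope

theorem inner_eq (a b c : ℝ) (x : E 3) :
    inner ℝ (!₂[a, b, c] : E 3) x = a * x 0 + b * x 1 + c * x 2 := by
  simp [PiLp.inner_apply, Fin.sum_univ_three, mul_comm]

theorem inner_eq_vec (a b c x y z : ℝ) :
    inner ℝ (!₂[a, b, c] : E 3) !₂[x, y, z] = a * x + b * y + c * z := inner_eq a b c _

theorem isBounded_of_subset_cube {s : Set (E 3)}
    (h : ∀ x ∈ s, ∀ i, |x i| ≤ 1) : Bornology.IsBounded s := by
  refine (Metric.isBounded_closedBall (x := (0 : E 3)) (r := 3)).subset fun x hx => ?_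
  rw [mem_closedBall_zero_iff, EuclideanSpace.norm_eq]
  refine Real.sqrt_le_iff.2 ⟨by norm_num, ?_⟩
  have h' : ∀ i, ‖x i‖ ^ 2 ≤ 1 := fun i =>
    pow_le_one₀ (norm_nonneg _) (by simpa using h x hx i)
  rw [Fin.sum_univ_three]
  linarith [h' 0, h' 1, h' 2]

/-- The standard triangular prism `{x ≥ 0, y ≥ 0, x + y ≤ 1, 0 ≤ z ≤ 1}` in `ℝ³`. -/
noncomputable def triangularPrism : ConvexPolytope 3 (Fin 5) where
  normal := ![!₂[-1, 0, 0], !₂[0, -1, 0], !₂[1, 1, 0], !₂[0, 0, -1], !₂[0, 0, 1]]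
  offset := ![0, 0, 1, 0, 1]
  bounded := by
    refine isBounded_of_subset_cube fun x hx => ?_
    simp only [Set.mem_ofPred_eq, Fin.forall_fin_succ, IsEmpty.forall_iff] at hx
    simp [inner_eq] at hx
    obtain ⟨h0, h1, h2, h3, h4⟩ := hx
    intro i
    rw [abs_le]
    fin_cases i <;> constructor <;> simp <;> linarith
  exists_interior_point := by
    refine ⟨!₂[1/4, 1/4, 1/2], fun i => ?_⟩
    fin_cases i <;> norm_num [inner_eq_vec]
  exists_facet_point := by
    intro i
    refine ⟨![!₂[0, 1/4, 1/2], !₂[1/4, 0, 1/2], !₂[1/2, 1/2, 1/2], !₂[1/4, 1/4, 0],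
      !₂[1/4, 1/4, 1]] i, ?_, fun j hj => ?_⟩
    · fin_cases i <;> norm_num [inner_eq_vec]
    · fin_cases i <;> fin_cases j <;> first | exact absurd rfl hj | norm_num [inner_eq_vec]

/-- The truncated prism: the standard triangular prism with its vertex `(0, 0, 1)` cut off by the
half-space `z - x - y ≤ 1/2`, which contains all the other vertices in its interior. -/
noncomputable def truncatedPrism : ConvexPolytope 3 (Fin 6) where
  normal := ![!₂[-1, 0, 0], !₂[0, -1, 0], !₂[1, 1, 0], !₂[0, 0, -1], !₂[0, 0, 1],
    !₂[-1, -1, 1]]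
  offset := ![0, 0, 1, 0, 1, 1/2]
  bounded := by
    refine isBounded_of_subset_cube fun x hx => ?_
    simp only [Set.mem_ofPred_eq, Fin.forall_fin_succ, IsEmpty.forall_iff] at hx
    simp [inner_eq] at hx
    obtain ⟨h0, h1, h2, h3, h4, -⟩ := hx
    intro i
    rw [abs_le]
    fin_cases i <;> constructor <;> simp <;> linarith
  exists_interior_point := by
    refine ⟨!₂[1/4, 1/4, 1/2], fun i => ?_⟩
    fin_cases i <;> norm_num [inner_eq_vec]
  exists_facet_point := by
    intro i
    refine ⟨![!₂[0, 1/4, 1/2], !₂[1/4, 0, 1/2], !₂[1/2, 1/2, 1/2], !₂[1/4, 1/4, 0],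
      !₂[2/5, 2/5, 1], !₂[1/10, 1/10, 7/10]] i, ?_, fun j hj => ?_⟩
    · fin_cases i <;> norm_num [inner_eq_vec]
    · fin_cases i <;> fin_cases j <;> first | exact absurd rfl hj | norm_num [inner_eq_vec]

/-- The antipodal relation on the unit sphere of `ℝⁿ⁺¹`. -/
def antipodal (n : ℕ) : Setoid (Metric.sphere (0 : E (n + 1)) 1) where
  r x y := x = y ∨ x = -y
  iseqv :=
    { refl := fun _ => Or.inl rfl
      symm := by
        rintro x y (rfl | rfl)
        · exact Or.inl rfl
        · exact Or.inr (neg_neg y).symm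
      trans := by
        rintro x y z (rfl | rfl) (rfl | rfl) <;> simp }

/-- Real projective `n`-space: the unit sphere of `ℝⁿ⁺¹` with antipodal points identified. -/
def RealProjectiveSpace (n : ℕ) : Type := Quotient (antipodal n)

instance (n : ℕ) : TopologicalSpace (RealProjectiveSpace n) :=
  inferInstanceAs (TopologicalSpace (Quotient (antipodal n)))

section ConnectedSum

variable {n : ℕ} {A B : Type*}

/-- The points outside the open disc that is the image of the open unit ball under `φ`. -/
abbrev DiscComplement (φ : E n → A) : Type _ := {a : A // a ∉ φ '' Metric.ball 0 1}

/-- Gluing of the two boundary spheres: `φ x` is identified with `ψ x` for every unit vector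
`x`. -/
def sphereGluing (φ : E n → A) (ψ : E n → B) (p q : DiscComplement φ ⊕ DiscComplement ψ) : Prop :=
  ∃ (a : DiscComplement φ) (b : DiscComplement ψ), p = Sum.inl a ∧ q = Sum.inr b ∧
    ∃ x ∈ Metric.sphere (0 : E n) 1, φ x = a ∧ ψ x = b

/-- The connected sum along the discs `φ` and `ψ`: remove the two open discs and glue the
boundary spheres (`Quot` is the quotient by the equivalence relation generated). -/
def ConnSum (φ : E n → A) (ψ : E n → B) : Type _ := Quot (sphereGluing φ ψ)

instance [TopologicalSpace A] [TopologicalSpace B] (φ : E n → A) (ψ : E n → B) :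
    TopologicalSpace (ConnSum φ ψ) :=
  inferInstanceAs (TopologicalSpace (Quot (sphereGluing φ ψ)))

end ConnectedSum

/-- `X` is homeomorphic to a connected sum `A # B` of `n`-manifolds, formed along the unit discs
of two locally flat embedded discs, that is, of two open embeddings of `ℝⁿ`. -/
def IsConnectedSum (n : ℕ) (X A B : Type*) [TopologicalSpace X] [TopologicalSpace A]
    [TopologicalSpace B] : Prop :=
  ∃ (φ : E n → A) (ψ : E n → B), Topology.IsOpenEmbedding φ ∧ Topology.IsOpenEmbedding ψ ∧
    Nonempty (X ≃ₜ ConnSum φ ψ)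

end SmallCovers

/-! A small cover depends only on the polytope up to facet-preserving homeomorphism and on the
coloring up to automorphisms of `(ℤ/2)³`. Combinatorially equivalent polytopes are related by such a
homeomorphism: choose a point in the relative interior of every face and extend from the boundary of
each face by coning (`CombEquiv.exists_homeomorph`). The theorem is thereby reduced to colorings of
two concrete models, each a subset of `ℝ³` with walls, whose small covers are the spaces `Glued
(wallSpanOn X s c)`.

The main geometric fact is `IsCorner.isConnectedSum_cut`. Near a vertex with colors `e₀, e₁, e₂` the
eight copies of the polytope unfold to a ball in `ℝ³`, the group acting by coordinate reflections.
If the vertex is cut off, the new facet must have color `(1, 1, 1)`, because this is the only vector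
independent of each pair of basis vectors. That color acts on the new boundary sphere as the
antipodal map, so the ball is replaced by `ℝP³` minus a ball. The same unfolding shows that the
simplex with colors `e₀, e₁, e₂, (1, 1, 1)` has small cover `ℝP³`: an octahedron with antipodal
boundary points identified.

For the prism (`prismCover_cases`) there are two cases. If the colors of the three quadrilaterals
are independent, both triangles have the sum of these colors, and the prism is a simplex with a
vertex cut off; this gives `ℝP³ # ℝP³`. If they are dependent, each triangular slice unfolds to
`ℝP²` and the small cover is an `ℝP²`-bundle over the circle. Its monodromy is a coordinate
reflection, which projectively is joined to the identity by rotations, so the bundle is `S¹ × ℝP²`.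

The truncated prism is a simplex with two vertices cut off. At one of the two the removed colors are
independent (`IsTruncColoring.indep_or`), and a combinatorial symmetry exchanges the two. Restoring
that vertex presents the small cover as a connected sum of a small cover of the prism with `ℝP³`. -/

namespace SmallCovers

/-! ### Gluing along stabilizer subgroups -/

/-- The group `(ℤ/2)³`. -/
abbrev V3 : Type := Fin 3 → ZMod 2

/-- The gluing relation on `X × (ℤ/2)³` given by a subgroup for each point of `X`. -/
def stabGluing {X : Type*} (W : X → Submodule (ZMod 2) V3) : Setoid (X × V3) where
  r p q := p.1 = q.1 ∧ p.2 - q.2 ∈ W p.1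
  iseqv :=
    { refl := fun p => ⟨rfl, by simp⟩
      symm := by
        rintro ⟨x, g⟩ ⟨y, h⟩ ⟨hxy, hgh⟩
        obtain rfl : x = y := hxy
        exact ⟨rfl, by simpa using neg_mem hgh⟩
      trans := by
        rintro ⟨x, g⟩ ⟨y, h⟩ ⟨z, k⟩ ⟨hxy, hgh⟩ ⟨hyz, hhk⟩
        obtain rfl : x = y := hxy
        obtain rfl : x = z := hyz
        exact ⟨rfl, by simpa using add_mem hgh hhk⟩ }

/-- The space obtained from `X × (ℤ/2)³` by gluing along the subgroups `W x`. -/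
def Glued {X : Type*} (W : X → Submodule (ZMod 2) V3) : Type _ := Quotient (stabGluing W)

instance {X : Type*} [TopologicalSpace X] (W : X → Submodule (ZMod 2) V3) :
    TopologicalSpace (Glued W) :=
  inferInstanceAs (TopologicalSpace (Quotient (stabGluing W)))

namespace Glued

variable {X Y : Type*} {W : X → Submodule (ZMod 2) V3}

/-- The class of a point of `X × (ℤ/2)³`. -/
def mk (W : X → Submodule (ZMod 2) V3) (p : X × V3) : Glued W := Quotient.mk (stabGluing W) p

theorem mk_eq_mk {p q : X × V3} : mk W p = mk W q ↔ p.1 = q.1 ∧ p.2 - q.2 ∈ W p.1 :=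
  Quotient.eq (r := stabGluing W)

theorem mk_surjective : Function.Surjective (mk W) := Quotient.mk_surjective

variable [TopologicalSpace X] [TopologicalSpace Y]

theorem isQuotientMap_mk : Topology.IsQuotientMap (mk W) := isQuotientMap_quotient_mk'

theorem continuous_mk : Continuous (mk W) := isQuotientMap_mk.continuous

instance [CompactSpace X] : CompactSpace (Glued W) :=
  inferInstanceAs (CompactSpace (Quotient (stabGluing W)))

/-- A continuous bijection from a compact space to a Hausdorff space is a homeomorphism, so it
suffices to give a map whose fibres are exactly the gluing classes. Both `ℝP³` and `S¹ × ℝP²` are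
recognized in this way. -/
theorem nonempty_homeomorph_of_kernel [CompactSpace X] {Z : Type*} [TopologicalSpace Z]
    [T2Space Z] (f : X × V3 → Z) (hf : Continuous f) (hs : Function.Surjective f)
    (hk : ∀ p q, f p = f q ↔ p.1 = q.1 ∧ p.2 - q.2 ∈ W p.1) : Nonempty (Glued W ≃ₜ Z) := by
  let F : Glued W → Z := Quotient.lift f fun p q h => (hk p q).2 h
  have hF : Continuous F := hf.quotient_lift _
  have hb : Function.Bijective F := by
    constructor
    · intro a b hab
      obtain ⟨p, rfl⟩ := mk_surjective a
      obtain ⟨q, rfl⟩ := mk_surjective b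
      exact mk_eq_mk.2 ((hk p q).1 hab)
    · intro z
      obtain ⟨p, rfl⟩ := hs z
      exact ⟨mk W p, rfl⟩
  exact ⟨Continuous.homeoOfEquivCompactToT2 (f := Equiv.ofBijective F hb) hF⟩

theorem nonempty_homeomorph_map (W' : Y → Submodule (ZMod 2) V3) (h : X ≃ₜ Y)
    (L : V3 ≃ₗ[ZMod 2] V3) (hW : ∀ x g, L g ∈ W' (h x) ↔ g ∈ W x) :
    Nonempty (Glued W ≃ₜ Glued W') := by
  have h1 : Continuous fun p : X × V3 => (h p.1, L p.2) :=
    (h.continuous.comp continuous_fst).prodMk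
      ((continuous_of_discreteTopology (f := L)).comp continuous_snd)
  have h2 : Continuous fun p : Y × V3 => (h.symm p.1, L.symm p.2) :=
    (h.symm.continuous.comp continuous_fst).prodMk
      ((continuous_of_discreteTopology (f := L.symm)).comp continuous_snd)
  have e1 : ∀ p q : X × V3, (stabGluing W).r p q →
      (stabGluing W').r (h p.1, L p.2) (h q.1, L q.2) := by
    rintro ⟨x, g⟩ ⟨y, k⟩ ⟨hxy, hgk⟩
    exact ⟨congrArg h hxy, by rw [← map_sub]; exact (hW _ _).2 hgk⟩
  have e2 : ∀ p q : Y × V3, (stabGluing W').r p q →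
      (stabGluing W).r (h.symm p.1, L.symm p.2) (h.symm q.1, L.symm q.2) := by
    rintro ⟨x, g⟩ ⟨y, k⟩ ⟨hxy, hgk⟩
    refine ⟨congrArg h.symm hxy, ?_⟩
    rw [← map_sub]
    refine (hW _ _).1 ?_
    simpa using hgk
  refine ⟨{ toFun := Quotient.map _ e1, invFun := Quotient.map _ e2, left_inv := ?_,
            right_inv := ?_, continuous_toFun := h1.quotient_map' e1,
            continuous_invFun := h2.quotient_map' e2 }⟩
  · intro a
    obtain ⟨p, rfl⟩ := mk_surjective a
    exact congrArg (mk W) (Prod.ext (h.symm_apply_apply _) (L.symm_apply_apply _))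
  · intro a
    obtain ⟨p, rfl⟩ := mk_surjective a
    exact congrArg (mk W') (Prod.ext (h.apply_symm_apply _) (L.apply_symm_apply _))

end Glued

/-- The sign `(-1)^a`. -/
def sgn (a : ZMod 2) : ℝ := if a = 0 then 1 else -1

@[simp] theorem sgn_zero : sgn 0 = 1 := rfl

@[simp] theorem sgn_one : sgn 1 = -1 := if_neg (by decide)

theorem zmod2_cases (a : ZMod 2) : a = 0 ∨ a = 1 := by revert a; decide

theorem sgn_add (a b : ZMod 2) : sgn (a + b) = sgn a * sgn b := by
  rcases zmod2_cases a with rfl | rfl <;> rcases zmod2_cases b with rfl | rfl <;>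
    simp [show (1 + 1 : ZMod 2) = 0 from rfl]

@[simp] theorem sgn_mul_self (a : ZMod 2) : sgn a * sgn a = 1 := by
  rcases zmod2_cases a with rfl | rfl <;> simp

@[simp] theorem abs_sgn (a : ZMod 2) : |sgn a| = 1 := by
  rcases zmod2_cases a with rfl | rfl <;> simp

theorem sgn_injective : Function.Injective sgn := by
  intro a b h
  rcases zmod2_cases a with rfl | rfl <;> rcases zmod2_cases b with rfl | rfl <;>
    norm_num at h <;> rfl

/-- The subgroup spanned by the colors `c i` of the walls `s i = 0` containing `x`. -/
def wallSpan {X ι : Type*} (s : ι → X → ℝ) (c : ι → V3) (x : X) : Submodule (ZMod 2) V3 :=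
  Submodule.span (ZMod 2) (c '' {i | s i x = 0})

/-- A character `χ` of the color group gives the function `sgn (χ g) * ∏ s i x`, the product being
over the walls with `χ (c i) ≠ 0`. It descends to the quotient: on a wall whose color `χ` does not
kill it vanishes, and away from such walls `χ` kills the stabilizer. Together with the point `x`
these functions separate classes, since a vector outside the stabilizer is detected by a character
that kills the stabilizer, and for this character the product is nonzero. -/
theorem t2Space_glued_wallSpan {X ι : Type*} [TopologicalSpace X] [T2Space X] [Finite ι]
    (s : ι → X → ℝ) (hs : ∀ i, Continuous (s i)) (c : ι → V3) :
    T2Space (Glued (wallSpan s c)) := by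
  classical
  have := Fintype.ofFinite ι
  let f : X × V3 → X × (Module.Dual (ZMod 2) V3 → ℝ) := fun p =>
    (p.1, fun χ => sgn (χ p.2) * ∏ i, if χ (c i) = 0 then 1 else s i p.1)
  have hf : Continuous f := by
    refine continuous_fst.prodMk (continuous_pi fun χ => Continuous.mul ?_ ?_)
    · exact (continuous_of_discreteTopology (f := fun g : V3 => sgn (χ g))).comp continuous_snd
    · refine continuous_finsetProd _ fun i _ => ?_
      split_ifs
      · exact continuous_const
      · exact (hs i).comp continuous_fst
  have hk : ∀ p q, (stabGluing (wallSpan s c)).r p q → f p = f q := by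
    rintro ⟨x, g⟩ ⟨y, k⟩ ⟨hxy, hgk⟩
    obtain rfl : x = y := hxy
    refine Prod.ext rfl (funext fun χ => ?_)
    change sgn (χ g) * _ = sgn (χ k) * _
    by_cases h : ∃ i, s i x = 0 ∧ χ (c i) ≠ 0
    · obtain ⟨i, hi, hi'⟩ := h
      have : (∏ i, if χ (c i) = 0 then 1 else s i x) = 0 :=
        Finset.prod_eq_zero (Finset.mem_univ i) (by rw [if_neg hi', hi])
      rw [this, mul_zero, mul_zero]
    · push Not at h
      have hle : wallSpan s c x ≤ LinearMap.ker χ := by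
        rw [wallSpan, Submodule.span_le]
        rintro _ ⟨i, hi, rfl⟩
        exact h i hi
      have : χ (g - k) = 0 := hle hgk
      rw [map_sub, sub_eq_zero] at this
      rw [this]
  let F : Glued (wallSpan s c) → _ := Quotient.lift f hk
  refine T2Space.of_injective_continuous (f := F) ?_ (hf.quotient_lift _)
  intro a b hab
  obtain ⟨⟨x, g⟩, rfl⟩ := Glued.mk_surjective a
  obtain ⟨⟨y, k⟩, rfl⟩ := Glued.mk_surjective b
  have hab' : f (x, g) = f (y, k) := hab
  obtain rfl : x = y := congrArg Prod.fst hab'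
  refine Glued.mk_eq_mk.2 ⟨rfl, ?_⟩
  by_contra hn
  obtain ⟨χ, hχ, hle⟩ := Submodule.exists_le_ker_of_notMem hn
  have hprod : (∏ i, if χ (c i) = 0 then 1 else s i x) ≠ 0 := by
    refine Finset.prod_ne_zero_iff.2 fun i _ => ?_
    split_ifs with h
    · exact one_ne_zero
    · intro h0
      exact h (hle (Submodule.subset_span ⟨i, h0, rfl⟩))
  have h1 : sgn (χ g) * _ = sgn (χ k) * _ := congrFun (congrArg Prod.snd hab') χ
  have h2 := sgn_injective (mul_right_cancel₀ hprod h1)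
  exact hχ (by simp [h2])

end SmallCovers

/-! ### Radial gauge of a polytope from a base point -/

namespace SmallCovers

namespace ConvexPolytope

variable {n m : ℕ} {ι : Type*} (P : ConvexPolytope n ι) (Q : ConvexPolytope m ι)

/-- The set of facet inequalities that are equalities at `x`. -/
def act (x : E n) : Set ι := {i | inner ℝ (P.normal i) x = P.offset i}

theorem mem_act {x : E n} {i : ι} : i ∈ P.act x ↔ inner ℝ (P.normal i) x = P.offset i := Iff.rfl

theorem isClosed_carrier : IsClosed P.carrier := by
  have : P.carrier = ⋂ i, {x : E n | inner ℝ (P.normal i) x ≤ P.offset i} := by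
    ext x; simp [carrier]
  rw [this]
  exact isClosed_iInter fun i => isClosed_le (by fun_prop) continuous_const

theorem isCompact_carrier : IsCompact P.carrier :=
  Metric.isCompact_of_isClosed_isBounded P.isClosed_carrier P.bounded

instance : CompactSpace P.carrier := isCompact_iff_compactSpace.1 P.isCompact_carrier

theorem convex_comb_mem {x y : E n} (hx : x ∈ P.carrier) (hy : y ∈ P.carrier) {t : ℝ}
    (h0 : 0 ≤ t) (h1 : t ≤ 1) : x + t • (y - x) ∈ P.carrier := by
  intro i
  rw [inner_add_right, inner_smul_right, inner_sub_right]
  nlinarith [hx i, hy i]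

/-- An inequality valid at both ends of a segment and tight at an inner point is tight at both ends.
-/
theorem act_convex_comb {x y : E n} (hx : x ∈ P.carrier) (hy : y ∈ P.carrier) {t : ℝ}
    (h0 : 0 < t) (h1 : t < 1) : P.act (x + t • (y - x)) = P.act x ∩ P.act y := by
  ext i
  have hxi := hx i
  have hyi := hy i
  simp only [mem_act, Set.mem_inter_iff, inner_add_right, inner_smul_right, inner_sub_right]
  constructor
  · intro h
    constructor <;> nlinarith
  · rintro ⟨h, h'⟩
    rw [h, h']; ring

section Gauge

variable [Fintype ι]

/-- For `b` in the polytope, the factor by which `x` has been moved from `b` towards the boundary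
(of the face of `b`): the points with gauge `1` are those lying on a facet not through `b`. -/
noncomputable def gaugeFrom (b x : E n) : ℝ :=
  ((Finset.univ.sup fun i => Real.toNNReal
    (inner ℝ (P.normal i) (x - b) / (P.offset i - inner ℝ (P.normal i) b)) : NNReal) : ℝ)

theorem continuous_gaugeFrom (b : E n) : Continuous (P.gaugeFrom b) := by
  unfold gaugeFrom
  refine NNReal.continuous_coe.comp ?_
  refine Continuous.finset_sup_apply fun i _ => ?_
  exact continuous_real_toNNReal.comp (by fun_prop)

theorem gaugeFrom_nonneg (b x : E n) : 0 ≤ P.gaugeFrom b x := NNReal.coe_nonneg _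

theorem gaugeFrom_le_iff {b x : E n} {r : ℝ} (hr : 0 ≤ r) : P.gaugeFrom b x ≤ r ↔
    ∀ i, inner ℝ (P.normal i) (x - b) / (P.offset i - inner ℝ (P.normal i) b) ≤ r := by
  lift r to NNReal using hr
  rw [gaugeFrom, NNReal.coe_le_coe, Finset.sup_le_iff]
  simp [Real.toNNReal_le_iff_le_coe]

theorem gaugeFrom_self (b : E n) : P.gaugeFrom b b = 0 :=
  le_antisymm ((P.gaugeFrom_le_iff le_rfl).2 (by simp)) (P.gaugeFrom_nonneg _ _)

variable {P}

/-- For a facet through `b` the denominator is zero, so the quotient has the default value zero and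
imposes nothing. The cleared inequality is then trivial too, because `x` lies on the same facet. -/
theorem gaugeFrom_le_iff' {b x : E n} (hb : b ∈ P.carrier) (hx : P.act b ⊆ P.act x) {r : ℝ}
    (hr : 0 ≤ r) : P.gaugeFrom b x ≤ r ↔
      ∀ i, inner ℝ (P.normal i) (x - b) ≤ r * (P.offset i - inner ℝ (P.normal i) b) := by
  rw [P.gaugeFrom_le_iff hr]
  refine forall_congr' fun i => ?_
  rcases (hb i).eq_or_lt with h | h
  · have : inner ℝ (P.normal i) x = P.offset i := hx h
    rw [inner_sub_right, this, h]
    simpa using hr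
  · rw [div_le_iff₀ (by linarith)]

theorem gaugeFrom_smul (b x : E n) {r : ℝ} (hr : 0 ≤ r) :
    P.gaugeFrom b (b + r • (x - b)) = r * P.gaugeFrom b x := by
  unfold gaugeFrom
  lift r to NNReal using hr
  rw [← NNReal.coe_mul, NNReal.mul_finset_sup]
  congr 2
  funext i
  rw [add_sub_cancel_left, inner_smul_right, mul_div_assoc, Real.toNNReal_mul r.coe_nonneg,
    Real.toNNReal_coe]

theorem gaugeFrom_le_one {b x : E n} (hb : b ∈ P.carrier) (hx : x ∈ P.carrier)
    (hbx : P.act b ⊆ P.act x) : P.gaugeFrom b x ≤ 1 := by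
  rw [gaugeFrom_le_iff' hb hbx zero_le_one]
  intro i
  rw [inner_sub_right]
  linarith [hx i]

omit [Fintype ι] in
theorem act_subset_ray {b x : E n} (hbx : P.act b ⊆ P.act x) (r : ℝ) :
    P.act b ⊆ P.act (b + r • (x - b)) := by
  intro i hi
  have h1 : inner ℝ (P.normal i) b = P.offset i := hi
  have h2 : inner ℝ (P.normal i) x = P.offset i := hbx hi
  rw [mem_act, inner_add_right, inner_smul_right, inner_sub_right, h1, h2]
  ring

theorem ray_mem_iff {b x : E n} (hb : b ∈ P.carrier) (hbx : P.act b ⊆ P.act x) {r : ℝ}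
    (hr : 0 ≤ r) : b + r • (x - b) ∈ P.carrier ↔ r * P.gaugeFrom b x ≤ 1 := by
  rw [← gaugeFrom_smul b x hr, gaugeFrom_le_iff' hb (act_subset_ray hbx r) zero_le_one]
  refine forall_congr' fun i => ?_
  rw [inner_sub_right]
  constructor <;> intro h <;> linarith

/-- With gauge zero the whole ray from `b` through `x` would stay in the bounded polytope. -/
theorem gaugeFrom_pos {b x : E n} (hb : b ∈ P.carrier) (hbx : P.act b ⊆ P.act x) (hne : x ≠ b) :
    0 < P.gaugeFrom b x := by
  refine (P.gaugeFrom_nonneg b x).lt_of_ne fun h0 => ?_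
  obtain ⟨C, hC⟩ := isBounded_iff_forall_norm_le.1 P.bounded
  have hpos : 0 < ‖x - b‖ := norm_pos_iff.2 (sub_ne_zero.2 hne)
  have hCb := hC b hb
  have hC0 : 0 ≤ C := (norm_nonneg _).trans hCb
  -- Two points of norm at most `C` are at distance at most `2 * C`, so a point of the ray at
  -- distance `2 * C + 1` gives the contradiction.
  have hr : 0 ≤ (2 * C + 1) / ‖x - b‖ := by positivity
  have hmem : b + ((2 * C + 1) / ‖x - b‖) • (x - b) ∈ P.carrier :=
    (ray_mem_iff hb hbx hr).2 (by rw [← h0]; simp)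
  have h1 := hC _ hmem
  have h2 : ‖((2 * C + 1) / ‖x - b‖) • (x - b)‖ = 2 * C + 1 := by
    rw [norm_smul, Real.norm_of_nonneg hr, div_mul_cancel₀ _ hpos.ne']
  have h3 := norm_sub_le (b + ((2 * C + 1) / ‖x - b‖) • (x - b)) b
  rw [add_sub_cancel_left, h2] at h3
  linarith

/-- A facet through `x` but not through `b` contributes the ratio `1`, and no ratio exceeds `1`
inside the polytope. -/
theorem gaugeFrom_eq_one {b x : E n} (hb : b ∈ P.carrier) (hx : x ∈ P.carrier)
    (hbx : P.act b ⊂ P.act x) : P.gaugeFrom b x = 1 := by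
  obtain ⟨hsub, hn⟩ := hbx
  obtain ⟨i, hi, hib⟩ := Set.not_subset.1 hn
  refine le_antisymm (gaugeFrom_le_one hb hx hsub) ?_
  have h := (gaugeFrom_le_iff' hb hsub (P.gaugeFrom_nonneg b x)).1 le_rfl i
  rw [inner_sub_right, P.mem_act.1 hi] at h
  have hlt : inner ℝ (P.normal i) b < P.offset i := lt_of_le_of_ne (hb i) hib
  nlinarith

/-- If `x` lay on no facet beyond those of `b`, each of the finitely many ratios would be less than
`1`, and so would their supremum. -/
theorem act_ssubset_of_gaugeFrom_eq_one {b x : E n} (hb : b ∈ P.carrier) (hx : x ∈ P.carrier)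
    (hbx : P.act b ⊆ P.act x) (h : P.gaugeFrom b x = 1) : P.act b ⊂ P.act x := by
  refine ⟨hbx, fun hxb => ?_⟩
  have hlt : ∀ i, inner ℝ (P.normal i) (x - b) / (P.offset i - inner ℝ (P.normal i) b) < 1 := by
    intro i
    by_cases hi : i ∈ P.act x
    · have : inner ℝ (P.normal i) b = P.offset i := hxb hi
      rw [this]
      simp
    · have h1 : inner ℝ (P.normal i) x < P.offset i := lt_of_le_of_ne (hx i) hi
      have h2 : inner ℝ (P.normal i) b < P.offset i :=
        lt_of_le_of_ne (hb i) fun h => hi (hbx h)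
      rw [div_lt_one (by linarith), inner_sub_right]
      linarith
  have : P.gaugeFrom b x < 1 := by
    rw [gaugeFrom, ← NNReal.coe_one, NNReal.coe_lt_coe, Finset.sup_lt_iff (by simp)]
    intro i _
    exact Real.toNNReal_lt_one.2 (hlt i)
  linarith

/-- The point where the ray from `b` through `x` leaves the polytope. -/
noncomputable def exitPoint (P : ConvexPolytope n ι) (b x : E n) : E n :=
  b + (P.gaugeFrom b x)⁻¹ • (x - b)

/-- The case `x = b` needs no exception: the inverse of the gauge is then `0` and the exit point is
`b`. -/
theorem exitPoint_mem {b x : E n} (hb : b ∈ P.carrier) (hbx : P.act b ⊆ P.act x) :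
    P.exitPoint b x ∈ P.carrier :=
  (ray_mem_iff hb hbx (inv_nonneg.2 (P.gaugeFrom_nonneg b x))).2 inv_mul_le_one

theorem act_ssubset_exitPoint {b x : E n} (hb : b ∈ P.carrier)
    (hbx : P.act b ⊆ P.act x) (hne : x ≠ b) : P.act b ⊂ P.act (P.exitPoint b x) := by
  refine act_ssubset_of_gaugeFrom_eq_one hb (exitPoint_mem hb hbx) (act_subset_ray hbx _) ?_
  rw [exitPoint, gaugeFrom_smul b x (inv_nonneg.2 (P.gaugeFrom_nonneg b x)),
    inv_mul_cancel₀ (gaugeFrom_pos hb hbx hne).ne']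

theorem exitPoint_eq_self {b x : E n} (hb : b ∈ P.carrier) (hx : x ∈ P.carrier)
    (hbx : P.act b ⊂ P.act x) : P.exitPoint b x = x := by
  rw [exitPoint, gaugeFrom_eq_one hb hx hbx, inv_one, one_smul, add_sub_cancel]

theorem ray_exitPoint {b x : E n} (hb : b ∈ P.carrier)
    (hbx : P.act b ⊆ P.act x) : b + P.gaugeFrom b x • (P.exitPoint b x - b) = x := by
  by_cases hne : x = b
  · rw [hne, gaugeFrom_self, zero_smul, add_zero]
  · rw [exitPoint, add_sub_cancel_left, smul_smul,
      mul_inv_cancel₀ (gaugeFrom_pos hb hbx hne).ne', one_smul, add_sub_cancel]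

end Gauge

end ConvexPolytope

end SmallCovers

/-! ### Homeomorphisms of polytopes by coning over faces -/

namespace SmallCovers

namespace ConvexPolytope

variable {n m : ℕ} {ι : Type*}

/-- `b` chooses a point in the relative interior of each face, where `A` is the set of all sets of
facets meeting in the relative interior of a face. -/
structure IsBase (P : ConvexPolytope n ι) (A : Set (Set ι)) (b : Set ι → E n) : Prop where
  act_mem : ∀ x ∈ P.carrier, P.act x ∈ A
  mem : ∀ S ∈ A, b S ∈ P.carrier
  act_eq : ∀ S ∈ A, P.act (b S) = S

section Transport

variable [Fintype ι] (P : ConvexPolytope n ι) (Q : ConvexPolytope m ι) (b : Set ι → E n)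
  (b' : Set ι → E m)

/-- The map that takes base points to base points and is extended to each face by coning off the
boundary from the base point; the first argument bounds the depth of the recursion. -/
noncomputable def transport : ℕ → E n → E m
  | 0, x => b' (P.act x)
  | k + 1, x => b' (P.act x) + P.gaugeFrom (b (P.act x)) x •
      (transport k (P.exitPoint (b (P.act x)) x) - b' (P.act x))

variable {P Q b b'} {A : Set (Set ι)}

omit [Fintype ι] in
theorem IsBase.act_base (h : P.IsBase A b) {x : E n} (hx : x ∈ P.carrier) :
    P.act (b (P.act x)) = P.act x := h.act_eq _ (h.act_mem x hx)

theorem IsBase.exitPoint_mem (h : P.IsBase A b) {x : E n} (hx : x ∈ P.carrier) :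
    P.exitPoint (b (P.act x)) x ∈ P.carrier :=
  ConvexPolytope.exitPoint_mem (h.mem _ (h.act_mem x hx)) (h.act_base hx).subset

/-- The exit point lies on strictly more facets, so the number of facets missed decreases. This is
the measure for the recursion and for all inductions on it. -/
theorem IsBase.act_ssubset (h : P.IsBase A b) {x : E n} (hx : x ∈ P.carrier)
    (hne : x ≠ b (P.act x)) : P.act x ⊂ P.act (P.exitPoint (b (P.act x)) x) := by
  have := act_ssubset_exitPoint (h.mem _ (h.act_mem x hx)) (h.act_base hx).subset hne
  rwa [h.act_base hx] at this

omit [Fintype ι] in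
theorem ncard_compl_lt [Finite ι] {S T : Set ι} (h : S ⊂ T) : Tᶜ.ncard < Sᶜ.ncard :=
  Set.ncard_lt_ncard (compl_lt_compl_iff_lt.2 h)

theorem IsBase.gaugeFrom_mem_Ioo (h : P.IsBase A b) {x : E n} (hx : x ∈ P.carrier)
    (hne : x ≠ b (P.act x)) : P.gaugeFrom (b (P.act x)) x ∈ Set.Ioo 0 1 := by
  have hb := h.mem _ (h.act_mem x hx)
  have hs := (h.act_base hx).subset
  refine ⟨gaugeFrom_pos hb hs hne, (gaugeFrom_le_one hb hx hs).lt_of_ne fun h1 => ?_⟩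
  exact (act_ssubset_of_gaugeFrom_eq_one hb hx hs h1).ne (h.act_base hx)

theorem transport_succ_base (h : P.IsBase A b) (k : ℕ) {S : Set ι} (hS : S ∈ A) :
    transport P b b' (k + 1) (b S) = b' S := by
  rw [transport, h.act_eq S hS, gaugeFrom_self, zero_smul, add_zero]

/-- Away from the base point, the image lies strictly between the new base point and the image of
the exit point. Its tight set is therefore the intersection of theirs, which is that of the base
point. -/
theorem transport_mem (h : P.IsBase A b) (h' : Q.IsBase A b') (k : ℕ) :
    ∀ x ∈ P.carrier, (P.act x)ᶜ.ncard < k →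
      transport P b b' k x ∈ Q.carrier ∧ Q.act (transport P b b' k x) = P.act x := by
  induction k with
  | zero => intro x _ hk; exact absurd hk (Nat.not_lt_zero _)
  | succ k ih =>
    intro x hx hk
    have hA := h.act_mem x hx
    by_cases hne : x = b (P.act x)
    · rw [hne, transport_succ_base h k hA, h.act_base hx]
      exact ⟨h'.mem _ hA, h'.act_eq _ hA⟩
    · have hss := h.act_ssubset hx hne
      have hlt := ncard_compl_lt hss
      obtain ⟨hz, hza⟩ := ih _ (h.exitPoint_mem hx) (by omega)
      obtain ⟨hg0, hg1⟩ := h.gaugeFrom_mem_Ioo hx hne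
      rw [transport]
      refine ⟨Q.convex_comb_mem (h'.mem _ hA) hz hg0.le hg1.le, ?_⟩
      rw [Q.act_convex_comb (h'.mem _ hA) hz hg0 hg1, hza, h'.act_eq _ hA,
        Set.inter_eq_left.2 hss.1]

/-- Transport preserves gauges and commutes with exit points: the image of an exit point lies on
more facets than the base point, hence has gauge `1`, and the gauge is homogeneous along rays.
Applying the inverse construction then undoes each cone in turn. -/
theorem transport_transport (h : P.IsBase A b) (h' : Q.IsBase A b') (k : ℕ) :
    ∀ x ∈ P.carrier, (P.act x)ᶜ.ncard < k →
      transport Q b' b k (transport P b b' k x) = x := by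
  induction k with
  | zero => intro x _ hk; exact absurd hk (Nat.not_lt_zero _)
  | succ k ih =>
    intro x hx hk
    have hA := h.act_mem x hx
    by_cases hne : x = b (P.act x)
    · rw [hne, transport_succ_base h k hA, transport_succ_base h' k hA]
    · have hss := h.act_ssubset hx hne
      have hlt := ncard_compl_lt hss
      have hy := h.exitPoint_mem hx
      obtain ⟨hz, hza⟩ := transport_mem h h' k _ hy (by omega)
      have hinv := ih _ hy (by omega)
      have hact := (transport_mem h h' (k + 1) x hx hk).2
      obtain ⟨hg0, hg1⟩ := h.gaugeFrom_mem_Ioo hx hne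
      have hb' := h'.mem _ hA
      have hg : Q.gaugeFrom (b' (P.act x)) (transport P b b' (k + 1) x) =
          P.gaugeFrom (b (P.act x)) x := by
        rw [transport, gaugeFrom_smul _ _ hg0.le, gaugeFrom_eq_one hb' hz, mul_one]
        rw [h'.act_eq _ hA, hza]
        exact hss
      have he : Q.exitPoint (b' (P.act x)) (transport P b b' (k + 1) x) =
          transport P b b' k (P.exitPoint (b (P.act x)) x) := by
        rw [exitPoint, hg, transport, add_sub_cancel_left, smul_smul, inv_mul_cancel₀ hg0.ne',
          one_smul, add_sub_cancel]
      rw [transport, hact, hg, he, hinv]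
      exact ray_exitPoint (h.mem _ hA) (h.act_base hx).subset

/-- Once the depth exceeds the number of facets missed, the recursion is stationary. One depth can
thus serve for all points. -/
theorem transport_succ (h : P.IsBase A b) (k : ℕ) :
    ∀ x ∈ P.carrier, (P.act x)ᶜ.ncard < k →
      transport P b b' (k + 1) x = transport P b b' k x := by
  induction k with
  | zero => intro x _ hk; exact absurd hk (Nat.not_lt_zero _)
  | succ k ih =>
    intro x hx hk
    by_cases hne : x = b (P.act x)
    · rw [hne, transport_succ_base h _ (h.act_mem x hx), transport_succ_base h _ (h.act_mem x hx)]
    · have hlt := ncard_compl_lt (h.act_ssubset hx hne)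
      rw [transport, ih _ (h.exitPoint_mem hx) (by omega)]
      rfl

/-- A depth of the recursion that suffices for every point. -/
noncomputable def fullDepth (ι : Type*) : ℕ := Nat.card ι + 1

omit [Fintype ι] in
theorem ncard_lt_fullDepth [Finite ι] (S : Set ι) : S.ncard < fullDepth ι :=
  Nat.lt_succ_of_le (Set.ncard_le_card S)

/-- The cone formula based at `b S` holds on the whole closed face, not only in its relative
interior: on the boundary the gauge is `1` and the exit point is the point itself. This uniform
formula is what makes continuity on closed faces accessible. -/
theorem transport_face (h : P.IsBase A b) {S : Set ι} (hS : S ∈ A) {x : E n}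
    (hx : x ∈ P.carrier) (hSx : S ⊆ P.act x) :
    transport P b b' (fullDepth ι) x = b' S + P.gaugeFrom (b S) x •
      (transport P b b' (fullDepth ι) (P.exitPoint (b S) x) - b' S) := by
  rcases eq_or_ne S (P.act x) with rfl | hne
  · rw [← transport_succ h _ x hx (ncard_lt_fullDepth _)]
    rfl
  · have hss : P.act (b S) ⊂ P.act x := by
      rw [h.act_eq S hS]; exact hSx.ssubset_of_ne hne
    rw [gaugeFrom_eq_one (h.mem S hS) hx hss, exitPoint_eq_self (h.mem S hS) hx hss, one_smul,
      add_sub_cancel]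

omit [Fintype ι] in
theorem isClosed_face (P : ConvexPolytope n ι) (S : Set ι) :
    IsClosed {x | x ∈ P.carrier ∧ S ⊆ P.act x} := by
  have : {x | x ∈ P.carrier ∧ S ⊆ P.act x} =
      P.carrier ∩ ⋂ i ∈ S, {x | inner ℝ (P.normal i) x = P.offset i} := by
    ext x
    simp [Set.subset_def, mem_act]
  rw [this]
  refine P.isClosed_carrier.inter (isClosed_biInter fun i _ => ?_)
  exact isClosed_eq (by fun_prop) continuous_const

/-- Induction on the number of facets outside `S`. Away from `b S` the exit point depends
continuously on `x` and lands in the finite union of the smaller closed faces, where continuity is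
known by induction. -/
theorem continuousOn_transport_face (h : P.IsBase A b) (h' : Q.IsBase A b') (k : ℕ) :
    ∀ S ∈ A, Sᶜ.ncard < k →
      ContinuousOn (transport P b b' (fullDepth ι)) {x | x ∈ P.carrier ∧ S ⊆ P.act x} := by
  induction k with
  | zero => intro S _ hk; exact absurd hk (Nat.not_lt_zero _)
  | succ k ih =>
    intro S hS hk
    have hb := h.mem S hS
    have hbd : ContinuousOn (transport P b b' (fullDepth ι))
        (⋃ T : {T : Set ι // T ∈ A ∧ S ⊂ T}, {x | x ∈ P.carrier ∧ T.1 ⊆ P.act x}) := by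
      refine (locallyFinite_of_finite _).continuousOn_iUnion (fun T => isClosed_face P T.1) ?_
      rintro ⟨T, hT, hST⟩
      have := ncard_compl_lt hST
      exact ih T hT (by omega)
    have hmaps : Set.MapsTo (P.exitPoint (b S)) ({x | x ∈ P.carrier ∧ S ⊆ P.act x} \ {b S})
        (⋃ T : {T : Set ι // T ∈ A ∧ S ⊂ T}, {x | x ∈ P.carrier ∧ T.1 ⊆ P.act x}) := by
      rintro x ⟨⟨hx, hSx⟩, hne⟩
      have hsub : P.act (b S) ⊆ P.act x := by rwa [h.act_eq S hS]
      have hss := act_ssubset_exitPoint hb hsub hne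
      rw [h.act_eq S hS] at hss
      have hm := exitPoint_mem hb hsub
      exact Set.mem_iUnion.2 ⟨⟨_, h.act_mem _ hm, hss⟩, hm, subset_rfl⟩
    intro x₀ hx₀
    have hform : ∀ x ∈ {x | x ∈ P.carrier ∧ S ⊆ P.act x},
        transport P b b' (fullDepth ι) x = b' S + P.gaugeFrom (b S) x •
          (transport P b b' (fullDepth ι) (P.exitPoint (b S) x) - b' S) :=
      fun x hx => transport_face h hS hx.1 hx.2
    refine ContinuousWithinAt.congr ?_ hform (hform x₀ hx₀)
    by_cases hne : x₀ = b S
    -- The exit point has no limit at the base point, but its image stays in a bounded set while the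
    -- gauge factor tends to zero.
    · subst hne
      obtain ⟨C, hC⟩ := isBounded_iff_forall_norm_le.1 Q.bounded
      have h0 : Filter.Tendsto (fun x => P.gaugeFrom (b S) x * (C + ‖b' S‖))
          (nhdsWithin (b S) {x | x ∈ P.carrier ∧ S ⊆ P.act x}) (nhds 0) := by
        have := ((P.continuous_gaugeFrom (b S)).mul
          (continuous_const (y := C + ‖b' S‖))).tendsto (b S)
        rw [Pi.mul_apply, gaugeFrom_self, zero_mul] at this
        exact this.mono_left nhdsWithin_le_nhds
      rw [ContinuousWithinAt, gaugeFrom_self, zero_smul, add_zero]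
      suffices hlim : Filter.Tendsto (fun x => P.gaugeFrom (b S) x •
          (transport P b b' (fullDepth ι) (P.exitPoint (b S) x) - b' S))
          (nhdsWithin (b S) {x | x ∈ P.carrier ∧ S ⊆ P.act x}) (nhds 0) by
        simpa using (tendsto_const_nhds (x := b' S)).add hlim
      refine squeeze_zero_norm' ?_ h0
      filter_upwards [self_mem_nhdsWithin] with x hx
      rw [norm_smul, Real.norm_of_nonneg (P.gaugeFrom_nonneg _ _)]
      refine mul_le_mul_of_nonneg_left ?_ (P.gaugeFrom_nonneg _ _)
      refine (norm_sub_le _ _).trans (add_le_add_left (hC _ ?_) _)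
      have hm : P.exitPoint (b S) x ∈ P.carrier :=
        exitPoint_mem hb (by rw [h.act_eq S hS]; exact hx.2)
      exact (transport_mem h h' _ _ hm (ncard_lt_fullDepth _)).1
    · have hsub : P.act (b S) ⊆ P.act x₀ := by rw [h.act_eq S hS]; exact hx₀.2
      have hg := gaugeFrom_pos hb hsub hne
      have hcg := P.continuous_gaugeFrom (b S)
      have hexit : ContinuousAt (P.exitPoint (b S)) x₀ := by
        unfold exitPoint
        exact continuousAt_const.add ((hcg.continuousAt.inv₀ hg.ne').smul
          (continuousAt_id.sub continuousAt_const))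
      have hmem : x₀ ∈ {x | x ∈ P.carrier ∧ S ⊆ P.act x} \ {b S} := ⟨hx₀, hne⟩
      have hcomp := (hbd _ (hmaps hmem)).comp hexit.continuousWithinAt hmaps
      have hcomp' : ContinuousWithinAt
          (fun x => transport P b b' (fullDepth ι) (P.exitPoint (b S) x))
          {x | x ∈ P.carrier ∧ S ⊆ P.act x} x₀ := by
        refine hcomp.mono_of_mem_nhdsWithin ?_
        exact Filter.inter_mem self_mem_nhdsWithin
          (nhdsWithin_le_nhds (isOpen_compl_singleton.mem_nhds hne))
      exact continuousWithinAt_const.add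
        (hcg.continuousAt.continuousWithinAt.smul (hcomp'.sub continuousWithinAt_const))

theorem continuousOn_transport (h : P.IsBase A b) (h' : Q.IsBase A b') :
    ContinuousOn (transport P b b' (fullDepth ι)) P.carrier := by
  have hU : P.carrier = ⋃ S : A, {x | x ∈ P.carrier ∧ S.1 ⊆ P.act x} := by
    ext x
    refine ⟨fun hx => Set.mem_iUnion.2 ⟨⟨_, h.act_mem x hx⟩, hx, subset_rfl⟩, fun hx => ?_⟩
    obtain ⟨S, hS⟩ := Set.mem_iUnion.1 hx
    exact hS.1
  rw [hU]
  refine (locallyFinite_of_finite _).continuousOn_iUnion (fun S => isClosed_face P S.1) ?_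
  rintro ⟨S, hS⟩
  exact continuousOn_transport_face h h' _ S hS (ncard_lt_fullDepth _)

/-- Polytopes with the same incidences between points and facets are homeomorphic, by a map that
respects the facets. -/
theorem exists_homeomorph_of_isBase (h : P.IsBase A b) (h' : Q.IsBase A b') :
    ∃ e : P.carrier ≃ₜ Q.carrier, ∀ x, Q.act (e x) = P.act x := by
  have hm := fun x : P.carrier => transport_mem h h' (fullDepth ι) x x.2 (ncard_lt_fullDepth _)
  have hm' := fun x : Q.carrier => transport_mem h' h (fullDepth ι) x x.2 (ncard_lt_fullDepth _)
  let f : P.carrier ≃ Q.carrier :=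
    ⟨fun x => ⟨_, (hm x).1⟩, fun x => ⟨_, (hm' x).1⟩,
      fun x => Subtype.ext (transport_transport h h' _ x x.2 (ncard_lt_fullDepth _)),
      fun x => Subtype.ext (transport_transport h' h _ x x.2 (ncard_lt_fullDepth _))⟩
  exact ⟨⟨f, (continuousOn_iff_continuous_domRestrict.1 (continuousOn_transport h h')).subtype_mk _,
    (continuousOn_iff_continuous_domRestrict.1 (continuousOn_transport h' h)).subtype_mk _⟩,
    fun x => (hm x).2⟩

end Transport

/-- The polytope with its facets relabelled. -/
def relabel {κ : Type*} (P : ConvexPolytope n ι) (σ : κ ≃ ι) : ConvexPolytope n κ where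
  normal := P.normal ∘ σ
  offset := P.offset ∘ σ
  bounded := by
    convert P.bounded using 1
    ext x
    exact σ.forall_congr_left (p := fun i => inner ℝ (P.normal (σ i)) x ≤ P.offset (σ i)) |>.trans
      (by simp)
  exists_interior_point := by
    obtain ⟨x, hx⟩ := P.exists_interior_point
    exact ⟨x, fun i => hx _⟩
  exists_facet_point := fun i => by
    obtain ⟨x, hx, hx'⟩ := P.exists_facet_point (σ i)
    exact ⟨x, hx, fun j hj => hx' _ (σ.injective.ne hj)⟩

theorem carrier_relabel {κ : Type*} (P : ConvexPolytope n ι) (σ : κ ≃ ι) :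
    (P.relabel σ).carrier = P.carrier := by
  ext x
  exact σ.forall_congr_left (p := fun i => inner ℝ (P.normal (σ i)) x ≤ P.offset (σ i)) |>.trans
    (by simp [carrier])

/-- A bijection between the facets that respects the incidences with points is induced by a
homeomorphism. -/
theorem exists_homeomorph_of_act {κ : Type*} [Finite ι] (P : ConvexPolytope n ι)
    (Q : ConvexPolytope m κ) (σ : ι ≃ κ)
    (h : ∀ S : Set ι, (∃ x ∈ P.carrier, P.act x = S) ↔ ∃ y ∈ Q.carrier, Q.act y = σ '' S) :
    ∃ e : P.carrier ≃ₜ Q.carrier, ∀ x i, σ i ∈ Q.act (e x) ↔ i ∈ P.act x := by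
  have := Fintype.ofFinite ι
  have hact : ∀ y, (Q.relabel σ).act y = σ ⁻¹' Q.act y := fun y => rfl
  let A : Set (Set ι) := {S | ∃ x ∈ P.carrier, P.act x = S}
  have hA : ∀ S ∈ A, ∃ y ∈ (Q.relabel σ).carrier, (Q.relabel σ).act y = S := by
    intro S hS
    obtain ⟨y, hy, hyS⟩ := (h S).1 hS
    refine ⟨y, by rwa [carrier_relabel], ?_⟩
    rw [hact, hyS, σ.injective.preimage_image]
  have hne : ∃ x, x ∈ P.carrier :=
    let ⟨x, hx⟩ := P.exists_interior_point
    ⟨x, fun i => (hx i).le⟩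
  classical
  choose! b hb hbA using fun S (hS : S ∈ A) => hS
  choose! b' hb' hbA' using hA
  have h1 : P.IsBase A b := ⟨fun x hx => ⟨x, hx, rfl⟩, hb, hbA⟩
  have h2 : (Q.relabel σ).IsBase A b' := by
    refine ⟨fun y hy => (h _).2 ⟨y, by rwa [carrier_relabel] at hy, ?_⟩, hb', hbA'⟩
    rw [hact, σ.surjective.image_preimage]
  obtain ⟨e, he⟩ := exists_homeomorph_of_isBase h1 h2
  refine ⟨e.trans (Homeomorph.setCongr (Q.carrier_relabel σ)), fun x i => ?_⟩
  have := Set.ext_iff.1 (he x) i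
  exact this

end ConvexPolytope

end SmallCovers

/-! ### Recovering incidences from the face lattice -/

namespace SmallCovers

namespace ConvexPolytope

variable {n m : ℕ} {ι κ : Type*} (P : ConvexPolytope n ι)

/-- At no point of a polytope are all facet inequalities equalities. -/
theorem act_ne_univ [NeZero n] {x : E n} (hx : x ∈ P.carrier) : P.act x ≠ Set.univ := by
  intro hu
  obtain ⟨p, hp⟩ := P.exists_interior_point
  obtain ⟨v, hv0, hv⟩ : ∃ v : E n, v ≠ 0 ∧ ∀ i, inner ℝ (P.normal i) v ≤ 0 := by
    -- If the interior point is `x` itself, there are no facets at all and any nonzero direction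
    -- serves; one exists since the dimension is positive.
    by_cases hpx : p = x
    · have hempty : ∀ _ : ι, False := fun i => by
        have h1 : i ∈ P.act x := hu ▸ Set.mem_univ i
        rw [mem_act, ← hpx] at h1
        exact (hp i).ne h1
      exact ⟨EuclideanSpace.single 0 1, by simp, fun i => (hempty i).elim⟩
    · refine ⟨p - x, sub_ne_zero.2 hpx, fun i => ?_⟩
      have h1 : i ∈ P.act x := hu ▸ Set.mem_univ i
      rw [mem_act] at h1
      rw [inner_sub_right, h1]
      linarith [hp i]
  obtain ⟨C, hC⟩ := isBounded_iff_forall_norm_le.1 P.bounded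
  have hpos : 0 < ‖v‖ := norm_pos_iff.2 hv0
  have hC0 : 0 ≤ C := (norm_nonneg _).trans (hC x hx)
  have hr : 0 ≤ (2 * C + 1) / ‖v‖ := by positivity
  have h1 := hC (x + ((2 * C + 1) / ‖v‖) • v) fun i => by
    rw [inner_add_right, inner_smul_right]
    have := mul_nonpos_of_nonneg_of_nonpos hr (hv i)
    linarith [hx i]
  have h3 := norm_sub_le (x + ((2 * C + 1) / ‖v‖) • v) x
  rw [add_sub_cancel_left, norm_smul, Real.norm_of_nonneg hr, div_mul_cancel₀ _ hpos.ne'] at h3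
  linarith [hC x hx]

/-- The face lattice. -/
abbrev Face : Type _ := {G : Set (E n) // P.IsFace G}

/-- The face on which the inequalities in `S` are equalities. -/
def faceOf (S : Set ι) : P.Face :=
  ⟨{x | x ∈ P.carrier ∧ ∀ i ∈ S, x ∈ P.facet i}, S, rfl⟩

theorem mem_faceOf {S : Set ι} {x : E n} :
    x ∈ (P.faceOf S).1 ↔ x ∈ P.carrier ∧ S ⊆ P.act x :=
  and_congr_right fun hx => forall₂_congr fun _ _ => and_iff_right hx

theorem exists_eq_faceOf (G : P.Face) : ∃ S, G = P.faceOf S :=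
  let ⟨S, hS⟩ := G.2
  ⟨S, Subtype.ext hS⟩

instance : OrderTop P.Face where
  top := P.faceOf ∅
  le_top G := by
    obtain ⟨S, rfl⟩ := P.exists_eq_faceOf G
    exact fun x hx => ⟨hx.1, fun i hi => hi.elim⟩

theorem mem_top {x : E n} : x ∈ (⊤ : P.Face).1 ↔ x ∈ P.carrier :=
  (P.mem_faceOf (S := ∅)).trans (and_iff_left (Set.empty_subset _))

theorem exists_act_eq_singleton (i : ι) : ∃ x ∈ P.carrier, P.act x = {i} := by
  obtain ⟨x, hx, hx'⟩ := P.exists_facet_point i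
  have hact : ∀ j, j ∈ P.act x → j = i := fun j hj => by
    by_contra hji
    exact (hx' j hji).ne hj
  refine ⟨x, fun j => ?_, Set.ext fun j => ⟨hact j, ?_⟩⟩
  · by_cases hji : j = i
    · rw [hji, hx]
    · exact (hx' j hji).le
  · rintro rfl
    exact hx

/-- A face above facet `i` contains the point lying on no other facet, so its defining set is
contained in `{i}`. Being order-theoretic, this description makes a lattice isomorphism permute
facets. -/
theorem isCoatom_iff {G : P.Face} : IsCoatom G ↔ ∃ i, G = P.faceOf {i} := by
  have hne : ∀ i, P.faceOf {i} ≠ ⊤ := fun i h => by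
    obtain ⟨p, hp⟩ := P.exists_interior_point
    have h1 : p ∈ (P.faceOf {i}).1 := h ▸ P.mem_top.2 fun j => (hp j).le
    exact (hp i).ne ((P.mem_faceOf.1 h1).2 rfl)
  constructor
  · intro h
    obtain ⟨S, rfl⟩ := P.exists_eq_faceOf G
    obtain ⟨i, hi⟩ : S.Nonempty := by
      rw [Set.nonempty_iff_ne_empty]
      rintro rfl
      exact h.1 rfl
    refine ⟨i, ?_⟩
    have hle : P.faceOf S ≤ P.faceOf {i} := fun x hx => by
      rw [mem_faceOf] at hx ⊢
      exact ⟨hx.1, (Set.singleton_subset_iff.2 hi).trans hx.2⟩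
    rcases hle.eq_or_lt with h' | h'
    · exact h'
    · exact (hne i (h.2 _ h')).elim
  · rintro ⟨i, rfl⟩
    refine ⟨hne i, fun G hG => ?_⟩
    obtain ⟨S, rfl⟩ := P.exists_eq_faceOf G
    obtain ⟨x, hx, hxi⟩ := P.exists_act_eq_singleton i
    have h1 : x ∈ (P.faceOf S).1 := hG.le (P.mem_faceOf.2 ⟨hx, hxi.ge⟩)
    have h2 : S ⊆ {i} := hxi ▸ (P.mem_faceOf.1 h1).2
    rcases Set.subset_singleton_iff_eq.1 h2 with rfl | rfl
    · rfl
    · exact absurd hG (lt_irrefl _)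

theorem faceOf_singleton_injective : Function.Injective fun i => P.faceOf {i} := by
  intro i j h
  obtain ⟨x, hx, hxi⟩ := P.exists_act_eq_singleton i
  have h1 : x ∈ (P.faceOf {j}).1 :=
    (show P.faceOf {i} = P.faceOf {j} from h) ▸ P.mem_faceOf.2 ⟨hx, hxi.ge⟩
  have h2 := (P.mem_faceOf.1 h1).2
  rw [hxi, Set.singleton_subset_singleton] at h2
  exact h2.symm

/-- Choose `x` in the face with minimal tight set. The midpoint of `x` and another point `y` of the
face has as tight set the intersection of theirs, so minimality puts the tight set of `x` inside
that of `y`. -/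
theorem exists_relint_point [Finite ι] {G : P.Face} (hG : G.1.Nonempty) :
    ∃ x ∈ P.carrier, G = P.faceOf (P.act x) := by
  obtain ⟨S, rfl⟩ := P.exists_eq_faceOf G
  obtain ⟨T, ⟨⟨x, hx, rfl⟩, hmin⟩⟩ := (Set.toFinite (P.act '' (P.faceOf S).1)).exists_minimal
    (hG.image _)
  have hx' := P.mem_faceOf.1 hx
  refine ⟨x, hx'.1, Subtype.ext (Set.ext fun y => ?_)⟩
  rw [mem_faceOf, mem_faceOf]
  refine ⟨fun hy' => ?_, fun hy => ⟨hy.1, hx'.2.trans hy.2⟩⟩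
  have hmid := P.act_convex_comb hx'.1 hy'.1 (t := 1 / 2) (by norm_num) (by norm_num)
  have hmem : x + (1 / 2 : ℝ) • (y - x) ∈ (P.faceOf S).1 := by
    refine P.mem_faceOf.2 ⟨P.convex_comb_mem hx'.1 hy'.1 (by norm_num) (by norm_num), ?_⟩
    rw [hmid]
    exact Set.subset_inter hx'.2 hy'.2
  have h1 := hmin ⟨_, hmem, rfl⟩ (by rw [hmid]; exact Set.inter_subset_left)
  rw [hmid] at h1
  exact ⟨hy'.1, h1.trans Set.inter_subset_right⟩

theorem faceOf_act_le_iff {x : E n} (hx : x ∈ P.carrier) {i : ι} :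
    P.faceOf (P.act x) ≤ P.faceOf {i} ↔ i ∈ P.act x := by
  constructor
  · intro h
    have h1 : x ∈ (P.faceOf {i}).1 := h (P.mem_faceOf.2 ⟨hx, subset_rfl⟩)
    exact (P.mem_faceOf.1 h1).2 rfl
  · intro h w hw
    rw [mem_faceOf] at hw ⊢
    exact ⟨hw.1, Set.singleton_subset_iff.2 (hw.2 h)⟩

variable {P} {Q : ConvexPolytope m κ}

/-- The smallest face containing `x` is sent to a face whose relative interior supplies `y`; lying
on a facet is then a comparison in the face lattice. It remains to exclude that the image is empty.
-/
theorem exists_act_of_faceIso [NeZero n] [Finite κ] (Φ : P.Face ≃o Q.Face)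
    (σ : ι → κ) (hσ : ∀ i, Φ (P.faceOf {i}) = Q.faceOf {σ i}) {x : E n} (hx : x ∈ P.carrier) :
    ∃ y ∈ Q.carrier, ∀ i, σ i ∈ Q.act y ↔ i ∈ P.act x := by
  have hne : (Φ (P.faceOf (P.act x))).1.Nonempty := by
    by_contra hemp
    rw [Set.not_nonempty_iff_eq_empty] at hemp
    -- An empty image lies below every face, in particular below the image of the intersection of
    -- all facets. Pulling back, `x` would lie on all facets.
    have h1 : Φ (P.faceOf (P.act x)) ≤ Φ (P.faceOf Set.univ) := by
      intro y hy
      rw [hemp] at hy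
      exact hy.elim
    have h2 : x ∈ (P.faceOf Set.univ).1 :=
      Φ.le_iff_le.1 h1 (P.mem_faceOf.2 ⟨hx, subset_rfl⟩)
    exact P.act_ne_univ hx (Set.univ_subset_iff.1 (P.mem_faceOf.1 h2).2)
  obtain ⟨y, hy, hyG⟩ := Q.exists_relint_point hne
  refine ⟨y, hy, fun i => ?_⟩
  rw [← Q.faceOf_act_le_iff hy, ← P.faceOf_act_le_iff hx, ← hyG, ← hσ, Φ.le_iff_le]

/-- A combinatorial equivalence is induced by a homeomorphism that respects the facets. -/
theorem CombEquiv.exists_homeomorph [NeZero n] [NeZero m] [Finite ι] [Finite κ]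
    (h : P.CombEquiv Q) : ∃ (σ : ι ≃ κ) (e : P.carrier ≃ₜ Q.carrier),
      ∀ x i, σ i ∈ Q.act (e x) ↔ i ∈ P.act x := by
  obtain ⟨Φ⟩ := h
  have hΦ : ∀ i, ∃ k, Φ (P.faceOf {i}) = Q.faceOf {k} := fun i =>
    Q.isCoatom_iff.1 ((Φ.isCoatom_iff _).2 (P.isCoatom_iff.2 ⟨i, rfl⟩))
  choose σ hσ using hΦ
  have hb : Function.Bijective σ := by
    constructor
    · intro i j hij
      apply P.faceOf_singleton_injective
      apply Φ.injective
      change Φ (P.faceOf {i}) = Φ (P.faceOf {j})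
      rw [hσ, hσ, hij]
    · intro k
      obtain ⟨i, hi⟩ := P.isCoatom_iff.1 ((Φ.symm.isCoatom_iff _).2 (Q.isCoatom_iff.2 ⟨k, rfl⟩))
      refine ⟨i, Q.faceOf_singleton_injective ?_⟩
      change Q.faceOf {σ i} = Q.faceOf {k}
      rw [← hσ, ← hi, Φ.apply_symm_apply]
  let τ : ι ≃ κ := Equiv.ofBijective σ hb
  have hτ : ∀ k, Φ.symm (Q.faceOf {k}) = P.faceOf {τ.symm k} := fun k => by
    have h1 := hσ (τ.symm k)
    rw [show σ (τ.symm k) = k from τ.apply_symm_apply k] at h1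
    rw [← h1, Φ.symm_apply_apply]
  obtain ⟨e, he⟩ := exists_homeomorph_of_act P Q τ fun S => by
    constructor
    · rintro ⟨x, hx, rfl⟩
      obtain ⟨y, hy, hyx⟩ := exists_act_of_faceIso Φ σ hσ hx
      refine ⟨y, hy, Set.ext fun k => ?_⟩
      obtain ⟨i, rfl⟩ := τ.surjective k
      rw [τ.injective.mem_set_image]
      exact hyx i
    · rintro ⟨y, hy, hyS⟩
      obtain ⟨x, hx, hxy⟩ := exists_act_of_faceIso Φ.symm τ.symm hτ hy
      refine ⟨x, hx, Set.ext fun i => ?_⟩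
      have h1 := hxy (τ i)
      rw [τ.symm_apply_apply, hyS, τ.injective.mem_set_image] at h1
      exact h1
  exact ⟨τ, e, he⟩

/-- A point of a polytope that is determined by the facets containing it is a vertex. -/
theorem mem_extremePoints_of_act {v : E n} (hv : v ∈ P.carrier)
    (h : ∀ x ∈ P.carrier, P.act v ⊆ P.act x → x = v) : v ∈ P.carrier.extremePoints ℝ := by
  refine mem_extremePoints.2 ⟨hv, fun x hx y hy hxy => ?_⟩
  have hact : P.act v = P.act x ∩ P.act y := by
    rw [openSegment_eq_image'] at hxy
    obtain ⟨t, ht, rfl⟩ := hxy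
    exact P.act_convex_comb hx hy ht.1 ht.2
  exact ⟨h x hx (hact ▸ Set.inter_subset_left), h y hy (hact ▸ Set.inter_subset_right)⟩

theorem colorSpan_eq (c : ι → (Fin n → ZMod 2)) {x : E n} (hx : x ∈ P.carrier) :
    P.colorSpan c x = Submodule.span (ZMod 2) (c '' P.act x) := by
  unfold colorSpan
  congr 2
  ext i
  exact and_iff_right hx

/-- The colors of the facets through a vertex `w` of a combinatorially equivalent polytope are
linearly independent. -/
theorem IsColoring.linearIndependent {c : ι → (Fin n → ZMod 2)} (hc : P.IsColoring c)
    (σ : ι ≃ κ) (e : P.carrier ≃ₜ Q.carrier) (he : ∀ x i, σ i ∈ Q.act (e x) ↔ i ∈ P.act x)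
    {w : E m} (hw : w ∈ Q.carrier) (hpin : ∀ y ∈ Q.carrier, Q.act w ⊆ Q.act y → y = w)
    {α : Type*} (f : α → κ) (hf : Function.Injective f) (hfw : ∀ a, f a ∈ Q.act w) :
    LinearIndependent (ZMod 2) fun a => c (σ.symm (f a)) := by
  set v : P.carrier := e.symm ⟨w, hw⟩ with hv
  have hev : e v = ⟨w, hw⟩ := e.apply_symm_apply _
  have hact : ∀ i, i ∈ P.act v ↔ σ i ∈ Q.act w := fun i => by rw [← he v i, hev]
  have hext : (v : E n) ∈ P.carrier.extremePoints ℝ := by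
    refine mem_extremePoints_of_act v.2 fun x hx hsub => ?_
    have h1 : (e ⟨x, hx⟩ : E m) = w := hpin _ (e ⟨x, hx⟩).2 fun k hk => by
      obtain ⟨i, rfl⟩ := σ.surjective k
      exact (he _ i).2 (hsub ((hact i).2 hk))
    have h2 : e ⟨x, hx⟩ = e v := by rw [hev]; exact Subtype.ext h1
    exact congrArg Subtype.val (e.injective h2)
  have hli := hc.2 v hext
  exact hli.comp (fun a => ⟨σ.symm (f a), v.2, (hact _).2 (by simpa using hfw a)⟩)
    fun a a' haa => hf (σ.symm.injective (congrArg Subtype.val haa))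

end ConvexPolytope

end SmallCovers

/-! ### Real projective space in homogeneous coordinates -/

namespace SmallCovers

namespace RealProjectiveSpace

variable {n : ℕ}

theorem continuous_mk : Continuous (Quotient.mk (antipodal n)) := continuous_quotient_mk'

/-- The point of projective space with homogeneous coordinates `v`. -/
noncomputable def proj (v : E (n + 1)) (hv : v ≠ 0) : RealProjectiveSpace n :=
  Quotient.mk (antipodal n) ⟨‖v‖⁻¹ • v, by simp [norm_smul, hv]⟩

theorem continuous_proj {X : Type*} [TopologicalSpace X] {f : X → E (n + 1)} (hf : Continuous f)
    (h0 : ∀ x, f x ≠ 0) : Continuous fun x => proj (f x) (h0 x) := by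
  refine continuous_mk.comp (Continuous.subtype_mk ?_ _)
  exact (hf.norm.inv₀ fun x => norm_ne_zero_iff.2 (h0 x)).smul hf

/-- After normalization the scalar becomes `±1`, which is the antipodal relation. That `r` is
nonzero need not be required, since `v ≠ 0`. -/
theorem proj_eq_proj_iff {v w : E (n + 1)} {hv : v ≠ 0} {hw : w ≠ 0} :
    proj v hv = proj w hw ↔ ∃ r : ℝ, v = r • w := by
  have hv' := norm_ne_zero_iff.2 hv
  have hw' := norm_ne_zero_iff.2 hw
  have key : proj v hv = proj w hw ↔
      (‖v‖⁻¹ • v = ‖w‖⁻¹ • w ∨ ‖v‖⁻¹ • v = -(‖w‖⁻¹ • w)) := by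
    refine (Quotient.eq (r := antipodal n)).trans (or_congr ?_ ?_)
    · exact Subtype.ext_iff
    · exact Subtype.ext_iff
  rw [key]
  constructor
  · rintro (h | h)
    · refine ⟨‖v‖ * ‖w‖⁻¹, ?_⟩
      rw [mul_smul, ← h, smul_smul, mul_inv_cancel₀ hv', one_smul]
    · refine ⟨-(‖v‖ * ‖w‖⁻¹), ?_⟩
      rw [neg_smul, mul_smul, ← smul_neg, ← h, smul_smul, mul_inv_cancel₀ hv', one_smul]
  · rintro ⟨r, rfl⟩
    have hr : r ≠ 0 := fun h => hv (by rw [h, zero_smul])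
    rw [norm_smul, smul_smul, ← neg_smul, Real.norm_eq_abs]
    rcases lt_or_gt_of_ne hr with h | h
    · right
      rw [abs_of_neg h]
      congr 1
      field_simp
    · left
      rw [abs_of_pos h]
      congr 1
      field_simp

theorem exists_proj_eq (p : RealProjectiveSpace n) : ∃ v hv, p = proj v hv := by
  obtain ⟨⟨v, hv⟩, rfl⟩ := Quotient.mk_surjective p
  have h1 : ‖v‖ = 1 := by simpa using hv
  refine ⟨v, fun h => by simp [h] at h1, ?_⟩
  unfold proj
  congr 2
  rw [h1, inv_one, one_smul]

/-- The quadratic functions on projective space. -/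
def quad (i j : Fin (n + 1)) : RealProjectiveSpace n → ℝ :=
  Quotient.lift (fun x : Metric.sphere (0 : E (n + 1)) 1 => x.1 i * x.1 j) <| by
    rintro x y (rfl | rfl)
    · rfl
    · simp

theorem continuous_quad (i j : Fin (n + 1)) : Continuous (quad (n := n) i j) := by
  refine Continuous.quotient_lift ?_ _
  fun_prop

theorem quad_proj (i j : Fin (n + 1)) (v : E (n + 1)) (hv : v ≠ 0) :
    quad i j (proj v hv) = v i * v j / ‖v‖ ^ 2 := by
  change (‖v‖⁻¹ • v) i * (‖v‖⁻¹ • v) j = _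
  simp only [PiLp.smul_apply, smul_eq_mul]
  have := norm_ne_zero_iff.2 hv
  field_simp

/-- The Veronese map, given by all products of two normalized coordinates, is continuous and
injective. -/
instance : T2Space (RealProjectiveSpace n) := by
  refine T2Space.of_injective_continuous
    (f := fun p : RealProjectiveSpace n => fun i : Fin (n + 1) × Fin (n + 1) => quad i.1 i.2 p) ?_
    (continuous_pi fun i => continuous_quad _ _)
  intro p q h
  obtain ⟨v, hv, rfl⟩ := exists_proj_eq p
  obtain ⟨w, hw, rfl⟩ := exists_proj_eq q
  have h' : ∀ i j, v i * v j / ‖v‖ ^ 2 = w i * w j / ‖w‖ ^ 2 := fun i j => by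
    rw [← quad_proj i j v hv, ← quad_proj i j w hw]
    exact congrFun h (i, j)
  obtain ⟨j, hj⟩ : ∃ j, v j ≠ 0 := by
    by_contra hn
    push Not at hn
    exact hv (PiLp.ext hn)
  have hvn := norm_ne_zero_iff.2 hv
  have hwn := norm_ne_zero_iff.2 hw
  -- The scalar is obtained by solving `v i * v j / ‖v‖ ^ 2 = w i * w j / ‖w‖ ^ 2` for `v i`.
  refine proj_eq_proj_iff.2 ⟨w j / ‖w‖ ^ 2 * (‖v‖ ^ 2 / v j), PiLp.ext fun i => ?_⟩
  have := h' i j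
  simp only [PiLp.smul_apply, smul_eq_mul]
  field_simp at this ⊢
  linarith

/-- The vector with first coordinate `s` and remaining coordinates those of `y`. -/
noncomputable def hom (s : ℝ) (y : E 3) : E 4 := !₂[s, y 0, y 1, y 2]

theorem hom_eq_smul_iff {s s' r : ℝ} {y y' : E 3} :
    hom s y = r • hom s' y' ↔ s = r * s' ∧ y = r • y' := by
  constructor
  · intro h
    refine ⟨by simpa [hom] using congrArg (fun v : E 4 => v 0) h, PiLp.ext fun i => ?_⟩
    have h1 := congrArg (fun v : E 4 => v i.succ) h
    fin_cases i <;> simpa [hom] using h1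
  · rintro ⟨rfl, rfl⟩
    ext i
    fin_cases i <;> simp [hom]

theorem hom_eq_zero_iff {s : ℝ} {y : E 3} : hom s y = 0 ↔ s = 0 ∧ y = 0 := by
  have := hom_eq_smul_iff (s := s) (s' := 0) (r := 0) (y := y) (y' := 0)
  simpa using this

theorem exists_eq_hom (v : E 4) : ∃ s y, v = hom s y := by
  refine ⟨v 0, !₂[v 1, v 2, v 3], ?_⟩
  ext i
  fin_cases i <;> simp [hom]

theorem exists_proj_hom_eq (b : RealProjectiveSpace 3) :
    ∃ s y, 0 ≤ s ∧ ∃ hv, b = proj (hom s y) hv := by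
  obtain ⟨v, hv, rfl⟩ := exists_proj_eq b
  obtain ⟨s, y, rfl⟩ := exists_eq_hom v
  rcases le_total 0 s with hs | hs
  · exact ⟨s, y, hs, hv, rfl⟩
  · refine ⟨-s, -y, by linarith, fun h0 => hv ?_, proj_eq_proj_iff.2 ⟨-1, ?_⟩⟩
    · obtain ⟨h1, h2⟩ := hom_eq_zero_iff.1 h0
      exact hom_eq_zero_iff.2 ⟨by linarith, neg_eq_zero.1 h2⟩
    · exact hom_eq_smul_iff.2 ⟨by ring, by simp⟩

theorem continuous_hom {X : Type*} [TopologicalSpace X] {f : X → ℝ} {g : X → E 3}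
    (hf : Continuous f) (hg : Continuous g) : Continuous fun x => hom (f x) (g x) := by
  refine (PiLp.continuous_toLp 2 _).comp (continuous_pi fun i => ?_)
  have h : ∀ j, Continuous fun x => g x j := fun j => by fun_prop
  fin_cases i
  · exact hf
  · exact h 0
  · exact h 1
  · exact h 2

theorem hom_one_ne_zero (x : E 3) : hom 1 x ≠ 0 := fun h => one_ne_zero (hom_eq_zero_iff.1 h).1

/-- The standard affine chart of projective space. -/
noncomputable def chart (x : E 3) : RealProjectiveSpace 3 := proj (hom 1 x) (hom_one_ne_zero x)

/-- The inverse divides the quadratic functions `x₀ xᵢ` by `x₀²`. These are well defined on the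
quotient, so continuity requires no choice of representatives. -/
theorem isOpenEmbedding_chart : Topology.IsOpenEmbedding chart := by
  let inv : RealProjectiveSpace 3 → E 3 := fun p =>
    (quad 0 0 p)⁻¹ • !₂[quad 0 1 p, quad 0 2 p, quad 0 3 p]
  have hq : ∀ x : E 3, quad 0 0 (chart x) ≠ 0 := fun x => by
    rw [chart, quad_proj]
    have := norm_ne_zero_iff.2 (hom_one_ne_zero x)
    simp only [hom] at this ⊢
    simp [this]
  have hl : ∀ x, inv (chart x) = x := fun x => by
    have := norm_ne_zero_iff.2 (hom_one_ne_zero x)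
    simp only [inv, chart, quad_proj]
    ext i
    simp only [hom] at this
    fin_cases i <;> simp [hom] <;> field_simp
  let e : OpenPartialHomeomorph (E 3) (RealProjectiveSpace 3) :=
    { toFun := chart
      invFun := inv
      source := Set.univ
      target := {p | quad 0 0 p ≠ 0}
      map_source' := fun x _ => hq x
      map_target' := fun _ _ => Set.mem_univ _
      left_inv' := fun x _ => hl x
      right_inv' := by
        intro p hp
        obtain ⟨v, hv, rfl⟩ := exists_proj_eq p
        have hvn := norm_ne_zero_iff.2 hv
        have h0 : v 0 ≠ 0 := fun h => hp (by rw [quad_proj, h]; simp)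
        refine proj_eq_proj_iff.2 ⟨(v 0)⁻¹, ?_⟩
        simp only [inv, quad_proj]
        ext i
        fin_cases i <;> simp [hom, h0] <;> field_simp
      open_source := isOpen_univ
      open_target := isOpen_ne_fun (continuous_quad _ _) continuous_const
      continuousOn_toFun :=
        (continuous_proj (continuous_hom continuous_const continuous_id) _).continuousOn
      continuousOn_invFun := by
        refine ContinuousOn.smul
          (ContinuousOn.inv₀ (continuous_quad _ _).continuousOn fun p hp => hp) ?_
        refine Continuous.continuousOn ((PiLp.continuous_toLp 2 _).comp (continuous_pi fun i => ?_))
        fin_cases i <;> exact continuous_quad _ _ }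
  exact e.isOpenEmbedding rfl

theorem chart_eq_proj_iff {x y : E 3} {s : ℝ} (h : hom s y ≠ 0) :
    chart x = proj (hom s y) h ↔ s ≠ 0 ∧ y = s • x := by
  rw [chart, proj_eq_proj_iff]
  constructor
  · rintro ⟨r, hr⟩
    obtain ⟨h1, rfl⟩ := hom_eq_smul_iff.1 hr
    have hs : s ≠ 0 := by rintro rfl; simp at h1
    refine ⟨hs, ?_⟩
    rw [smul_smul, mul_comm, ← h1, one_smul]
  · rintro ⟨hs, rfl⟩
    refine ⟨s⁻¹, hom_eq_smul_iff.2 ⟨(inv_mul_cancel₀ hs).symm, ?_⟩⟩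
    rw [smul_smul, inv_mul_cancel₀ hs, one_smul]

end RealProjectiveSpace

end SmallCovers

/-! ### Coordinate reflections and the `ℓ¹`-ball -/

namespace SmallCovers

/-- The `ℓ¹`-norm. -/
def l1 (x : E 3) : ℝ := ∑ i, |x i|

/-- The reflections in the coordinate planes. -/
noncomputable def flip (g : V3) (x : E 3) : E 3 := WithLp.toLp 2 fun i => sgn (g i) * x i

/-- The coordinatewise absolute value. -/
noncomputable def absVec (x : E 3) : E 3 := WithLp.toLp 2 fun i => |x i|

open Classical in
/-- The signs of the coordinates. -/
noncomputable def signVec (x : E 3) : V3 := fun i => if x i < 0 then 1 else 0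

@[simp] theorem flip_apply (g : V3) (x : E 3) (i : Fin 3) : flip g x i = sgn (g i) * x i := rfl

@[simp] theorem absVec_apply (x : E 3) (i : Fin 3) : absVec x i = |x i| := rfl

theorem continuous_l1 : Continuous l1 := by
  unfold l1
  fun_prop

theorem continuous_absVec : Continuous absVec := by
  refine (PiLp.continuous_toLp 2 _).comp (continuous_pi fun i => ?_)
  fun_prop

theorem continuous_uncurry_flip : Continuous fun p : E 3 × V3 => flip p.2 p.1 := by
  refine (PiLp.continuous_toLp 2 _).comp (continuous_pi fun i => ?_)
  refine Continuous.mul ?_ (by fun_prop)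
  exact (continuous_of_discreteTopology (f := fun g : V3 => sgn (g i))).comp continuous_snd

theorem l1_nonneg (x : E 3) : 0 ≤ l1 x := Finset.sum_nonneg fun _ _ => abs_nonneg _

theorem l1_smul (r : ℝ) (x : E 3) : l1 (r • x) = |r| * l1 x := by
  simp [l1, abs_mul, Finset.mul_sum]

@[simp] theorem l1_flip (g : V3) (x : E 3) : l1 (flip g x) = l1 x := by
  simp [l1, abs_mul]

@[simp] theorem l1_absVec (x : E 3) : l1 (absVec x) = l1 x := by
  simp [l1]

theorem l1_eq_zero {x : E 3} : l1 x = 0 ↔ x = 0 := by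
  rw [l1, Finset.sum_eq_zero_iff_of_nonneg fun i _ => abs_nonneg _]
  exact ⟨fun h => PiLp.ext fun i => abs_eq_zero.1 (h i (Finset.mem_univ i)),
    fun h i _ => by simp [h]⟩

theorem l1_pos {x : E 3} (h : x ≠ 0) : 0 < l1 x :=
  (l1_nonneg x).lt_of_ne fun h0 => h (l1_eq_zero.1 h0.symm)

@[simp] theorem norm_flip (g : V3) (x : E 3) : ‖flip g x‖ = ‖x‖ := by
  simp [EuclideanSpace.norm_eq, ← abs_pow]

theorem norm_le_l1 (x : E 3) : ‖x‖ ≤ l1 x := by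
  rw [EuclideanSpace.norm_eq, l1]
  refine Real.sqrt_le_iff.2 ⟨l1_nonneg x, ?_⟩
  simp only [Fin.sum_univ_three, Real.norm_eq_abs]
  have := abs_nonneg (x 0)
  have := abs_nonneg (x 1)
  have := abs_nonneg (x 2)
  nlinarith [mul_nonneg (abs_nonneg (x 0)) (abs_nonneg (x 1)),
    mul_nonneg (abs_nonneg (x 0)) (abs_nonneg (x 2)),
    mul_nonneg (abs_nonneg (x 1)) (abs_nonneg (x 2))]

theorem l1_le_norm (x : E 3) : l1 x ≤ 3 * ‖x‖ := by
  have h : ∀ i, |x i| ≤ ‖x‖ := fun i => PiLp.norm_apply_le x i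
  simp only [l1, Fin.sum_univ_three]
  linarith [h 0, h 1, h 2]

theorem flip_smul (g : V3) (r : ℝ) (x : E 3) : flip g (r • x) = r • flip g x := by
  ext i
  simp only [flip_apply, PiLp.smul_apply, smul_eq_mul]
  ring

/-- The color `(1, 1, 1)` acts as the antipodal map; this is the source of every projective space
that is split off below. -/
theorem flip_add_one (g : V3) (x : E 3) : flip (g + 1) x = -flip g x := by
  ext i
  simp [sgn_add]

theorem flip_signVec_absVec (x : E 3) : flip (signVec x) (absVec x) = x := by
  ext i
  simp only [flip_apply, absVec_apply, signVec]
  split_ifs with h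
  · simp [abs_of_neg h]
  · simp [abs_of_nonneg (not_lt.1 h)]

theorem absVec_flip {g : V3} {x : E 3} (hx : ∀ i, 0 ≤ x i) : absVec (flip g x) = x := by
  ext i
  simp [abs_mul, abs_of_nonneg (hx i)]

theorem flip_eq_flip_iff {g h : V3} {x : E 3} :
    flip g x = flip h x ↔ ∀ i, x i ≠ 0 → (g - h) i = 0 := by
  constructor
  · intro H i hi
    have h1 : sgn (g i) * x i = sgn (h i) * x i := congrArg (fun v : E 3 => v i) H
    simp [sgn_injective (mul_right_cancel₀ hi h1)]
  · intro H
    ext i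
    by_cases hi : x i = 0
    · simp [hi]
    · simp [sub_eq_zero.1 (H i hi)]

theorem flip_eq_neg_flip_iff {g h : V3} {x : E 3} :
    flip g x = -flip h x ↔ ∀ i, x i ≠ 0 → (g - h) i = 1 := by
  rw [← flip_add_one, flip_eq_flip_iff]
  refine forall_congr' fun i => imp_congr_right fun _ => ?_
  simp only [Pi.sub_apply, Pi.add_apply, Pi.one_apply]
  generalize g i = a
  generalize h i = b
  revert a b
  decide

theorem eq_of_flip_eq_flip {g h : V3} {x y : E 3} (hx : ∀ i, 0 ≤ x i) (hy : ∀ i, 0 ≤ y i)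
    (H : flip g x = flip h y) : x = y := by
  rw [← absVec_flip (g := g) hx, H, absVec_flip hy]

/-- A bounded factor times `x` tends to zero at the origin, so a discontinuity of the factor there
is harmless. -/
theorem continuous_smul_self {f : E 3 → ℝ} {C : ℝ} (hf : ∀ x ≠ 0, ContinuousAt f x)
    (hC : ∀ x, |f x| ≤ C) : Continuous fun x => f x • x := by
  refine continuous_iff_continuousAt.2 fun x => ?_
  by_cases hx : x = 0
  · subst hx
    rw [ContinuousAt, smul_zero]
    refine squeeze_zero_norm (a := fun x => C * ‖x‖) (fun x => ?_) ?_
    · rw [norm_smul]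
      exact mul_le_mul_of_nonneg_right (hC x) (norm_nonneg x)
    · have : Continuous fun x : E 3 => C * ‖x‖ := by fun_prop
      simpa using this.tendsto 0
  · exact (hf x hx).smul continuousAt_id

/-- The radial homeomorphism from `ℝ³` to the open `ℓ¹`-ball that maps the Euclidean unit sphere to
the `ℓ¹`-sphere of radius `3/4`. -/
noncomputable def toL1Ball (x : E 3) : E 3 := (3 / (3 * ‖x‖ + 1)) • ((‖x‖ / l1 x) • x)

/-- The inverse of `toL1Ball`. -/
noncomputable def ofL1Ball (x : E 3) : E 3 := (1 / (3 * (1 - l1 x))) • ((l1 x / ‖x‖) • x)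

theorem continuous_toL1Ball : Continuous toL1Ball := by
  unfold toL1Ball
  have hc : Continuous fun x : E 3 => (‖x‖ / l1 x) • x :=
    continuous_smul_self (C := 1) (fun x hx => ?_) fun x => ?_
  · have hd : Continuous fun x : E 3 => 3 / (3 * ‖x‖ + 1) :=
      continuous_const.div₀ (by fun_prop) fun x => by positivity
    exact hd.smul hc
  · exact continuous_norm.continuousAt.div continuous_l1.continuousAt (l1_pos hx).ne'
  · rw [abs_of_nonneg (div_nonneg (norm_nonneg _) (l1_nonneg _))]
    exact div_le_one_of_le₀ (norm_le_l1 x) (l1_nonneg x)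

theorem continuousOn_ofL1Ball : ContinuousOn ofL1Ball {x | l1 x < 1} := by
  unfold ofL1Ball
  have hc : Continuous fun x : E 3 => (l1 x / ‖x‖) • x :=
    continuous_smul_self (C := 3) (fun x hx => ?_) fun x => ?_
  · have hd : Continuous fun x : E 3 => 3 * (1 - l1 x) := by
      have := continuous_l1
      fun_prop
    have hd' : ContinuousOn (fun x : E 3 => 1 / (3 * (1 - l1 x))) {x | l1 x < 1} :=
      continuousOn_const.div hd.continuousOn fun x hx => by
        have : l1 x < 1 := hx
        linarith
    exact hd'.smul hc.continuousOn
  · exact continuous_l1.continuousAt.div continuous_norm.continuousAt (norm_ne_zero_iff.2 hx)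
  · rw [abs_of_nonneg (div_nonneg (l1_nonneg _) (norm_nonneg _))]
    exact div_le_of_le_mul₀ (norm_nonneg _) (by norm_num) (l1_le_norm x)

theorem toL1Ball_zero : toL1Ball 0 = 0 := by simp [toL1Ball]

theorem ofL1Ball_zero : ofL1Ball 0 = 0 := by simp [ofL1Ball]

/-- The radial profile `t ↦ 3 * t / (3 * t + 1)` maps `[0, ∞)` onto `[0, 1)` and sends `1` to `3/4`,
halfway between the cut at `1/2` and the edge of the corner at `1`. -/
theorem l1_toL1Ball (x : E 3) : l1 (toL1Ball x) = 3 * ‖x‖ / (3 * ‖x‖ + 1) := by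
  by_cases hx : x = 0
  · simp [hx, toL1Ball_zero, l1]
  · have h1 := l1_pos hx
    have h2 := norm_nonneg x
    rw [toL1Ball, l1_smul, l1_smul, abs_of_nonneg (by positivity), abs_of_nonneg (by positivity)]
    field_simp

theorem norm_ofL1Ball {x : E 3} (h : l1 x < 1) : ‖ofL1Ball x‖ = l1 x / (3 * (1 - l1 x)) := by
  by_cases hx : x = 0
  · simp [hx, ofL1Ball_zero, l1]
  · have h1 := l1_pos hx
    have h2 := norm_pos_iff.2 hx
    have h3 : 0 < 1 - l1 x := by linarith
    rw [ofL1Ball, norm_smul, norm_smul, Real.norm_of_nonneg (by positivity),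
      Real.norm_of_nonneg (by positivity)]
    field_simp

theorem l1_toL1Ball_lt_one (x : E 3) : l1 (toL1Ball x) < 1 := by
  have h := norm_nonneg x
  rw [l1_toL1Ball, div_lt_one (by positivity)]
  linarith

theorem ofL1Ball_toL1Ball (x : E 3) : ofL1Ball (toL1Ball x) = x := by
  by_cases hx : x = 0
  · simp [hx, toL1Ball_zero, ofL1Ball_zero]
  · have h1 := l1_pos hx
    have h2 := norm_pos_iff.2 hx
    rw [ofL1Ball, l1_toL1Ball]
    have hn : ‖toL1Ball x‖ = 3 * ‖x‖ / (3 * ‖x‖ + 1) * (‖x‖ / l1 x) := by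
      rw [toL1Ball, norm_smul, norm_smul, Real.norm_of_nonneg (by positivity),
        Real.norm_of_nonneg (by positivity)]
      field_simp
    rw [hn, toL1Ball, smul_smul, smul_smul, smul_smul]
    have h3 : 1 - 3 * ‖x‖ / (3 * ‖x‖ + 1) = 1 / (3 * ‖x‖ + 1) := by
      field_simp
      ring
    rw [h3]
    convert one_smul ℝ x using 2
    field_simp

theorem toL1Ball_ofL1Ball {x : E 3} (h : l1 x < 1) : toL1Ball (ofL1Ball x) = x := by
  by_cases hx : x = 0
  · simp [hx, toL1Ball_zero, ofL1Ball_zero]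
  · have h1 := l1_pos hx
    have h2 := norm_pos_iff.2 hx
    have h3 : 0 < 1 - l1 x := by linarith
    have hl : l1 (ofL1Ball x) = l1 x / (3 * (1 - l1 x)) * (l1 x / ‖x‖) := by
      rw [ofL1Ball, l1_smul, l1_smul, abs_of_nonneg (by positivity),
        abs_of_nonneg (by positivity)]
      field_simp
    rw [toL1Ball, hl, norm_ofL1Ball h, ofL1Ball, smul_smul, smul_smul, smul_smul]
    have h4 : 3 * (l1 x / (3 * (1 - l1 x))) + 1 = 1 / (1 - l1 x) := by
      field_simp
      ring
    rw [h4]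
    convert one_smul ℝ x using 2
    field_simp

theorem toL1Ball_of_norm_eq_one {x : E 3} (h : ‖x‖ = 1) :
    toL1Ball x = (3 / (4 * l1 x)) • x := by
  rw [toL1Ball, h, smul_smul]
  congr 1
  have : x ≠ 0 := by rintro rfl; simp at h
  have := l1_pos this
  field_simp
  norm_num

end SmallCovers

/-! ### Recognizing connected sums, and discs around corners -/

namespace SmallCovers

open RealProjectiveSpace

/-- The space `Z` is covered by the images of two compact spaces that also parametrize the punctured
summands, with the same fibres; identifications between the two sides are exactly the sphere gluing.
The induced map from the connected sum to `Z` is then a continuous bijection from a compact space to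
a Hausdorff one. Injectivity is tested in `Z`, so the equivalence relation generated by the gluing
need not be described. -/
theorem nonempty_homeomorph_connSum {K₁ K₂ A B Z : Type*} [TopologicalSpace K₁]
    [TopologicalSpace K₂] [CompactSpace K₁] [CompactSpace K₂] [TopologicalSpace A]
    [TopologicalSpace B] [TopologicalSpace Z] [T2Space A] [T2Space B] [T2Space Z]
    {n : ℕ} {φ : E n → A} {ψ : E n → B}
    {q₁ : K₁ → DiscComplement φ} {q₂ : K₂ → DiscComplement ψ} {p₁ : K₁ → Z} {p₂ : K₂ → Z}
    (hq₁ : Continuous q₁) (hq₂ : Continuous q₂) (hp₁ : Continuous p₁) (hp₂ : Continuous p₂)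
    (hs₁ : Function.Surjective q₁) (hs₂ : Function.Surjective q₂)
    (hp : ∀ z, (∃ k, p₁ k = z) ∨ ∃ k, p₂ k = z)
    (h₁ : ∀ k k', q₁ k = q₁ k' ↔ p₁ k = p₁ k') (h₂ : ∀ k k', q₂ k = q₂ k' ↔ p₂ k = p₂ k')
    (h₁₂ : ∀ k k', sphereGluing φ ψ (Sum.inl (q₁ k)) (Sum.inr (q₂ k')) ↔ p₁ k = p₂ k') :
    Nonempty (Z ≃ₜ ConnSum φ ψ) := by
  let Q : K₁ ⊕ K₂ → ConnSum φ ψ := fun k => Quot.mk (sphereGluing φ ψ) (Sum.map q₁ q₂ k)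
  have hQ : Topology.IsQuotientMap Q := by
    refine isQuotientMap_quot_mk.comp ?_
    refine (Continuous.isClosedMap (hq₁.sumMap hq₂)).isQuotientMap (hq₁.sumMap hq₂) ?_
    exact hs₁.sumMap hs₂
  let α : DiscComplement φ → Z := fun a => p₁ (Function.surjInv hs₁ a)
  let β : DiscComplement ψ → Z := fun b => p₂ (Function.surjInv hs₂ b)
  have hα : ∀ k, α (q₁ k) = p₁ k := fun k => (h₁ _ _).1 (Function.surjInv_eq hs₁ _)
  have hβ : ∀ k, β (q₂ k) = p₂ k := fun k => (h₂ _ _).1 (Function.surjInv_eq hs₂ _)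
  let F : ConnSum φ ψ → Z := Quot.lift (Sum.elim α β) <| by
    rintro _ _ ⟨a, b, rfl, rfl, hab⟩
    obtain ⟨k, rfl⟩ := hs₁ a
    obtain ⟨k', rfl⟩ := hs₂ b
    change α _ = β _
    rw [hα, hβ]
    exact (h₁₂ k k').1 ⟨_, _, rfl, rfl, hab⟩
  have hFQ : F ∘ Q = Sum.elim p₁ p₂ := by
    funext k
    rcases k with k | k
    · exact hα k
    · exact hβ k
  have hF : Continuous F := by
    rw [hQ.continuous_iff, hFQ]
    exact hp₁.sumElim hp₂
  have hbij : Function.Bijective F := by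
    constructor
    · intro a b hab
      obtain ⟨k, rfl⟩ := hQ.surjective a
      obtain ⟨l, rfl⟩ := hQ.surjective b
      have hkl : Sum.elim p₁ p₂ k = Sum.elim p₁ p₂ l := by rw [← hFQ]; exact hab
      rcases k with k | k <;> rcases l with l | l
      · exact congrArg (fun a => Quot.mk (sphereGluing φ ψ) (Sum.inl a)) ((h₁ k l).2 hkl)
      · exact Quot.sound ((h₁₂ k l).2 hkl)
      · exact (Quot.sound ((h₁₂ l k).2 hkl.symm)).symm
      · exact congrArg (fun a => Quot.mk (sphereGluing φ ψ) (Sum.inr a)) ((h₂ k l).2 hkl)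
    · intro z
      rcases hp z with ⟨k, rfl⟩ | ⟨k, rfl⟩
      · exact ⟨Q (Sum.inl k), congrFun hFQ (Sum.inl k)⟩
      · exact ⟨Q (Sum.inr k), congrFun hFQ (Sum.inr k)⟩
  have : CompactSpace (ConnSum φ ψ) := hQ.surjective.compactSpace hQ.continuous
  exact ⟨(Continuous.homeoOfEquivCompactToT2 (f := Equiv.ofBijective F hbij) hF).symm⟩

/-- A compact subset `X` of the positive orthant that agrees with the orthant near the origin, with
stabilizers that near the origin are those of the group of reflections in the coordinate planes. -/
structure IsCorner (X : Set (E 3)) (W : X → Submodule (ZMod 2) V3) : Prop where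
  isCompact : IsCompact X
  nonneg : ∀ x ∈ X, ∀ i, 0 ≤ x i
  mem : ∀ x, (∀ i, 0 ≤ x i) → l1 x < 1 → x ∈ X
  stab : ∀ x : X, l1 x < 1 → ∀ g, g ∈ W x ↔ ∀ i, x.1 i ≠ 0 → g i = 0

namespace IsCorner

variable {X : Set (E 3)} {W : X → Submodule (ZMod 2) V3}

theorem absVec_toL1Ball_mem (h : IsCorner X W) (x : E 3) : absVec (toL1Ball x) ∈ X :=
  h.mem _ (fun _ => abs_nonneg _) (by rw [l1_absVec]; exact l1_toL1Ball_lt_one x)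

/-- The disc around the corner. -/
noncomputable def disc (h : IsCorner X W) (x : E 3) : Glued W :=
  Glued.mk W (⟨absVec (toL1Ball x), h.absVec_toL1Ball_mem x⟩, signVec (toL1Ball x))

/-- Near the origin the eight copies of the orthant unfold to a neighborhood in `ℝ³`, and a class is
determined by the unfolded point. -/
theorem mk_eq_mk_iff (h : IsCorner X W) {p q : X × V3} (hp : l1 p.1 < 1) :
    Glued.mk W p = Glued.mk W q ↔ flip p.2 p.1 = flip q.2 q.1 := by
  obtain ⟨x, g⟩ := p
  obtain ⟨y, k⟩ := q
  rw [Glued.mk_eq_mk]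
  constructor
  · rintro ⟨hxy, hgk⟩
    obtain rfl : x = y := hxy
    exact flip_eq_flip_iff.2 ((h.stab x hp _).1 hgk)
  · intro H
    obtain rfl : x = y := Subtype.ext (eq_of_flip_eq_flip (h.nonneg _ x.2) (h.nonneg _ y.2) H)
    exact ⟨rfl, (h.stab x hp _).2 (flip_eq_flip_iff.1 H)⟩

theorem mk_eq_disc_iff (h : IsCorner X W) {p : X × V3} {x : E 3} :
    h.disc x = Glued.mk W p ↔ flip p.2 p.1 = toL1Ball x := by
  rw [disc, h.mk_eq_mk_iff (by rw [l1_absVec]; exact l1_toL1Ball_lt_one x), eq_comm,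
    flip_signVec_absVec]

theorem mk_eq_disc (h : IsCorner X W) {p : X × V3} (hp : l1 p.1 < 1) :
    h.disc (ofL1Ball (flip p.2 p.1)) = Glued.mk W p := by
  rw [mk_eq_disc_iff, toL1Ball_ofL1Ball (by rwa [l1_flip])]

/-- The sign vector jumps, but on each of the eight closed orthants it may be replaced by a constant
without changing the class. These orthants form a finite closed cover. -/
theorem continuous_disc (h : IsCorner X W) : Continuous h.disc := by
  let O : V3 → Set (E 3) := fun g => {x | ∀ i, 0 ≤ sgn (g i) * toL1Ball x i}
  have hO : ∀ g, IsClosed (O g) := fun g => by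
    have : O g = ⋂ i, {x | 0 ≤ sgn (g i) * toL1Ball x i} := by ext; simp [O]
    rw [this]
    refine isClosed_iInter fun i => isClosed_le continuous_const (continuous_const.mul ?_)
    exact (EuclideanSpace.proj (𝕜 := ℝ) i).continuous.comp continuous_toL1Ball
  refine (locallyFinite_of_finite O).continuous ?_ hO fun g => ?_
  · refine Set.eq_univ_of_forall fun x => Set.mem_iUnion.2 ⟨signVec (toL1Ball x), fun i => ?_⟩
    unfold signVec
    split_ifs with hi
    · simpa using hi.le
    · simpa using hi
  · have hc : Continuous fun x => Glued.mk W
        (⟨absVec (toL1Ball x), h.absVec_toL1Ball_mem x⟩, g) := by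
      refine Glued.continuous_mk.comp (Continuous.prodMk ?_ continuous_const)
      exact (continuous_absVec.comp continuous_toL1Ball).subtype_mk _
    refine hc.continuousOn.congr fun x hx => ?_
    rw [mk_eq_disc_iff]
    ext i
    have hi : 0 ≤ sgn (g i) * toL1Ball x i := hx i
    simp only [flip_apply, absVec_apply]
    have h1 : |toL1Ball x i| = sgn (g i) * toL1Ball x i := by
      rw [← abs_of_nonneg hi, abs_mul, abs_sgn, one_mul]
    rw [h1, ← mul_assoc, sgn_mul_self, one_mul]

/-- The inverse must be read off from a continuous function on the whole glued space, whereas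
unfolding is well defined only for `l1 < 1`. Multiplying it by `max (1 - l1) 0` makes it descend
everywhere; on the corner the factor is divided out again. -/
theorem isOpenEmbedding_disc (h : IsCorner X W) : Topology.IsOpenEmbedding h.disc := by
  let D : X × V3 → E 3 × ℝ := fun p => (max (1 - l1 p.1) 0 • flip p.2 p.1, l1 p.1)
  have hl : Continuous fun p : X × V3 => l1 p.1 :=
    continuous_l1.comp (continuous_subtype_val.comp continuous_fst)
  have hD : Continuous D := by
    have h1 : Continuous fun p : X × V3 => max (1 - l1 p.1) 0 := by fun_prop
    have h2 : Continuous fun p : X × V3 => flip p.2 p.1 := continuous_uncurry_flip.comp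
      ((continuous_subtype_val.comp continuous_fst).prodMk continuous_snd)
    exact (h1.smul h2).prodMk hl
  have hk : ∀ p q, (stabGluing W).r p q → D p = D q := by
    rintro ⟨x, g⟩ ⟨y, k⟩ ⟨hxy, hgk⟩
    obtain rfl : x = y := hxy
    by_cases hx : l1 x < 1
    · have : flip g x = flip k x := flip_eq_flip_iff.2 ((h.stab x hx _).1 hgk)
      simp only [D, this]
    · have : max (1 - l1 x) 0 = 0 := max_eq_right (by linarith)
      simp only [D, this, zero_smul]
  let F : Glued W → E 3 × ℝ := Quotient.lift D hk
  have hF : Continuous F := hD.quotient_lift hk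
  let inv : Glued W → E 3 := fun a => ofL1Ball ((1 - (F a).2)⁻¹ • (F a).1)
  have hinv : ∀ p : X × V3, l1 p.1 < 1 → (1 - (F (Glued.mk W p)).2)⁻¹ • (F (Glued.mk W p)).1 =
      flip p.2 p.1 := fun p hp => by
    change (1 - l1 p.1)⁻¹ • max (1 - l1 p.1) 0 • flip p.2 p.1 = _
    rw [max_eq_left (by linarith), smul_smul, inv_mul_cancel₀ (by linarith), one_smul]
  let e : OpenPartialHomeomorph (E 3) (Glued W) :=
    { toFun := h.disc
      invFun := inv
      source := Set.univ
      target := {a | (F a).2 < 1}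
      map_source' := fun x _ => by
        change l1 (absVec (toL1Ball x)) < 1
        rw [l1_absVec]
        exact l1_toL1Ball_lt_one x
      map_target' := fun _ _ => Set.mem_univ _
      left_inv' := fun x _ => by
        have h1 := hinv (⟨absVec (toL1Ball x), h.absVec_toL1Ball_mem x⟩, signVec (toL1Ball x))
          (by rw [l1_absVec]; exact l1_toL1Ball_lt_one x)
        change ofL1Ball _ = x
        rw [disc, h1, flip_signVec_absVec, ofL1Ball_toL1Ball]
      right_inv' := by
        intro a ha
        obtain ⟨p, rfl⟩ := Glued.mk_surjective a
        have hp : l1 p.1 < 1 := ha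
        change h.disc (ofL1Ball _) = _
        rw [hinv p hp, h.mk_eq_disc hp]
      open_source := isOpen_univ
      open_target := isOpen_lt (continuous_snd.comp hF) continuous_const
      continuousOn_toFun := h.continuous_disc.continuousOn
      continuousOn_invFun := by
        refine continuousOn_ofL1Ball.comp ?_ ?_
        · have h1 : Continuous fun a => 1 - (F a).2 := by fun_prop
          have h2 : Continuous fun a => (F a).1 := by fun_prop
          have h3 : ContinuousOn (fun a => (1 - (F a).2)⁻¹) {a | (F a).2 < 1} :=
            h1.continuousOn.inv₀ fun a ha => by
              have : (F a).2 < 1 := ha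
              linarith
          exact h3.smul h2.continuousOn
        · intro a ha
          obtain ⟨p, rfl⟩ := Glued.mk_surjective a
          have hp : l1 p.1 < 1 := ha
          change l1 ((1 - (F (Glued.mk W p)).2)⁻¹ • (F (Glued.mk W p)).1) < 1
          rw [hinv p hp, l1_flip]
          exact hp }
  exact e.isOpenEmbedding rfl

end IsCorner

end SmallCovers

/-! ### Cutting off a corner adds a projective space -/

namespace SmallCovers

open RealProjectiveSpace

namespace IsCorner

variable {X : Set (E 3)} {W : X → Submodule (ZMod 2) V3}

/-- `X` with the corner at the origin cut off. -/
def cut (X : Set (E 3)) : Set (E 3) := {x | x ∈ X ∧ 1 / 2 ≤ l1 x}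

/-- The stabilizers `W'` on `X` with the corner cut off are those on `X` away from the new facet,
and on the new facet they are enlarged by the color `(1, 1, 1)`. -/
structure IsCutStab (W : X → Submodule (ZMod 2) V3) (W' : cut X → Submodule (ZMod 2) V3) :
    Prop where
  old : ∀ y : cut X, 1 / 2 < l1 y → W' y = W ⟨y, y.2.1⟩
  new : ∀ y : cut X, l1 y = 1 / 2 → ∀ g, g ∈ W' y ↔
    (∀ i, y.1 i ≠ 0 → g i = 0) ∨ ∀ i, y.1 i ≠ 0 → g i = 1

variable {W' : cut X → Submodule (ZMod 2) V3}

theorem isCompact_cut (h : IsCorner X W) : IsCompact (cut X) :=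
  h.isCompact.inter_right (isClosed_le continuous_const continuous_l1)

theorem cut_ne_zero (y : cut X) : y.1 ≠ 0 := fun h0 => by
  have := y.2.2
  rw [l1_eq_zero.2 h0] at this
  norm_num at this

/-- In the collar of the new facet, two points are identified precisely if they differ by
reflections or lie on the new facet and differ by reflections and the antipodal map. -/
theorem mk_cut_eq_iff (h : IsCorner X W) (h' : IsCutStab W W') {p q : cut X × V3}
    (hp : l1 p.1 ≤ 3 / 4) : Glued.mk W' p = Glued.mk W' q ↔
      flip p.2 p.1 = flip q.2 q.1 ∨ (l1 p.1 = 1 / 2 ∧ flip p.2 p.1 = -flip q.2 q.1) := by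
  obtain ⟨x, g⟩ := p
  obtain ⟨y, k⟩ := q
  dsimp only at hp ⊢
  have hx0 := h.nonneg _ x.2.1
  have hy0 := h.nonneg _ y.2.1
  rw [Glued.mk_eq_mk]
  by_cases hl : l1 x = 1 / 2
  · constructor
    · rintro ⟨hxy, hgk⟩
      obtain rfl : x = y := hxy
      exact ((h'.new x hl _).1 hgk).imp flip_eq_flip_iff.2 fun H =>
        ⟨hl, flip_eq_neg_flip_iff.2 H⟩
    · rintro (H | ⟨-, H⟩)
      · obtain rfl : x = y := Subtype.ext (eq_of_flip_eq_flip hx0 hy0 H)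
        exact ⟨rfl, (h'.new x hl _).2 (Or.inl (flip_eq_flip_iff.1 H))⟩
      · obtain rfl : x = y := Subtype.ext
          (eq_of_flip_eq_flip hx0 hy0 (H.trans (flip_add_one _ _).symm))
        exact ⟨rfl, (h'.new x hl _).2 (Or.inr (flip_eq_neg_flip_iff.1 H))⟩
  · have hl' : 1 / 2 < l1 x := lt_of_le_of_ne x.2.2 (Ne.symm hl)
    have hs := h.stab ⟨x, x.2.1⟩ (show l1 x < 1 by linarith) (g - k)
    simp only [hl, false_and, or_false, h'.old x hl']
    constructor
    · rintro ⟨hxy, hgk⟩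
      obtain rfl : x = y := hxy
      exact flip_eq_flip_iff.2 (hs.1 hgk)
    · intro H
      obtain rfl : x = y := Subtype.ext (eq_of_flip_eq_flip hx0 hy0 H)
      exact ⟨rfl, hs.2 (flip_eq_flip_iff.1 H)⟩

theorem mk_cut_eq_iff_mk (h' : IsCutStab W W') {p q : cut X × V3} (hp : 1 / 2 < l1 p.1) :
    Glued.mk W (⟨p.1, p.1.2.1⟩, p.2) = Glued.mk W (⟨q.1, q.1.2.1⟩, q.2) ↔
      Glued.mk W' p = Glued.mk W' q := by
  rw [Glued.mk_eq_mk, Glued.mk_eq_mk, h'.old p.1 hp]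
  exact and_congr_left fun _ => ⟨fun e => Subtype.ext (congrArg (fun x : X => x.1) e),
    fun e => Subtype.ext (congrArg (fun x : cut X => x.1) e)⟩

/-- The homogeneous coordinates of the point of projective space corresponding to a point of the
collar of the new facet. -/
noncomputable def collarVec (p : E 3 × V3) : E 4 := hom (4 * l1 p.1 - 2) (‖p.1‖⁻¹ • flip p.2 p.1)

theorem norm_inv_smul_flip {p : E 3 × V3} (hp : p.1 ≠ 0) : ‖‖p.1‖⁻¹ • flip p.2 p.1‖ = 1 := by
  rw [norm_smul, norm_inv, norm_norm, norm_flip, inv_mul_cancel₀ (norm_ne_zero_iff.2 hp)]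

theorem collarVec_ne_zero {p : E 3 × V3} (hp : p.1 ≠ 0) : collarVec p ≠ 0 := fun h0 => by
  have := norm_inv_smul_flip hp
  rw [(hom_eq_zero_iff.1 h0).2, norm_zero] at this
  exact zero_ne_one this

theorem inv_norm_smul_inj {x y : E 3} (hx : x ≠ 0) (hl : l1 x = l1 y)
    (h : ‖x‖⁻¹ • x = ‖y‖⁻¹ • y) : x = y := by
  have h1 := congrArg l1 h
  rw [l1_smul, l1_smul, hl, abs_of_nonneg (by positivity), abs_of_nonneg (by positivity)] at h1
  have h2 : l1 y ≠ 0 := hl ▸ (l1_pos hx).ne'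
  rw [mul_right_cancel₀ h2 h1] at h
  have h3 : ‖y‖⁻¹ ≠ 0 := by
    rw [← mul_right_cancel₀ h2 h1]
    exact inv_ne_zero (norm_ne_zero_iff.2 hx)
  exact smul_right_injective _ h3 h

/-- The last three coordinates form a unit vector, so the scalar is `±1`. Since the first
coordinates are nonnegative, the sign `-1` forces both to vanish, which happens exactly on the new
facet. -/
theorem proj_collarVec_eq_iff {p q : E 3 × V3} (hp : p.1 ≠ 0) (hq : q.1 ≠ 0)
    (hpl : 1 / 2 ≤ l1 p.1) (hql : 1 / 2 ≤ l1 q.1) :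
    proj (collarVec p) (collarVec_ne_zero hp) = proj (collarVec q) (collarVec_ne_zero hq) ↔
      flip p.2 p.1 = flip q.2 q.1 ∨ (l1 p.1 = 1 / 2 ∧ flip p.2 p.1 = -flip q.2 q.1) := by
  have hnp : flip p.2 p.1 ≠ 0 := fun h0 => by
    have := norm_inv_smul_flip hp
    rw [h0, smul_zero, norm_zero] at this
    exact zero_ne_one this
  rw [proj_eq_proj_iff]
  constructor
  · rintro ⟨r, hr⟩
    obtain ⟨h1, h2⟩ := hom_eq_smul_iff.1 hr
    have h3 := congrArg norm h2
    rw [norm_inv_smul_flip hp, norm_smul, norm_inv_smul_flip hq, mul_one, Real.norm_eq_abs,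
      eq_comm, abs_eq zero_le_one] at h3
    rw [← norm_flip p.2 p.1, ← norm_flip q.2 q.1] at h2
    rcases h3 with rfl | rfl
    · left
      rw [one_smul] at h2
      refine inv_norm_smul_inj hnp ?_ h2
      rw [l1_flip, l1_flip]
      linarith
    · right
      have h4 : l1 p.1 = 1 / 2 := by linarith
      have h5 : l1 q.1 = 1 / 2 := by linarith
      refine ⟨h4, inv_norm_smul_inj hnp ?_ ?_⟩
      · rw [← flip_add_one, l1_flip, l1_flip, h4, h5]
      · rw [h2, norm_neg, neg_smul, one_smul, smul_neg]
  · rintro (H | ⟨hl, H⟩)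
    · refine ⟨1, hom_eq_smul_iff.2 ⟨?_, ?_⟩⟩
      · rw [← l1_flip p.2, H, l1_flip, one_mul]
      · rw [← norm_flip p.2, H, norm_flip, one_smul]
    · have hl' : l1 q.1 = l1 p.1 := by
        rw [← l1_flip p.2 p.1, H, ← flip_add_one, l1_flip]
      refine ⟨-1, hom_eq_smul_iff.2 ⟨?_, ?_⟩⟩
      · rw [hl', hl]
        norm_num
      · rw [← norm_flip p.2, H, norm_neg, norm_flip, smul_neg, neg_smul, one_smul]

/-- Cutting off the corner of a small cover amounts to forming the connected sum with projective
space. -/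
theorem isConnectedSum_cut [T2Space (Glued W)] [T2Space (Glued W')] (h : IsCorner X W)
    (h' : IsCutStab W W') : IsConnectedSum 3 (Glued W') (Glued W) (RealProjectiveSpace 3) := by
  refine ⟨h.disc, chart, h.isOpenEmbedding_disc, isOpenEmbedding_chart, ?_⟩
  have hK : CompactSpace (cut X) := isCompact_iff_compactSpace.1 h.isCompact_cut
  have hl : Continuous fun y : cut X => l1 y := continuous_l1.comp continuous_subtype_val
  -- The separating sphere is `l1 = 3 / 4`. The outer part is the old space minus the disc, and the
  -- collar `1 / 2 ≤ l1 ≤ 3 / 4` is projective space minus the unit ball of the chart.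
  have : CompactSpace {y : cut X // 3 / 4 ≤ l1 y} := isCompact_iff_compactSpace.1
    (isClosed_le continuous_const hl).isCompact
  have : CompactSpace {y : cut X // l1 y ≤ 3 / 4} := isCompact_iff_compactSpace.1
    (isClosed_le hl continuous_const).isCompact
  have hdisc : ∀ p : X × V3, 3 / 4 ≤ l1 p.1 ↔ Glued.mk W p ∉ h.disc '' Metric.ball 0 1 := by
    intro p
    rw [← not_lt, not_iff_not]
    constructor
    · intro hp
      refine ⟨_, ?_, h.mk_eq_disc (hp.trans (by norm_num))⟩
      have hp1 : l1 (flip p.2 p.1) < 1 := by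
        rw [l1_flip]
        exact hp.trans (by norm_num)
      rw [mem_ball_zero_iff, norm_ofL1Ball hp1, l1_flip, div_lt_one (by linarith)]
      linarith
    · rintro ⟨x, hx, hxp⟩
      rw [h.mk_eq_disc_iff] at hxp
      rw [mem_ball_zero_iff] at hx
      have := norm_nonneg x
      rw [← l1_flip p.2, hxp, l1_toL1Ball, div_lt_iff₀ (by positivity)]
      linarith
  have hchart : ∀ p : {y : cut X // l1 y ≤ 3 / 4} × V3,
      proj (collarVec (p.1.1.1, p.2)) (collarVec_ne_zero (cut_ne_zero p.1.1)) ∉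
        chart '' Metric.ball 0 1 := by
    rintro p ⟨x, hx, hxp⟩
    obtain ⟨hs, hu⟩ := (chart_eq_proj_iff
      (collarVec_ne_zero (p := (p.1.1.1, p.2)) (cut_ne_zero p.1.1))).1 hxp
    have hn := norm_inv_smul_flip (p := (p.1.1.1, p.2)) (cut_ne_zero p.1.1)
    rw [hu, norm_smul, Real.norm_eq_abs] at hn
    rw [mem_ball_zero_iff] at hx
    have h1 : l1 p.1.1.1 ≤ 3 / 4 := p.1.2
    have h2 := p.1.1.2.2
    -- The first homogeneous coordinate runs from `0` on the new facet to `1` on the separating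
    -- sphere. As the remaining part is a unit vector, the affine point, if it exists, has norm at
    -- least `1`.
    have h3 : |4 * l1 p.1.1.1 - 2| ≤ 1 := abs_le.2 ⟨by linarith, by linarith⟩
    have h4 := abs_pos.2 hs
    dsimp only at hn h4
    nlinarith
  let q₁ : {y : cut X // 3 / 4 ≤ l1 y} × V3 → DiscComplement h.disc := fun p =>
    ⟨Glued.mk W (⟨p.1.1.1, p.1.1.2.1⟩, p.2), (hdisc _).1 p.1.2⟩
  let q₂ : {y : cut X // l1 y ≤ 3 / 4} × V3 → DiscComplement chart := fun p => ⟨_, hchart p⟩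
  let p₁ : {y : cut X // 3 / 4 ≤ l1 y} × V3 → Glued W' := fun p => Glued.mk W' (p.1.1, p.2)
  let p₂ : {y : cut X // l1 y ≤ 3 / 4} × V3 → Glued W' := fun p => Glued.mk W' (p.1.1, p.2)
  refine nonempty_homeomorph_connSum (q₁ := q₁) (q₂ := q₂) (p₁ := p₁) (p₂ := p₂)
    ?_ ?_ ?_ ?_ ?_ ?_ ?_ ?_ ?_ ?_
  · refine (Glued.continuous_mk.comp (Continuous.prodMk ?_ continuous_snd)).subtype_mk _
    exact (continuous_subtype_val.comp
      (continuous_subtype_val.comp continuous_fst)).subtype_mk _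
  · have hv : Continuous fun p : {y : cut X // l1 y ≤ 3 / 4} × V3 => p.1.1.1 :=
      continuous_subtype_val.comp (continuous_subtype_val.comp continuous_fst)
    have hf : Continuous fun p : {y : cut X // l1 y ≤ 3 / 4} × V3 => flip p.2 p.1.1.1 :=
      continuous_uncurry_flip.comp (hv.prodMk continuous_snd)
    have hn : Continuous fun p : {y : cut X // l1 y ≤ 3 / 4} × V3 => ‖p.1.1.1‖⁻¹ :=
      hv.norm.inv₀ fun p => norm_ne_zero_iff.2 (cut_ne_zero p.1.1)
    have hL : Continuous fun p : {y : cut X // l1 y ≤ 3 / 4} × V3 => 4 * l1 p.1.1.1 - 2 :=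
      (continuous_const.mul (continuous_l1.comp hv)).sub continuous_const
    exact (continuous_proj (continuous_hom hL (hn.smul hf)) _).subtype_mk _
  · exact Glued.continuous_mk.comp
      ((continuous_subtype_val.comp continuous_fst).prodMk continuous_snd)
  · exact Glued.continuous_mk.comp
      ((continuous_subtype_val.comp continuous_fst).prodMk continuous_snd)
  · rintro ⟨a, ha⟩
    obtain ⟨⟨x, g⟩, rfl⟩ := Glued.mk_surjective a
    have hx : 3 / 4 ≤ l1 x := (hdisc (x, g)).2 ha
    exact ⟨(⟨⟨x, x.2, by linarith⟩, hx⟩, g), rfl⟩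
  · rintro ⟨b, hb⟩
    obtain ⟨s, y, hs, hv, rfl⟩ := exists_proj_hom_eq b
    have hle : s ≤ ‖y‖ := by
      by_contra hlt
      push Not at hlt
      have hs0 : 0 < s := (norm_nonneg y).trans_lt hlt
      refine hb ⟨s⁻¹ • y, ?_, (chart_eq_proj_iff hv).2 ⟨hs0.ne', ?_⟩⟩
      · rw [mem_ball_zero_iff, norm_smul, norm_inv, Real.norm_of_nonneg hs,
          inv_mul_lt_iff₀ hs0, mul_one]
        exact hlt
      · rw [smul_smul, mul_inv_cancel₀ hs0.ne', one_smul]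
    have hy : y ≠ 0 := by
      rintro rfl
      rw [norm_zero] at hle
      exact hv (hom_eq_zero_iff.2 ⟨le_antisymm hle hs, rfl⟩)
    have hy1 := l1_pos hy
    have hy2 := norm_pos_iff.2 hy
    -- This solves `4 * l - 2 = s / ‖y‖`; the bounds `0 ≤ s / ‖y‖ ≤ 1` become `1 / 2 ≤ l ≤ 3 / 4`.
    set l := (2 + s / ‖y‖) / 4 with hl_def
    have ht0 : 0 ≤ s / ‖y‖ := by positivity
    have ht1 : s / ‖y‖ ≤ 1 := div_le_one_of_le₀ hle hy2.le
    have hl0 : 0 < l := by positivity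
    have hc : 0 < l / l1 y := by positivity
    set z := (l / l1 y) • absVec y with hz_def
    have hzl : l1 z = l := by
      rw [hz_def, l1_smul, l1_absVec, abs_of_pos hc, div_mul_cancel₀ _ hy1.ne']
    have hzX : z ∈ X := by
      refine h.mem z (fun i => mul_nonneg hc.le (abs_nonneg (y i))) ?_
      rw [hzl]
      linarith
    have hzf : flip (signVec y) z = (l / l1 y) • y := by
      rw [hz_def, flip_smul, flip_signVec_absVec]
    have hzn : ‖z‖ = l / l1 y * ‖y‖ := by
      rw [← norm_flip (signVec y), hzf, norm_smul, Real.norm_of_nonneg hc.le]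
    have hz0 : z ≠ 0 := fun h0 => by
      rw [l1_eq_zero.2 h0] at hzl
      linarith
    have hproj : proj (collarVec (z, signVec y)) (collarVec_ne_zero hz0) = proj (hom s y) hv := by
      refine proj_eq_proj_iff.2 ⟨‖y‖⁻¹, hom_eq_smul_iff.2 ⟨?_, ?_⟩⟩
      · change 4 * l1 z - 2 = _
        rw [hzl, hl_def]
        field_simp
        ring
      · change ‖z‖⁻¹ • flip (signVec y) z = _
        rw [hzf, hzn, smul_smul]
        congr 1
        field_simp
    refine ⟨(⟨⟨z, hzX, ?_⟩, ?_⟩, signVec y), Subtype.ext hproj⟩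
    · rw [hzl]
      linarith
    · change l1 z ≤ 3 / 4
      rw [hzl]
      linarith
  · intro a
    obtain ⟨⟨y, g⟩, rfl⟩ := Glued.mk_surjective a
    rcases le_total (3 / 4) (l1 y) with hy | hy
    · exact Or.inl ⟨(⟨y, hy⟩, g), rfl⟩
    · exact Or.inr ⟨(⟨y, hy⟩, g), rfl⟩
  · intro k k'
    have hk : 3 / 4 ≤ l1 k.1.1 := k.1.2
    exact Subtype.ext_iff.trans
      (mk_cut_eq_iff_mk h' (p := (k.1.1, k.2)) (q := (k'.1.1, k'.2)) (by dsimp only; linarith))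
  · intro k k'
    rw [Subtype.ext_iff]
    exact (proj_collarVec_eq_iff (p := (k.1.1.1, k.2)) (q := (k'.1.1.1, k'.2))
      (cut_ne_zero k.1.1) (cut_ne_zero k'.1.1) k.1.1.2.2 k'.1.1.2.2).trans
      (mk_cut_eq_iff h h' (p := (k.1.1, k.2)) (q := (k'.1.1, k'.2)) k.1.2).symm
  · rintro ⟨⟨y, hy⟩, g⟩ ⟨⟨y', hy'⟩, g'⟩
    have hy0 := cut_ne_zero y'
    have hy1 := l1_pos hy0
    have hn := norm_pos_iff.2 hy0
    change _ ↔ Glued.mk W' (y, g) = Glued.mk W' (y', g')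
    rw [eq_comm, mk_cut_eq_iff h h' hy']
    dsimp only
    constructor
    · rintro ⟨_, _, ha, hb, x, hx, hxa, hxb⟩
      obtain rfl := Sum.inl_injective ha
      obtain rfl := Sum.inr_injective hb
      have hx1 : ‖x‖ = 1 := by simpa using hx
      rw [h.mk_eq_disc_iff, toL1Ball_of_norm_eq_one hx1] at hxa
      obtain ⟨hs, hu⟩ :=
        (chart_eq_proj_iff (collarVec_ne_zero (p := (y'.1, g')) hy0)).1 hxb
      dsimp only at hxa hs hu
      have hx0 : x ≠ 0 := by rintro rfl; simp at hx1
      have hxl := l1_pos hx0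
      have h2 := y'.2.2
      have hu1 := norm_inv_smul_flip (p := (y'.1, g')) hy0
      dsimp only at hu1
      rw [hu, norm_smul, hx1, mul_one, Real.norm_of_nonneg (by linarith)] at hu1
      rw [hu1, one_smul] at hu
      have hl' : l1 y' = 3 / 4 := by linarith
      left
      rw [hxa, ← hu, l1_smul, l1_flip, hl', smul_smul, abs_of_nonneg (by positivity)]
      have : (3 / (4 * (‖y'.1‖⁻¹ * (3 / 4))) * ‖y'.1‖⁻¹ : ℝ) = 1 := by
        field_simp
      rw [this, one_smul]
    · intro H
      -- The antipodal alternative occurs only at `l1 = 1 / 2`, which is excluded because the outer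
      -- point has `l1` at least `3 / 4`.
      have hfl : flip g' y' = flip g y ∧ l1 y' = 3 / 4 := by
        rcases H with H | ⟨hl', H⟩
        · refine ⟨H, le_antisymm hy' ?_⟩
          rw [← l1_flip g', H, l1_flip]
          exact hy
        · have : l1 y' = l1 y := by rw [← l1_flip g', H, ← flip_add_one, l1_flip]
          have : (3 / 4 : ℝ) ≤ l1 y := hy
          linarith
      obtain ⟨hf, hl'⟩ := hfl
      have hu1 := norm_inv_smul_flip (p := (y'.1, g')) hy0
      dsimp only at hu1
      refine ⟨_, _, rfl, rfl, ‖y'.1‖⁻¹ • flip g' y', by simpa using hu1, ?_, ?_⟩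
      · rw [h.mk_eq_disc_iff, toL1Ball_of_norm_eq_one hu1, l1_smul, l1_flip, hl', smul_smul,
          abs_of_nonneg (by positivity)]
        have : (3 / (4 * (‖y'.1‖⁻¹ * (3 / 4))) * ‖y'.1‖⁻¹ : ℝ) = 1 := by
          field_simp
        rw [this, one_smul, hf]
      · refine (chart_eq_proj_iff (collarVec_ne_zero (p := (y'.1, g')) hy0)).2 ⟨?_, ?_⟩
        · dsimp only
          rw [hl']
          norm_num
        · dsimp only
          rw [hl', show (4 * (3 / 4) - 2 : ℝ) = 1 by norm_num, one_smul]

end IsCorner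

end SmallCovers

/-! ### Spaces with colored walls -/

namespace SmallCovers

open RealProjectiveSpace

theorem mem_span_single {Z : Set (Fin 3)} {g : V3} :
    g ∈ Submodule.span (ZMod 2) ((fun i => Pi.single i 1) '' Z) ↔ ∀ i, i ∉ Z → g i = 0 := by
  constructor
  · intro h i hi
    induction h using Submodule.span_induction with
    | mem x hx =>
      obtain ⟨j, hj, rfl⟩ := hx
      exact Pi.single_eq_of_ne (by rintro rfl; exact hi hj) _
    | zero => rfl
    | add x y _ _ hx hy => rw [Pi.add_apply, hx, hy, add_zero]
    | smul a x _ hx => rw [Pi.smul_apply, hx, smul_zero]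
  · intro h
    have h1 : g = ∑ i, g i • (Pi.single i 1 : V3) := by
      ext j
      simp [Finset.sum_apply, Pi.single_apply]
    rw [h1]
    refine Submodule.sum_mem _ fun i _ => ?_
    by_cases hi : i ∈ Z
    · exact Submodule.smul_mem _ _ (Submodule.subset_span ⟨i, hi, rfl⟩)
    · rw [h i hi, zero_smul]
      exact Submodule.zero_mem _

theorem mem_span_insert_iff {T : Set V3} {v g : V3} :
    g ∈ Submodule.span (ZMod 2) (insert v T) ↔
      g ∈ Submodule.span (ZMod 2) T ∨ g - v ∈ Submodule.span (ZMod 2) T := by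
  rw [Submodule.mem_span_insert]
  constructor
  · rintro ⟨a, z, hz, rfl⟩
    rcases zmod2_cases a with rfl | rfl
    · left
      simpa using hz
    · right
      simpa using hz
  · rintro (h | h)
    · exact ⟨0, g, h, by simp⟩
    · exact ⟨1, g - v, h, by simp⟩

/-- A small cover, described by another space with walls homeomorphic to the polytope. -/
theorem ConvexPolytope.nonempty_smallCover_homeomorph {ι κ X : Type*} [TopologicalSpace X]
    (P : ConvexPolytope 3 ι) (c : ι → V3) (σ : ι ≃ κ) (e : P.carrier ≃ₜ X) (s : κ → X → ℝ)
    (c' : κ → V3) (L : V3 ≃ₗ[ZMod 2] V3) (hs : ∀ x i, s (σ i) (e x) = 0 ↔ i ∈ P.act x)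
    (hc : ∀ i, c' (σ i) = L (c i)) :
    Nonempty (P.SmallCover c ≃ₜ Glued (wallSpan s c')) := by
  refine Glued.nonempty_homeomorph_map (W := fun x : P.carrier => P.colorSpan c x) _ e L
    fun x g => ?_
  have h1 : c' '' {i | s i (e x) = 0} = L '' (c '' P.act x) := by
    ext v
    constructor
    · rintro ⟨k, hk, rfl⟩
      obtain ⟨i, rfl⟩ := σ.surjective k
      exact ⟨_, ⟨i, (hs x i).1 hk, rfl⟩, (hc i).symm⟩
    · rintro ⟨_, ⟨i, hi, rfl⟩, rfl⟩
      exact ⟨σ i, (hs x i).2 hi, hc i⟩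
  rw [wallSpan, h1, P.colorSpan_eq c x.2]
  change L g ∈ Submodule.span _ ((L : V3 →ₗ[ZMod 2] V3) '' _) ↔ _
  rw [Submodule.span_image]
  exact Submodule.map_equiv_eq_comap_symm L _ ▸ (by simp)

theorem Glued.nonempty_homeomorph_wallSpan {ι κ X Y : Type*} [TopologicalSpace X]
    [TopologicalSpace Y] [CompactSpace X] [T2Space Y] (s : ι → X → ℝ) (c : ι → V3)
    (s' : κ → Y → ℝ) (c' : κ → V3) (σ : ι ≃ κ) (f : X → Y) (hf : Continuous f)
    (hb : Function.Bijective f) (hs : ∀ x i, s' (σ i) (f x) = 0 ↔ s i x = 0)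
    (hc : ∀ i, c' (σ i) = c i) :
    Nonempty (Glued (wallSpan s c) ≃ₜ Glued (wallSpan s' c')) := by
  let e : X ≃ₜ Y := Continuous.homeoOfEquivCompactToT2 (f := Equiv.ofBijective f hb) hf
  refine Glued.nonempty_homeomorph_map _ e (LinearEquiv.refl _ _) fun x g => ?_
  have h1 : c' '' {i | s' i (f x) = 0} = c '' {i | s i x = 0} := by
    ext v
    constructor
    · rintro ⟨k, hk, rfl⟩
      obtain ⟨i, rfl⟩ := σ.surjective k
      exact ⟨i, (hs x i).1 hk, (hc i).symm⟩
    · rintro ⟨i, hi, rfl⟩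
      exact ⟨σ i, (hs x i).2 hi, hc i⟩
  change g ∈ Submodule.span _ (c' '' {i | s' i (f x) = 0}) ↔ _
  rw [h1]
  rfl

section CutWalls

variable {ι : Type*}

/-- The walls after cutting off the corner at the origin. -/
noncomputable def cutWall (s : ι → E 3 → ℝ) : Option ι → E 3 → ℝ
  | none => fun x => l1 x - 1 / 2
  | some i => s i

/-- The colors of the walls after cutting off the corner at the origin. -/
def cutColor (c : ι → V3) : Option ι → V3
  | none => 1
  | some i => c i

/-- The restriction of `wallSpan` to a subset of `ℝ³`. -/
abbrev wallSpanOn (X : Set (E 3)) (s : ι → E 3 → ℝ) (c : ι → V3) :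
    X → Submodule (ZMod 2) V3 := wallSpan (fun i (x : X) => s i x) c

variable {X : Set (E 3)} {s : ι → E 3 → ℝ} {c : ι → V3}

theorem isCutStab_cutWall (h : IsCorner X (wallSpanOn X s c)) :
    IsCorner.IsCutStab (wallSpanOn X s c)
      (wallSpanOn (IsCorner.cut X) (cutWall s) (cutColor c)) := by
  constructor
  · intro y hy
    unfold wallSpanOn wallSpan
    congr 1
    ext v
    constructor
    · rintro ⟨i | i, hi, rfl⟩
      · have : l1 y.1 - 1 / 2 = 0 := hi
        linarith
      · exact ⟨i, hi, rfl⟩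
    · rintro ⟨i, hi, rfl⟩
      exact ⟨some i, hi, rfl⟩
  · intro y hy g
    have h1 : cutColor c '' {i | cutWall s i y.1 = 0} = insert 1 (c '' {i | s i y.1 = 0}) := by
      ext v
      constructor
      · rintro ⟨i | i, hi, rfl⟩
        · exact Or.inl rfl
        · exact Or.inr ⟨i, hi, rfl⟩
      · rintro (rfl | ⟨i, hi, rfl⟩)
        · exact ⟨none, by simp [cutWall, hy], rfl⟩
        · exact ⟨some i, hi, rfl⟩
    have h2 := h.stab ⟨y, y.2.1⟩ (show l1 y.1 < 1 by rw [hy]; norm_num)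
    change g ∈ Submodule.span _ (cutColor c '' {i | cutWall s i y.1 = 0}) ↔ _
    rw [h1, mem_span_insert_iff]
    refine or_congr (h2 g) ((h2 (g - 1)).trans (forall_congr' fun i => imp_congr_right fun _ => ?_))
    rw [Pi.sub_apply, Pi.one_apply, sub_eq_zero]

theorem isConnectedSum_cutWall [Finite ι] (hs : ∀ i, Continuous (s i))
    (h : IsCorner X (wallSpanOn X s c)) :
    IsConnectedSum 3 (Glued (wallSpanOn (IsCorner.cut X) (cutWall s) (cutColor c)))
      (Glued (wallSpanOn X s c)) (RealProjectiveSpace 3) := by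
  have hs' : ∀ i, Continuous (cutWall s i) := fun i => by
    rcases i with _ | i
    · exact continuous_l1.sub continuous_const
    · exact hs i
  have := t2Space_glued_wallSpan (fun i (x : X) => s i x)
    (fun i => (hs i).comp continuous_subtype_val) c
  have := t2Space_glued_wallSpan (fun i (x : IsCorner.cut X) => cutWall s i x)
    (fun i => (hs' i).comp continuous_subtype_val) (cutColor c)
  exact IsCorner.isConnectedSum_cut h (isCutStab_cutWall h)

/-- Verifies the stabilizer condition of a corner: if the only walls met are coordinate planes with
the standard basis as colors, an element of their span may be nonzero only in the vanishing
coordinates. -/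
theorem stab_of_walls (k : Fin 3 → ι) (hc : ∀ i, c (k i) = Pi.single i 1) {x : E 3}
    (hs : ∀ j, s j x = 0 ↔ ∃ i, k i = j ∧ x i = 0) (g : V3) :
    g ∈ Submodule.span (ZMod 2) (c '' {j | s j x = 0}) ↔ ∀ i, x i ≠ 0 → g i = 0 := by
  have : c '' {j | s j x = 0} = (fun i => Pi.single i 1) '' {i | x i = 0} := by
    ext v
    constructor
    · rintro ⟨j, hj, rfl⟩
      obtain ⟨i, rfl, hi⟩ := (hs j).1 hj
      exact ⟨i, hi, (hc i).symm⟩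
    · rintro ⟨i, hi, rfl⟩
      exact ⟨k i, (hs _).2 ⟨i, rfl, hi⟩, hc i⟩
  rw [this, mem_span_single]
  rfl

end CutWalls

/-! ### The simplex and `ℝP³` -/

/-- The simplex spanned by the origin and the standard basis. -/
def simplex : Set (E 3) := {x | (∀ i, 0 ≤ x i) ∧ l1 x ≤ 1}

/-- The facets of the simplex are given by the vanishing of these functions. -/
noncomputable def simplexWall : Option (Fin 3) → E 3 → ℝ
  | none => fun x => 1 - l1 x
  | some i => fun x => x i

/-- A coloring of the simplex. -/
def simplexColor : Option (Fin 3) → V3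
  | none => 1
  | some i => Pi.single i 1

theorem continuous_simplexWall (i : Option (Fin 3)) : Continuous (simplexWall i) := by
  rcases i with _ | i
  · exact continuous_const.sub continuous_l1
  · exact (EuclideanSpace.proj (𝕜 := ℝ) i).continuous

theorem isCompact_simplex : IsCompact simplex := by
  refine Metric.isCompact_of_isClosed_isBounded ?_ ?_
  · have : simplex = (⋂ i, {x : E 3 | 0 ≤ x i}) ∩ {x | l1 x ≤ 1} := by
      ext x
      simp [simplex]
    rw [this]
    refine (isClosed_iInter fun i => isClosed_le continuous_const ?_).inter
      (isClosed_le continuous_l1 continuous_const)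
    exact (EuclideanSpace.proj (𝕜 := ℝ) i).continuous
  · exact isBounded_iff_forall_norm_le.2 ⟨1, fun x hx => (norm_le_l1 x).trans hx.2⟩

theorem isCorner_simplex : IsCorner simplex (wallSpanOn simplex simplexWall simplexColor) where
  isCompact := isCompact_simplex
  nonneg x hx := hx.1
  mem x hx hl := ⟨hx, hl.le⟩
  stab x hx g := by
    refine stab_of_walls some (fun i => rfl) (fun j => ?_) g
    rcases j with _ | j
    · simp only [simplexWall, reduceCtorEq, false_and, exists_false, iff_false]
      intro h
      linarith
    · simp [simplexWall]

/-- The facet opposite the origin adds the color `(1, 1, 1)`; over `ℤ/2` this adds just one further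
coset, giving the second alternative. -/
theorem mem_wallSpanOn_simplex {x : simplex} {g : V3} :
    g ∈ wallSpanOn simplex simplexWall simplexColor x ↔
      (∀ i, x.1 i ≠ 0 → g i = 0) ∨ (l1 x = 1 ∧ ∀ i, x.1 i ≠ 0 → g i = 1) := by
  by_cases hx : l1 x < 1
  · rw [isCorner_simplex.stab x hx]
    simp [hx.ne]
  · have hx1 : l1 x = 1 := le_antisymm x.2.2 (not_lt.1 hx)
    have h1 : simplexColor '' {j | simplexWall j x.1 = 0} =
        insert 1 ((fun i => Pi.single i 1) '' {i | x.1 i = 0}) := by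
      ext v
      constructor
      · rintro ⟨i | i, hi, rfl⟩
        · exact Or.inl rfl
        · exact Or.inr ⟨i, hi, rfl⟩
      · rintro (rfl | ⟨i, hi, rfl⟩)
        · exact ⟨none, by simp [simplexWall, hx1], rfl⟩
        · exact ⟨some i, hi, rfl⟩
    change g ∈ Submodule.span _ (simplexColor '' {j | simplexWall j x.1 = 0}) ↔ _
    rw [h1, mem_span_insert_iff, mem_span_single, mem_span_single]
    simp only [hx1, true_and, Pi.sub_apply, Pi.one_apply, sub_eq_zero]
    rfl

/-- The eight copies of the simplex unfold to the octahedron `l1 ≤ 1`, whose boundary points are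
identified antipodally. Taking `1 - l1` as an extra homogeneous coordinate maps this to `ℝP³`: the
interior goes to an affine part, the boundary to the plane at infinity. -/
theorem nonempty_simplexCover_homeomorph :
    Nonempty (Glued (wallSpanOn simplex simplexWall simplexColor) ≃ₜ RealProjectiveSpace 3) := by
  have : CompactSpace simplex := isCompact_iff_compactSpace.1 isCompact_simplex
  have h0 : ∀ p : simplex × V3, hom (1 - l1 p.1) (flip p.2 p.1) ≠ 0 := fun p h => by
    obtain ⟨h1, h2⟩ := hom_eq_zero_iff.1 h
    have h3 := l1_flip p.2 p.1
    rw [h2, l1_eq_zero.2 rfl] at h3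
    linarith
  refine Glued.nonempty_homeomorph_of_kernel
    (fun p : simplex × V3 => proj (hom (1 - l1 p.1) (flip p.2 p.1)) (h0 p)) ?_ ?_ ?_
  · have hv : Continuous fun p : simplex × V3 => p.1.1 :=
      continuous_subtype_val.comp continuous_fst
    exact continuous_proj (continuous_hom (continuous_const.sub (continuous_l1.comp hv))
      (continuous_uncurry_flip.comp (hv.prodMk continuous_snd))) _
  · intro b
    obtain ⟨s, y, hs, hv, rfl⟩ := exists_proj_hom_eq b
    have hl := l1_nonneg y
    have hpos : 0 < s + l1 y := by
      refine (add_nonneg hs hl).lt_of_ne fun h1 => hv (hom_eq_zero_iff.2 ⟨by linarith, ?_⟩)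
      exact l1_eq_zero.1 (by linarith)
    have hi : 0 ≤ (s + l1 y)⁻¹ := by positivity
    have hz1 : l1 ((s + l1 y)⁻¹ • absVec y) = (s + l1 y)⁻¹ * l1 y := by
      rw [l1_smul, l1_absVec, abs_of_nonneg hi]
    -- Homogeneous coordinates are rescaled so that `s + l1 y = 1`, as holds for all images of
    -- points of the simplex.
    refine ⟨(⟨(s + l1 y)⁻¹ • absVec y, fun i => mul_nonneg hi (abs_nonneg (y i)), ?_⟩,
      signVec y), proj_eq_proj_iff.2 ⟨(s + l1 y)⁻¹, hom_eq_smul_iff.2 ⟨?_, ?_⟩⟩⟩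
    · rw [hz1, inv_mul_le_iff₀ hpos]
      linarith
    · dsimp only
      rw [hz1]
      field_simp
      ring
    · dsimp only
      rw [flip_smul, flip_signVec_absVec]
  · rintro ⟨x, g⟩ ⟨y, k⟩
    rw [proj_eq_proj_iff]
    dsimp only
    rw [mem_wallSpanOn_simplex]
    constructor
    · rintro ⟨r, hr⟩
      obtain ⟨h1, h2⟩ := hom_eq_smul_iff.1 hr
      have h3 := congrArg l1 h2
      rw [l1_smul, l1_flip, l1_flip] at h3
      have hx2 : l1 x.1 ≤ 1 := x.2.2
      have hy2 : l1 y.1 ≤ 1 := y.2.2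
      have h4 : |r| = 1 := by
        have h5 := congrArg abs h1
        rw [abs_mul, abs_of_nonneg (by linarith : 0 ≤ 1 - l1 x.1),
          abs_of_nonneg (by linarith : 0 ≤ 1 - l1 y.1)] at h5
        linarith
      rcases (abs_eq zero_le_one).1 h4 with rfl | rfl
      · rw [one_smul] at h2
        obtain rfl : x = y := Subtype.ext (eq_of_flip_eq_flip x.2.1 y.2.1 h2)
        exact ⟨rfl, Or.inl (flip_eq_flip_iff.1 h2)⟩
      · rw [neg_smul, one_smul] at h2
        obtain rfl : x = y := Subtype.ext
          (eq_of_flip_eq_flip x.2.1 y.2.1 (h2.trans (flip_add_one _ _).symm))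
        exact ⟨rfl, Or.inr ⟨by linarith, flip_eq_neg_flip_iff.1 h2⟩⟩
    · rintro ⟨hxy, H⟩
      obtain rfl : x = y := hxy
      rcases H with H | ⟨hl, H⟩
      · exact ⟨1, hom_eq_smul_iff.2 ⟨by ring, by rw [one_smul]; exact flip_eq_flip_iff.2 H⟩⟩
      · refine ⟨-1, hom_eq_smul_iff.2 ⟨by rw [hl]; ring, ?_⟩⟩
        rw [neg_smul, one_smul]
        exact flip_eq_neg_flip_iff.2 H

end SmallCovers

/-! ### The prism with dependent side colors and `S¹ × ℝP²` -/

namespace SmallCovers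

open RealProjectiveSpace

/-- The standard triangular prism as a set. -/
def prism : Set (E 3) := {x | 0 ≤ x 0 ∧ 0 ≤ x 1 ∧ x 0 + x 1 ≤ 1 ∧ 0 ≤ x 2 ∧ x 2 ≤ 1}

/-- The facets of the prism are given by the vanishing of these functions. -/
def prismWall : Fin 5 → E 3 → ℝ :=
  ![fun x => x 0, fun x => x 1, fun x => 1 - x 0 - x 1, fun x => x 2, fun x => 1 - x 2]

theorem continuous_prismWall (i : Fin 5) : Continuous (prismWall i) := by
  fin_cases i <;> simp only [prismWall] <;> dsimp <;> fun_prop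

theorem carrier_triangularPrism : triangularPrism.carrier = prism := by
  ext x
  simp only [ConvexPolytope.carrier, triangularPrism, prism, Set.mem_ofPred_eq,
    Fin.forall_fin_succ, IsEmpty.forall_iff]
  simp [inner_eq]

theorem prismWall_eq_zero_iff {x : E 3} {i : Fin 5} :
    prismWall i x = 0 ↔ i ∈ triangularPrism.act x := by
  rw [ConvexPolytope.mem_act]
  fin_cases i <;> simp [prismWall, triangularPrism, inner_eq] <;>
    constructor <;> intro h <;> linarith

theorem isCompact_prism : IsCompact prism :=
  carrier_triangularPrism ▸ triangularPrism.isCompact_carrier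

/-- The barycentric coordinates of the projection of a point of the prism to the triangle. -/
noncomputable def bary (x : E 3) : E 3 := !₂[x 0, x 1, 1 - x 0 - x 1]

theorem bary_nonneg (x : prism) (i : Fin 3) : 0 ≤ bary x.1 i := by
  obtain ⟨x, h0, h1, h2, h3, h4⟩ := x
  fin_cases i <;> simp [bary] <;> linarith

theorem l1_bary (x : prism) : l1 (bary x.1) = 1 := by
  have h := bary_nonneg x
  simp only [l1, abs_of_nonneg (h _), Fin.sum_univ_three]
  simp [bary]

theorem continuous_bary : Continuous bary := by
  refine (PiLp.continuous_toLp 2 _).comp (continuous_pi fun i => ?_)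
  fin_cases i <;> simp <;> fun_prop

/-- The reflection of the triangle determined by the first two coordinates. -/
def dropLast (g : V3) : V3 := ![g 0, g 1, 0]

theorem dropLast_add (g k : V3) : dropLast (g + k) = dropLast g + dropLast k := by
  ext i
  fin_cases i <;> simp [dropLast]

theorem dropLast_sub (g k : V3) : dropLast (g - k) = dropLast g - dropLast k := by
  ext i
  fin_cases i <;> simp [dropLast]

theorem flip_add (g k : V3) (x : E 3) : flip (g + k) x = flip g (flip k x) := by
  ext i
  simp only [flip_apply, Pi.add_apply, sgn_add, mul_assoc]

/-- A path of linear automorphisms that connects the two identifications of the triangle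
reflections at the two ends of the prism. -/
structure IsTwist (w : V3) (H : ℝ → E 3 →ₗ[ℝ] E 3) : Prop where
  continuous : Continuous fun p : ℝ × E 3 => H p.1 p.2
  neg_apply : ∀ θ v, H (-θ) (H θ v) = v
  ends : ∀ v, H Real.pi v = H (-Real.pi) (flip (dropLast w) v) ∨
    H Real.pi v = -H (-Real.pi) (flip (dropLast w) v)

/-- Rotation through `θ / 2` in a coordinate plane differs between `π` and `-π` by a half turn,
which is `-1` on the plane and `1` on the axis. A half turn in the first two coordinates is the
product of two reflections; a half turn in a plane containing the third coordinate is minus a single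
reflection, and this sign is invisible projectively. -/
theorem exists_isTwist (w : V3) : ∃ H, IsTwist w H := by
  have hc : ∀ θ : ℝ, Real.sin (θ / 2) ^ 2 + Real.cos (θ / 2) ^ 2 = 1 := fun θ =>
    Real.sin_sq_add_cos_sq (θ / 2)
  have hneg : ∀ θ : ℝ, -θ / 2 = -(θ / 2) := fun θ => neg_div _ _
  rcases zmod2_cases (w 0) with h0 | h0 <;> rcases zmod2_cases (w 1) with h1 | h1
  · refine ⟨fun _ => LinearMap.id, continuous_snd, fun _ _ => rfl, fun v => Or.inl ?_⟩
    ext i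
    fin_cases i <;> simp [dropLast, h0, h1]
  · refine ⟨fun θ =>
      { toFun := fun v => !₂[Real.cos (θ / 2) * v 0 - Real.sin (θ / 2) * v 2, v 1,
          Real.sin (θ / 2) * v 0 + Real.cos (θ / 2) * v 2]
        map_add' := fun v v' => by ext i; fin_cases i <;> simp <;> ring
        map_smul' := fun r v => by ext i; fin_cases i <;> simp <;> ring }, ?_, ?_, ?_⟩
    · refine (PiLp.continuous_toLp 2 _).comp (continuous_pi fun i => ?_)
      fin_cases i <;> simp <;> fun_prop
    · intro θ v
      ext i
      fin_cases i <;> simp [hneg]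
      · linear_combination v 0 * hc θ
      · linear_combination v 2 * hc θ
    · intro v
      right
      ext i
      fin_cases i <;> simp [hneg, dropLast, h0, h1]
  · refine ⟨fun θ =>
      { toFun := fun v => !₂[v 0, Real.cos (θ / 2) * v 1 - Real.sin (θ / 2) * v 2,
          Real.sin (θ / 2) * v 1 + Real.cos (θ / 2) * v 2]
        map_add' := fun v v' => by ext i; fin_cases i <;> simp <;> ring
        map_smul' := fun r v => by ext i; fin_cases i <;> simp <;> ring }, ?_, ?_, ?_⟩
    · refine (PiLp.continuous_toLp 2 _).comp (continuous_pi fun i => ?_)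
      fin_cases i <;> simp <;> fun_prop
    · intro θ v
      ext i
      fin_cases i <;> simp [hneg]
      · linear_combination v 1 * hc θ
      · linear_combination v 2 * hc θ
    · intro v
      right
      ext i
      fin_cases i <;> simp [hneg, dropLast, h0, h1]
  · refine ⟨fun θ =>
      { toFun := fun v => !₂[Real.cos (θ / 2) * v 0 - Real.sin (θ / 2) * v 1,
          Real.sin (θ / 2) * v 0 + Real.cos (θ / 2) * v 1, v 2]
        map_add' := fun v v' => by ext i; fin_cases i <;> simp <;> ring
        map_smul' := fun r v => by ext i; fin_cases i <;> simp <;> ring }, ?_, ?_, ?_⟩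
    · refine (PiLp.continuous_toLp 2 _).comp (continuous_pi fun i => ?_)
      fin_cases i <;> simp <;> fun_prop
    · intro θ v
      ext i
      fin_cases i <;> simp [hneg]
      · linear_combination v 0 * hc θ
      · linear_combination v 1 * hc θ
    · intro v
      left
      ext i
      fin_cases i <;> simp [hneg, dropLast, h0, h1]

/-- The colorings of the prism for which the colors of the three quadrilaterals are dependent. -/
def productColor (w : V3) : Fin 5 → V3 := ![![1, 0, 0], ![0, 1, 0], ![1, 1, 0], ![0, 0, 1], ![w 0, w 1, 1]]

theorem single_mem_wallSpanOn {ι : Type*} {X : Set (E 3)} {s : ι → E 3 → ℝ} {c : ι → V3} {x : X}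
    {i : ι} (h : s i x.1 = 0) : c i ∈ wallSpanOn X s c x := Submodule.subset_span ⟨i, h, rfl⟩

/-- If all relevant entries are `1`, the third barycentric coordinate must vanish, because the third
entry of `dropLast d` is `0`. The point then lies on the third side, and subtracting its color `(1,
1, 0)` leaves the case of zero entries. -/
theorem mem_productSpan_of_dropLast {w d : V3} {x : prism} (h2 : d 2 = 0)
    (h : (∀ i, bary x.1 i ≠ 0 → dropLast d i = 0) ∨ ∀ i, bary x.1 i ≠ 0 → dropLast d i = 1) :
    d ∈ wallSpanOn prism prismWall (productColor w) x := by
  have key : ∀ d : V3, d 2 = 0 → (∀ i, bary x.1 i ≠ 0 → dropLast d i = 0) →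
      d ∈ wallSpanOn prism prismWall (productColor w) x := by
    intro d h2 h
    have hd : d = d 0 • (![1, 0, 0] : V3) + d 1 • (![0, 1, 0] : V3) := by
      ext i
      fin_cases i <;> simp [h2]
    rw [hd]
    refine Submodule.add_mem _ ?_ ?_
    · by_cases h0 : bary x.1 0 = 0
      · exact Submodule.smul_mem _ _
          (single_mem_wallSpanOn (c := productColor w) (i := 0) (by simpa [bary, prismWall] using h0))
      · rw [show d 0 = 0 from h 0 h0, zero_smul]
        exact Submodule.zero_mem _
    · by_cases h0 : bary x.1 1 = 0
      · exact Submodule.smul_mem _ _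
          (single_mem_wallSpanOn (c := productColor w) (i := 1) (by simpa [bary, prismWall] using h0))
      · rw [show d 1 = 0 from h 1 h0, zero_smul]
        exact Submodule.zero_mem _
  rcases h with h | h
  · exact key d h2 h
  · have h3 : bary x.1 2 = 0 := by
      by_contra h3
      exact absurd (h 2 h3) (by simp [dropLast])
    have h4 : (![1, 1, 0] : V3) ∈ wallSpanOn prism prismWall (productColor w) x :=
      single_mem_wallSpanOn (c := productColor w) (i := 2) (by simpa [bary, prismWall] using h3)
    have h5 : d - ![1, 1, 0] ∈ wallSpanOn prism prismWall (productColor w) x := by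
      refine key _ (by simp [h2]) fun i hi => ?_
      have := h i hi
      fin_cases i
      · simpa [dropLast, sub_eq_zero] using this
      · simpa [dropLast, sub_eq_zero] using this
      · rfl
    rw [← sub_add_cancel d ![1, 1, 0]]
    exact Submodule.add_mem _ h5 h4

section Product

variable {w : V3} {H : ℝ → E 3 →ₗ[ℝ] E 3}

/-- The angle corresponding to a point of the prism. -/
noncomputable def prismAngle (p : prism × V3) : ℝ := sgn (p.2 2) * (Real.pi * p.1.1 2)

theorem IsTwist.ne_zero (hH : IsTwist w H) (θ : ℝ) {v : E 3} (hv : v ≠ 0) : H θ v ≠ 0 := fun h => by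
  have := hH.neg_apply θ v
  rw [h, map_zero] at this
  exact hv this.symm

theorem IsTwist.eq_smul (hH : IsTwist w H) {θ : ℝ} {v v' : E 3} {r : ℝ}
    (h : H θ v = r • H θ v') : v = r • v' := by
  rw [← hH.neg_apply θ v, h, map_smul, hH.neg_apply]

theorem flip_bary_ne_zero (g : V3) (x : prism) : flip g (bary x.1) ≠ 0 := fun h => by
  have h1 := l1_flip g (bary x.1)
  rw [h, l1_bary, l1_eq_zero.2 rfl] at h1
  exact zero_ne_one h1

/-- The map to `S¹ × ℝP²` that identifies the small cover. -/
noncomputable def productMap (hH : IsTwist w H) (p : prism × V3) :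
    Circle × RealProjectiveSpace 2 :=
  (Circle.exp (prismAngle p), proj (H (prismAngle p) (flip (dropLast p.2) (bary p.1.1)))
    (hH.ne_zero _ (flip_bary_ne_zero _ _)))

theorem productMap_eq_mk_iff (hH : IsTwist w H) {p : prism × V3} {ζ : Circle} {v : E 3}
    {hv : v ≠ 0} : productMap hH p = (ζ, proj v hv) ↔ Circle.exp (prismAngle p) = ζ ∧
      ∃ r : ℝ, H (prismAngle p) (flip (dropLast p.2) (bary p.1.1)) = r • v :=
  Prod.ext_iff.trans (and_congr Iff.rfl
    (proj_eq_proj_iff (hv := hH.ne_zero _ (flip_bary_ne_zero _ _)) (hw := hv)))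

theorem productMap_eq_iff (hH : IsTwist w H) {p q : prism × V3} :
    productMap hH p = productMap hH q ↔ Circle.exp (prismAngle p) = Circle.exp (prismAngle q) ∧
      ∃ r : ℝ, H (prismAngle p) (flip (dropLast p.2) (bary p.1.1)) =
        r • H (prismAngle q) (flip (dropLast q.2) (bary q.1.1)) :=
  productMap_eq_mk_iff hH

theorem continuous_prismAngle : Continuous prismAngle := by
  refine Continuous.mul ?_ ?_
  · exact (continuous_of_discreteTopology (f := fun g : V3 => sgn (g 2))).comp continuous_snd
  · refine continuous_const.mul ?_
    exact (EuclideanSpace.proj (𝕜 := ℝ) (2 : Fin 3)).continuous.comp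
      (continuous_subtype_val.comp continuous_fst)

theorem continuous_productMap (hH : IsTwist w H) : Continuous (productMap hH) := by
  refine (Circle.exp.continuous.comp continuous_prismAngle).prodMk (continuous_proj ?_ _)
  refine hH.continuous.comp (continuous_prismAngle.prodMk ?_)
  refine continuous_uncurry_flip.comp
    ((continuous_bary.comp (continuous_subtype_val.comp continuous_fst)).prodMk ?_)
  exact (continuous_of_discreteTopology (f := dropLast)).comp continuous_snd

theorem surjective_productMap (hH : IsTwist w H) : Function.Surjective (productMap hH) := by
  rintro ⟨ζ, b⟩
  obtain ⟨θ, hθ1, hθ2, rfl⟩ : ∃ θ, -Real.pi ≤ θ ∧ θ ≤ Real.pi ∧ Circle.exp θ = ζ :=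
    ⟨Complex.arg ζ, (Complex.neg_pi_lt_arg _).le, Complex.arg_le_pi _, Circle.exp_arg ζ⟩
  obtain ⟨v, hv, rfl⟩ := exists_proj_eq b
  -- The representative is first untwisted by `H (-θ)`. Its third coordinate is then made
  -- nonnegative by a change of sign, since the triangle reflections in use never change that
  -- coordinate.
  obtain ⟨u, hu0, hu2, r, hu⟩ : ∃ u : E 3, u ≠ 0 ∧ 0 ≤ u 2 ∧ ∃ r : ℝ, H θ u = r • v := by
    have h0 : H (-θ) v ≠ 0 := hH.ne_zero _ hv
    have h1 : H θ (H (-θ) v) = v := by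
      have := hH.neg_apply (-θ) v
      rwa [neg_neg] at this
    rcases le_total 0 (H (-θ) v 2) with h2 | h2
    · exact ⟨_, h0, h2, 1, by rw [h1, one_smul]⟩
    · refine ⟨-H (-θ) v, neg_ne_zero.2 h0, by simpa using h2, -1, ?_⟩
      rw [map_neg, h1, neg_smul, one_smul]
  have hl := l1_pos hu0
  have hpi := Real.pi_pos
  have hsum : |u 0| + |u 1| + |u 2| = l1 u := by
    rw [l1, Fin.sum_univ_three]
  have hx : (!₂[|u 0| / l1 u, |u 1| / l1 u, |θ| / Real.pi] : E 3) ∈ prism := by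
    refine ⟨?_, ?_, ?_, ?_, ?_⟩
    · exact div_nonneg (abs_nonneg _) hl.le
    · exact div_nonneg (abs_nonneg _) hl.le
    · change |u 0| / l1 u + |u 1| / l1 u ≤ 1
      rw [← add_div, div_le_one hl]
      linarith [abs_nonneg (u 2)]
    · exact div_nonneg (abs_nonneg _) hpi.le
    · change |θ| / Real.pi ≤ 1
      rw [div_le_one hpi]
      exact abs_le.2 ⟨hθ1, hθ2⟩
  classical
  let g : V3 := ![signVec u 0, signVec u 1, if θ < 0 then 1 else 0]
  have hang : prismAngle (⟨_, hx⟩, g) = θ := by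
    change sgn (if θ < 0 then 1 else 0) * (Real.pi * (|θ| / Real.pi)) = θ
    rw [mul_div_cancel₀ _ hpi.ne']
    split_ifs with h
    · rw [abs_of_neg h, sgn_one]
      ring
    · rw [abs_of_nonneg (not_lt.1 h), sgn_zero, one_mul]
  have hsign : ∀ i, sgn (signVec u i) * |u i| = u i := fun i =>
    congrArg (fun v : E 3 => v i) (flip_signVec_absVec u)
  have hb : flip (dropLast g) (bary !₂[|u 0| / l1 u, |u 1| / l1 u, |θ| / Real.pi]) =
      (l1 u)⁻¹ • u := by
    ext i
    fin_cases i
    · change sgn (signVec u 0) * (|u 0| / l1 u) = (l1 u)⁻¹ * u 0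
      rw [← mul_div_assoc, hsign, div_eq_inv_mul]
    · change sgn (signVec u 1) * (|u 1| / l1 u) = (l1 u)⁻¹ * u 1
      rw [← mul_div_assoc, hsign, div_eq_inv_mul]
    · change sgn 0 * (1 - |u 0| / l1 u - |u 1| / l1 u) = (l1 u)⁻¹ * u 2
      have : |u 2| = u 2 := abs_of_nonneg hu2
      rw [sgn_zero]
      field_simp
      linarith
  refine ⟨(⟨_, hx⟩, g), (productMap_eq_mk_iff hH).2
    ⟨congrArg Circle.exp hang, (l1 u)⁻¹ * r, ?_⟩⟩
  rw [hang, hb, map_smul, hu, smul_smul]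

/-- Invariance needs checking only for the colors of the walls through `x`. Colors of the sides act
on the unfolded triangle trivially or antipodally, and the color of the bottom reverses the angle,
which is `0` there. -/
theorem productMap_add (hH : IsTwist w H) {x : prism} {d : V3}
    (hd : d ∈ wallSpanOn prism prismWall (productColor w) x) (g : V3) :
    productMap hH (x, g + d) = productMap hH (x, g) := by
  induction hd using Submodule.span_induction generalizing g with
  | zero => rw [add_zero]
  | add a b _ _ ha hb => rw [← add_assoc, hb, ha]
  | smul a y _ hy =>
    rcases zmod2_cases a with rfl | rfl
    · rw [zero_smul, add_zero]
    · rw [one_smul, hy]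
  | mem y hy =>
    obtain ⟨i, hi, rfl⟩ := hy
    have hside : ∀ y : V3, y 2 = 0 → ((∀ i, bary x.1 i ≠ 0 → dropLast y i = 0) ∨
        ∀ i, bary x.1 i ≠ 0 → dropLast y i = 1) →
        productMap hH (x, g + y) = productMap hH (x, g) := by
      intro y hy2 hy
      have hang : prismAngle (x, g + y) = prismAngle (x, g) := by
        simp [prismAngle, hy2]
      refine (productMap_eq_iff hH).2 ⟨congrArg Circle.exp hang, ?_⟩
      dsimp only
      rw [hang]
      rcases hy with hy | hy
      · refine ⟨1, ?_⟩
        rw [one_smul]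
        congr 1
        refine flip_eq_flip_iff.2 fun i hi => ?_
        rw [dropLast_add, add_sub_cancel_left, hy i hi]
      · refine ⟨-1, ?_⟩
        rw [neg_smul, one_smul, ← map_neg]
        congr 1
        refine flip_eq_neg_flip_iff.2 fun i hi => ?_
        rw [dropLast_add, add_sub_cancel_left, hy i hi]
    have hi' : prismWall i x.1 = 0 := hi
    fin_cases i
    · refine hside _ rfl (Or.inl fun i h => ?_)
      fin_cases i
      · exact absurd hi' h
      · rfl
      · rfl
    · refine hside _ rfl (Or.inl fun i h => ?_)
      fin_cases i
      · rfl
      · exact absurd hi' h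
      · rfl
    · refine hside _ rfl (Or.inr fun i h => ?_)
      fin_cases i
      · rfl
      · rfl
      · exact absurd hi' h
    · have hz : x.1 2 = 0 := hi'
      have hang : ∀ g, prismAngle (x, g) = 0 := fun g => by simp [prismAngle, hz]
      refine (productMap_eq_iff hH).2
        ⟨congrArg Circle.exp ((hang _).trans (hang _).symm), 1, ?_⟩
      dsimp only
      rw [hang, hang, one_smul]
      congr 2
      rw [dropLast_add]
      ext i
      fin_cases i <;> simp [dropLast, productColor]
    -- On the top facet the angle passes between `π` and `-π`. The color also reflects the triangle
    -- by `dropLast w`, which is compensated up to sign by the twist.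
    · have hz : x.1 2 = 1 := by
        have : 1 - x.1 2 = 0 := hi'
        linarith
      have hdl : dropLast (productColor w 4) = dropLast w := by
        ext i
        fin_cases i <;> rfl
      have h4 : productColor w 4 2 = 1 := rfl
      change productMap hH (x, g + productColor w 4) = _
      have hend : ∀ v, ∃ r : ℝ, H Real.pi v = r • H (-Real.pi) (flip (dropLast w) v) := fun v => by
        rcases hH.ends v with h | h
        · exact ⟨1, by rw [one_smul, h]⟩
        · exact ⟨-1, by rw [neg_smul, one_smul, h]⟩
      have hend' : ∀ v, ∃ r : ℝ, H (-Real.pi) v = r • H Real.pi (flip (dropLast w) v) := fun v => by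
        have hff : flip (dropLast w) (flip (dropLast w) v) = v := by
          ext i
          simp [← mul_assoc]
        rcases hH.ends (flip (dropLast w) v) with h | h
        · exact ⟨1, by rw [one_smul, h, hff]⟩
        · exact ⟨-1, by rw [h, hff, neg_smul, one_smul, neg_neg]⟩
      have hcirc : Circle.exp Real.pi = Circle.exp (-Real.pi) :=
        Circle.exp_eq_exp.2 ⟨1, by push_cast; ring⟩
      rcases zmod2_cases (g 2) with hg | hg
      · have a1 : prismAngle (x, g) = Real.pi := by simp [prismAngle, hz, hg]
        have a2 : prismAngle (x, g + productColor w 4) = -Real.pi := by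
          simp [prismAngle, hz, hg, h4]
        refine (productMap_eq_iff hH).2 ⟨?_, ?_⟩
        · rw [a1, a2, hcirc]
        · dsimp only
          rw [a1, a2, dropLast_add, hdl, add_comm, flip_add]
          obtain ⟨r, hr⟩ := hend' (flip (dropLast w) (flip (dropLast g) (bary x.1)))
          refine ⟨r, hr.trans ?_⟩
          congr 2
          ext i
          simp [← mul_assoc]
      · have a1 : prismAngle (x, g) = -Real.pi := by simp [prismAngle, hz, hg]
        have a2 : prismAngle (x, g + productColor w 4) = Real.pi := by
          simp [prismAngle, hz, hg, h4, show (1 + 1 : ZMod 2) = 0 from rfl]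
        refine (productMap_eq_iff hH).2 ⟨?_, ?_⟩
        · rw [a1, a2, hcirc]
        · dsimp only
          rw [a1, a2, dropLast_add, hdl, add_comm, flip_add]
          obtain ⟨r, hr⟩ := hend (flip (dropLast w) (flip (dropLast g) (bary x.1)))
          refine ⟨r, hr.trans ?_⟩
          congr 2
          ext i
          simp [← mul_assoc]

/-- Barycentric vectors have `ℓ¹`-norm `1` and reflections preserve it, so the scalar is `±1`. -/
theorem eq_of_flip_bary {x y : prism} {g k : V3} {r : ℝ}
    (h : flip g (bary x.1) = r • flip k (bary y.1)) : bary x.1 = bary y.1 ∧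
      ((∀ i, bary x.1 i ≠ 0 → (g - k) i = 0) ∨ ∀ i, bary x.1 i ≠ 0 → (g - k) i = 1) := by
  have h1 := congrArg l1 h
  rw [l1_smul, l1_flip, l1_flip, l1_bary, l1_bary, mul_one, eq_comm, abs_eq zero_le_one] at h1
  rcases h1 with rfl | rfl
  · rw [one_smul] at h
    have h2 := eq_of_flip_eq_flip (bary_nonneg x) (bary_nonneg y) h
    rw [← h2] at h
    exact ⟨h2, Or.inl (flip_eq_flip_iff.1 h)⟩
  · rw [neg_smul, one_smul] at h
    have h2 := eq_of_flip_eq_flip (bary_nonneg x) (bary_nonneg y) (h.trans (flip_add_one _ _).symm)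
    rw [← h2] at h
    exact ⟨h2, Or.inr (flip_eq_neg_flip_iff.1 h)⟩

theorem ext_prism {x y : prism} (h : bary x.1 = bary y.1) (h2 : x.1 2 = y.1 2) : x = y := by
  refine Subtype.ext (PiLp.ext fun i => ?_)
  fin_cases i
  · have := congrArg (fun v : E 3 => v 0) h
    exact this
  · have := congrArg (fun v : E 3 => v 1) h
    exact this
  · exact h2

theorem abs_prismAngle (p : prism × V3) : |prismAngle p| = Real.pi * p.1.1 2 := by
  rw [prismAngle, abs_mul, abs_sgn, one_mul]
  exact abs_of_nonneg (mul_nonneg Real.pi_pos.le p.1.2.2.2.2.1)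

/-- Both angles lie in `[-π, π]` and differ by an integral multiple of `2π`, which can only be
`-2π`, `0` or `2π`. -/
theorem prismAngle_cases {p q : prism × V3}
    (h : Circle.exp (prismAngle p) = Circle.exp (prismAngle q)) :
    prismAngle p = prismAngle q ∨ (prismAngle p = Real.pi ∧ prismAngle q = -Real.pi) ∨
      (prismAngle q = Real.pi ∧ prismAngle p = -Real.pi) := by
  obtain ⟨m, hm⟩ := Circle.exp_eq_exp.1 h
  have hpi := Real.pi_pos
  have hle : ∀ p : prism × V3, |prismAngle p| ≤ Real.pi := fun p => by
    rw [abs_prismAngle]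
    exact mul_le_of_le_one_right hpi.le p.1.2.2.2.2.2
  obtain ⟨p1, p2⟩ := abs_le.1 (hle p)
  obtain ⟨q1, q2⟩ := abs_le.1 (hle q)
  have hm1 : m < 2 := by
    by_contra hlt
    have : (2 : ℝ) ≤ m := by exact_mod_cast not_lt.1 hlt
    nlinarith
  have hm2 : -2 < m := by
    by_contra hlt
    have : (m : ℝ) ≤ -2 := by exact_mod_cast not_lt.1 hlt
    nlinarith
  obtain rfl | rfl | rfl : m = -1 ∨ m = 0 ∨ m = 1 := by omega
  · right; right
    push_cast at hm
    constructor <;> linarith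
  · left
    simpa using hm
  · right; left
    push_cast at hm
    constructor <;> linarith

/-- Both points are on the top facet, in copies on opposite sides of it. The end condition of the
twist turns the equation into one at the single angle `-π` with an additional reflection `dropLast
w`; subtracting the color of the top facet removes it. -/
theorem rel_of_prismAngle_eq_pi (hH : IsTwist w H) {p q : prism × V3}
    (h : productMap hH p = productMap hH q) (hp : prismAngle p = Real.pi)
    (hq : prismAngle q = -Real.pi) : p.1 = q.1 ∧
      p.2 - q.2 ∈ wallSpanOn prism prismWall (productColor w) p.1 := by
  obtain ⟨x, g⟩ := p
  obtain ⟨y, k⟩ := q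
  have hpi := Real.pi_pos
  have hx := abs_prismAngle (x, g)
  have hy := abs_prismAngle (y, k)
  rw [hp, abs_of_pos hpi] at hx
  rw [hq, abs_neg, abs_of_pos hpi] at hy
  have hx1 : x.1 2 = 1 := by
    have := mul_left_cancel₀ hpi.ne' ((mul_one _).trans hx)
    exact this.symm
  have hy1 : y.1 2 = 1 := by
    have := mul_left_cancel₀ hpi.ne' ((mul_one _).trans hy)
    exact this.symm
  have hg : g 2 = 0 := by
    rcases zmod2_cases (g 2) with hg | hg
    · exact hg
    · simp only [prismAngle, hg, hx1, sgn_one] at hp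
      linarith
  have hk : k 2 = 1 := by
    rcases zmod2_cases (k 2) with hk | hk
    · simp only [prismAngle, hk, hy1, sgn_zero] at hq
      linarith
    · exact hk
  obtain ⟨-, r, hr⟩ := (productMap_eq_iff hH).1 h
  dsimp only at hr
  rw [hp, hq] at hr
  obtain ⟨r', hr'⟩ : ∃ r' : ℝ, flip (dropLast w + dropLast g) (bary x.1) =
      r' • flip (dropLast k) (bary y.1) := by
    rcases hH.ends (flip (dropLast g) (bary x.1)) with h1 | h1
    · rw [h1, ← flip_add] at hr
      exact ⟨r, hH.eq_smul hr⟩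
    · rw [h1, ← flip_add, neg_eq_iff_eq_neg, ← neg_smul] at hr
      exact ⟨-r, hH.eq_smul hr⟩
  obtain ⟨hb, hd⟩ := eq_of_flip_bary hr'
  have hxy : x = y := ext_prism hb (hx1.trans hy1.symm)
  refine ⟨hxy, ?_⟩
  have h4 : productColor w 4 ∈ wallSpanOn prism prismWall (productColor w) x :=
    single_mem_wallSpanOn (i := 4) (show 1 - x.1 2 = 0 by rw [hx1, sub_self])
  change g - k ∈ _
  rw [← sub_add_cancel (g - k) (productColor w 4)]
  refine Submodule.add_mem _ (mem_productSpan_of_dropLast ?_ ?_) h4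
  · change g 2 - k 2 - 1 = 0
    rw [hg, hk]
    rfl
  · have : dropLast (g - k - productColor w 4) = dropLast w + dropLast g - dropLast k := by
      have hdl : dropLast (productColor w 4) = dropLast w := by
        ext i
        fin_cases i <;> rfl
      rw [dropLast_sub, dropLast_sub, hdl]
      ext i
      simp only [Pi.sub_apply, Pi.add_apply]
      generalize dropLast w i = a
      generalize dropLast g i = b
      generalize dropLast k i = c
      revert a b c
      decide
    rwa [this]

theorem rel_of_productMap_eq (hH : IsTwist w H) {p q : prism × V3}
    (h : productMap hH p = productMap hH q) : p.1 = q.1 ∧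
      p.2 - q.2 ∈ wallSpanOn prism prismWall (productColor w) p.1 := by
  obtain ⟨hexp, r, hr⟩ := (productMap_eq_iff hH).1 h
  rcases prismAngle_cases hexp with hang | ⟨hp, hq⟩ | ⟨hq, hp⟩
  · obtain ⟨x, g⟩ := p
    obtain ⟨y, k⟩ := q
    dsimp only at hr ⊢
    have hx := abs_prismAngle (x, g)
    rw [hang, abs_prismAngle] at hx
    have hz : x.1 2 = y.1 2 := (mul_left_cancel₀ Real.pi_pos.ne' hx).symm
    rw [hang] at hr
    obtain ⟨hb, hd⟩ := eq_of_flip_bary (hH.eq_smul hr)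
    have hxy : x = y := ext_prism hb hz
    refine ⟨hxy, ?_⟩
    rw [← dropLast_sub] at hd
    by_cases h2 : g 2 = k 2
    · exact mem_productSpan_of_dropLast (sub_eq_zero.2 h2) hd
    -- Equal angles with opposite signs must be zero, so the point is on the bottom facet, whose
    -- color accounts for the difference in the last entry.
    · have hz0 : x.1 2 = 0 := by
        simp only [prismAngle, hz] at hang
        have := sgn_injective.ne h2
        by_contra hne
        rw [hz] at hne
        exact this (mul_right_cancel₀ (mul_ne_zero Real.pi_pos.ne' hne) hang)
      have h3 : (![0, 0, 1] : V3) ∈ wallSpanOn prism prismWall (productColor w) x :=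
        single_mem_wallSpanOn (c := productColor w) (i := 3) hz0
      rw [← sub_add_cancel (g - k) ![0, 0, 1]]
      refine Submodule.add_mem _ (mem_productSpan_of_dropLast ?_ ?_) h3
      · change g 2 - k 2 - 1 = 0
        generalize g 2 = a at h2 ⊢
        generalize k 2 = b at h2 ⊢
        revert a b
        decide
      · have : dropLast (![0, 0, 1] : V3) = 0 := by decide
        rwa [dropLast_sub (g - k), this, sub_zero]
  · exact rel_of_prismAngle_eq_pi hH h hp hq
  · obtain ⟨h1, h2⟩ := rel_of_prismAngle_eq_pi hH h.symm hq hp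
    refine ⟨h1.symm, ?_⟩
    rw [← h1, ← neg_sub]
    exact Submodule.neg_mem _ h2

/-- The small covers of the prism for which the colors of the quadrilaterals are dependent. -/
theorem nonempty_productCover_homeomorph (w : V3) :
    Nonempty (Glued (wallSpanOn prism prismWall (productColor w)) ≃ₜ
      Circle × RealProjectiveSpace 2) := by
  obtain ⟨H, hH⟩ := exists_isTwist w
  have : CompactSpace prism := isCompact_iff_compactSpace.1 isCompact_prism
  refine Glued.nonempty_homeomorph_of_kernel (productMap hH) (continuous_productMap hH)
    (surjective_productMap hH) fun p q => ⟨rel_of_productMap_eq hH, ?_⟩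
  obtain ⟨x, g⟩ := p
  obtain ⟨y, k⟩ := q
  rintro ⟨hxy, hgk⟩
  obtain rfl : x = y := hxy
  have := productMap_add hH hgk k
  rwa [add_sub_cancel] at this

end Product

end SmallCovers

/-! ### Connected sums under homeomorphisms -/

namespace SmallCovers

open RealProjectiveSpace

section ConnectedSumCongr

variable {n : ℕ} {A A' B X X' : Type*} [TopologicalSpace A] [TopologicalSpace A']
  [TopologicalSpace B] [TopologicalSpace X] [TopologicalSpace X']

theorem IsConnectedSum.congr_left (e : X ≃ₜ X') (h : IsConnectedSum n X A B) :
    IsConnectedSum n X' A B :=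
  let ⟨φ, ψ, hφ, hψ, ⟨f⟩⟩ := h
  ⟨φ, ψ, hφ, hψ, ⟨e.symm.trans f⟩⟩

/-- The map of connected sums induced by a map of the first summand. -/
theorem exists_connSum_map (e : A ≃ₜ A') (φ : E n → A) (φ' : E n → A') (h : ∀ x, φ' x = e (φ x))
    (ψ : E n → B) :
    ∃ F : ConnSum φ ψ → ConnSum φ' ψ, Continuous F ∧
      (∀ (a : DiscComplement φ) (a' : DiscComplement φ'), a'.1 = e a.1 →
        F (Quot.mk _ (Sum.inl a)) = Quot.mk _ (Sum.inl a')) ∧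
      ∀ b, F (Quot.mk _ (Sum.inr b)) = Quot.mk _ (Sum.inr b) := by
  have hmem : ∀ a : DiscComplement φ, e a.1 ∉ φ' '' Metric.ball 0 1 := by
    rintro a ⟨x, hx, hxa⟩
    exact a.2 ⟨x, hx, e.injective ((h x).symm.trans hxa)⟩
  let g : DiscComplement φ ⊕ DiscComplement ψ → DiscComplement φ' ⊕ DiscComplement ψ :=
    Sum.map (fun a => ⟨e a.1, hmem a⟩) id
  have hg : Continuous g :=
    ((e.continuous.comp continuous_subtype_val).subtype_mk _).sumMap continuous_id
  have hr : ∀ p q, sphereGluing φ ψ p q → sphereGluing φ' ψ (g p) (g q) := by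
    rintro _ _ ⟨a, b, rfl, rfl, x, hx, hxa, hxb⟩
    exact ⟨_, _, rfl, rfl, x, hx, (h x).trans (congrArg e hxa), hxb⟩
  refine ⟨Quot.map g hr, continuous_quot_lift _ (continuous_quot_mk.comp hg), ?_, fun b => rfl⟩
  rintro a ⟨_, ha'⟩ rfl
  rfl

theorem IsConnectedSum.congr_summand (e : A ≃ₜ A') (h : IsConnectedSum n X A B) :
    IsConnectedSum n X A' B := by
  obtain ⟨φ, ψ, hφ, hψ, ⟨f⟩⟩ := h
  have hs : ∀ x, φ x = e.symm (e (φ x)) := fun x => (e.symm_apply_apply _).symm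
  obtain ⟨F, hF, hFl, hFr⟩ := exists_connSum_map e φ (e ∘ φ) (fun _ => rfl) ψ
  obtain ⟨G, hG, hGl, hGr⟩ := exists_connSum_map e.symm (e ∘ φ) φ hs ψ
  have hm : ∀ a : DiscComplement φ, e a.1 ∉ (e ∘ φ) '' Metric.ball 0 1 := by
    rintro a ⟨x, hx, hxa⟩
    exact a.2 ⟨x, hx, e.injective hxa⟩
  have hm' : ∀ a : DiscComplement (e ∘ φ), e.symm a.1 ∉ φ '' Metric.ball 0 1 := by
    rintro a ⟨x, hx, hxa⟩
    exact a.2 ⟨x, hx, (congrArg e hxa).trans (e.apply_symm_apply _)⟩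
  refine ⟨e ∘ φ, ψ, e.isOpenEmbedding.comp hφ, hψ, ⟨f.trans
    { toFun := F, invFun := G, left_inv := ?_, right_inv := ?_
      continuous_toFun := hF, continuous_invFun := hG }⟩⟩
  · rintro ⟨a | b⟩
    · exact (congrArg G (hFl a ⟨_, hm a⟩ rfl)).trans (hGl _ a (e.symm_apply_apply _).symm)
    · exact (congrArg G (hFr b)).trans (hGr b)
  · rintro ⟨a | b⟩
    · exact (congrArg F (hGl a ⟨_, hm' a⟩ rfl)).trans (hFl _ a (e.apply_symm_apply _).symm)
    · exact (congrArg F (hGr b)).trans (hFr b)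

end ConnectedSumCongr

/-! ### Normal forms of colors and the small covers of the prism -/

/-- Linear independence of three colors. -/
def Indep (u v w : V3) : Prop := ∀ x : V3, x 0 • u + x 1 • v + x 2 • w = 0 → x = 0

instance (u v w : V3) : Decidable (Indep u v w) := by
  unfold Indep
  infer_instance

theorem indep_iff {u v w : V3} : Indep u v w ↔ LinearIndependent (ZMod 2) ![u, v, w] := by
  rw [Fintype.linearIndependent_iff]
  refine forall_congr' fun x => ?_
  rw [Fin.sum_univ_three]
  exact imp_congr_right fun _ => funext_iff

theorem indep_map {u v w : V3} (L : V3 ≃ₗ[ZMod 2] V3) :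
    Indep (L u) (L v) (L w) ↔ Indep u v w := by
  refine forall_congr' fun x => ?_
  rw [← map_smul, ← map_smul, ← map_smul, ← map_add, ← map_add, LinearEquiv.map_eq_zero_iff]

/-- Allows any three independent colors to be taken as the standard basis; the possibilities for the
remaining colors are then finite checks. -/
theorem Indep.exists_equiv {u v w : V3} (h : Indep u v w) : ∃ L : V3 ≃ₗ[ZMod 2] V3,
    L u = Pi.single 0 1 ∧ L v = Pi.single 1 1 ∧ L w = Pi.single 2 1 := by
  have hli := indep_iff.1 h
  let b := basisOfLinearIndependentOfCardEqFinrank hli (by simp)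
  have hb : ∀ i, b.equivFun (![u, v, w] i) = Pi.single i 1 := fun i => by
    have : ![u, v, w] i = b i := by simp [b]
    ext j
    rw [this, Module.Basis.equivFun_self]
    simp [Pi.single_apply, eq_comm]
  exact ⟨b.equivFun, hb 0, hb 1, hb 2⟩

section Prism

/-- The conditions on the colors of the facets of a prism. -/
structure IsPrismColoring (d : Fin 5 → V3) : Prop where
  h013 : Indep (d 0) (d 1) (d 3)
  h023 : Indep (d 0) (d 2) (d 3)
  h123 : Indep (d 1) (d 2) (d 3)
  h014 : Indep (d 0) (d 1) (d 4)
  h024 : Indep (d 0) (d 2) (d 4)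
  h124 : Indep (d 1) (d 2) (d 4)

theorem IsPrismColoring.map {d : Fin 5 → V3} (h : IsPrismColoring d) (L : V3 ≃ₗ[ZMod 2] V3) :
    IsPrismColoring fun i => L (d i) :=
  ⟨(indep_map L).2 h.h013, (indep_map L).2 h.h023, (indep_map L).2 h.h123, (indep_map L).2 h.h014,
    (indep_map L).2 h.h024, (indep_map L).2 h.h124⟩

theorem nonempty_recolor {ι : Type*} {X : Set (E 3)} (s : ι → E 3 → ℝ) (d d' : ι → V3)
    (L : V3 ≃ₗ[ZMod 2] V3) (h : ∀ i, d' i = L (d i)) :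
    Nonempty (Glued (wallSpanOn X s d) ≃ₜ Glued (wallSpanOn X s d')) := by
  refine Glued.nonempty_homeomorph_map _ (Homeomorph.refl _) L fun x g => ?_
  have h1 : d' '' {i | s i x.1 = 0} = L '' (d '' {i | s i x.1 = 0}) := by
    rw [← Set.image_comp]
    exact Set.image_congr fun i _ => h i
  change L g ∈ Submodule.span _ (d' '' {i | s i x.1 = 0}) ↔ _
  rw [h1]
  change L g ∈ Submodule.span _ ((L : V3 →ₗ[ZMod 2] V3) '' _) ↔ _
  rw [Submodule.span_image]
  exact Submodule.map_equiv_eq_comap_symm L _ ▸ (by simp [wallSpan])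

/-- The correspondence between the facets of the prism and those of the simplex with its corner cut
off. -/
noncomputable def prismFacetEquiv : Fin 5 ≃ Option (Option (Fin 3)) :=
  Equiv.ofBijective ![some (some 0), some (some 1), some (some 2), none, some none] (by decide)

/-- The slices of the cut simplex at constant `l1` are triangles. The slice of the prism at height
`z` is sent to the one with `l1 = (z + 1) / 2`, so that the bottom becomes the new facet at `1 / 2`
and the top the facet opposite the origin. -/
theorem nonempty_prism_homeomorph_cut_simplex (d : Fin 5 → V3)
    (hd : ∀ i, cutColor simplexColor (prismFacetEquiv i) = d i) :
    Nonempty (Glued (wallSpanOn prism prismWall d) ≃ₜ Glued (wallSpanOn (IsCorner.cut simplex)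
      (cutWall simplexWall) (cutColor simplexColor))) := by
  have : CompactSpace prism := isCompact_iff_compactSpace.1 isCompact_prism
  have hpos : ∀ x : prism, 0 < (x.1 2 + 1) / 2 := fun x => by
    have := x.2.2.2.2.1
    linarith
  have hl : ∀ x : prism, l1 (((x.1 2 + 1) / 2) • bary x.1) = (x.1 2 + 1) / 2 := fun x => by
    rw [l1_smul, l1_bary, abs_of_pos (hpos x), mul_one]
  have hmem : ∀ x : prism, ((x.1 2 + 1) / 2) • bary x.1 ∈ IsCorner.cut simplex := fun x => by
    have h1 := x.2.2.2.2.1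
    have h2 := x.2.2.2.2.2
    refine ⟨⟨fun i => mul_nonneg (hpos x).le (bary_nonneg x i), ?_⟩, ?_⟩
    · rw [hl]
      linarith
    · rw [hl]
      linarith
  refine Glued.nonempty_homeomorph_wallSpan _ _ _ _ prismFacetEquiv (fun x => ⟨_, hmem x⟩) ?_
    ⟨?_, ?_⟩ ?_ hd
  · refine Continuous.subtype_mk ?_ _
    have h1 : Continuous fun x : prism => (x.1 2 + 1) / 2 := by fun_prop
    exact h1.smul (continuous_bary.comp continuous_subtype_val)
  · intro x y hxy
    have h1 := congrArg Subtype.val hxy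
    dsimp only at h1
    have h2 := congrArg l1 h1
    rw [hl, hl] at h2
    rw [h2] at h1
    exact ext_prism (smul_right_injective _ (hpos y).ne' h1) (by linarith)
  · rintro ⟨y, ⟨hy0, hy1⟩, hy2⟩
    have hyl : 0 < l1 y := by linarith
    have hsum : y 0 + y 1 + y 2 = l1 y := by
      rw [l1, Fin.sum_univ_three, abs_of_nonneg (hy0 0), abs_of_nonneg (hy0 1),
        abs_of_nonneg (hy0 2)]
    refine ⟨⟨!₂[y 0 / l1 y, y 1 / l1 y, 2 * l1 y - 1], ?_, ?_, ?_, ?_, ?_⟩, Subtype.ext ?_⟩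
    · exact div_nonneg (hy0 0) hyl.le
    · exact div_nonneg (hy0 1) hyl.le
    · change y 0 / l1 y + y 1 / l1 y ≤ 1
      rw [← add_div, div_le_one hyl]
      linarith [hy0 2]
    · change 0 ≤ 2 * l1 y - 1
      linarith
    · change 2 * l1 y - 1 ≤ 1
      linarith
    · have h3 : (2 * l1 y - 1 + 1) / 2 = l1 y := by ring
      change ((2 * l1 y - 1 + 1) / 2) • bary _ = y
      rw [h3]
      ext i
      fin_cases i
      · change l1 y * (y 0 / l1 y) = y 0
        field_simp
      · change l1 y * (y 1 / l1 y) = y 1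
        field_simp
      · change l1 y * (1 - y 0 / l1 y - y 1 / l1 y) = y 2
        field_simp
        linarith
  · intro x i
    have hne := (hpos x).ne'
    fin_cases i
    · exact mul_eq_zero.trans (or_iff_right hne)
    · exact mul_eq_zero.trans (or_iff_right hne)
    · exact mul_eq_zero.trans (or_iff_right hne)
    · change l1 (((x.1 2 + 1) / 2) • bary x.1) - 1 / 2 = 0 ↔ x.1 2 = 0
      rw [hl]
      constructor <;> intro h <;> linarith
    · change 1 - l1 (((x.1 2 + 1) / 2) • bary x.1) = 0 ↔ 1 - x.1 2 = 0
      rw [hl]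
      constructor <;> intro h <;> linarith

/-- The small covers of the triangular prism. -/
theorem prismCover_cases {d : Fin 5 → V3} (hd : IsPrismColoring d) :
    IsConnectedSum 3 (Glued (wallSpanOn prism prismWall d)) (RealProjectiveSpace 3)
        (RealProjectiveSpace 3) ∨
      Nonempty (Glued (wallSpanOn prism prismWall d) ≃ₜ Circle × RealProjectiveSpace 2) := by
  by_cases h012 : Indep (d 0) (d 1) (d 2)
  · left
    obtain ⟨L, h0, h1, h2⟩ := h012.exists_equiv
    have hLd := hd.map L
    -- Independence of `u` from each pair of basis vectors makes all three coordinates nonzero, so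
    -- both triangles have color `(1, 1, 1)`.
    have key : ∀ u : V3, Indep (Pi.single 0 1) (Pi.single 1 1) u →
        Indep (Pi.single 0 1) (Pi.single 2 1) u → Indep (Pi.single 1 1) (Pi.single 2 1) u →
        u = 1 := by decide
    have h3 := key _ (h0 ▸ h1 ▸ hLd.h013) (h0 ▸ h2 ▸ hLd.h023) (h1 ▸ h2 ▸ hLd.h123)
    have h4 := key _ (h0 ▸ h1 ▸ hLd.h014) (h0 ▸ h2 ▸ hLd.h024) (h1 ▸ h2 ▸ hLd.h124)
    obtain ⟨e₁⟩ := nonempty_recolor (X := prism) prismWall d (fun i => L (d i)) L fun _ => rfl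
    obtain ⟨e₂⟩ := nonempty_prism_homeomorph_cut_simplex (fun i => L (d i)) fun i => by
      fin_cases i
      · exact h0.symm
      · exact h1.symm
      · exact h2.symm
      · exact h3.symm
      · exact h4.symm
    obtain ⟨e₃⟩ := nonempty_simplexCover_homeomorph
    exact ((isConnectedSum_cutWall continuous_simplexWall isCorner_simplex).congr_left
      (e₁.trans e₂).symm).congr_summand e₃
  · right
    obtain ⟨L, h0, h1, h3⟩ := hd.h013.exists_equiv
    have hLd := hd.map L
    -- Dependence places the third side color in the span of the first two; the vertex conditions
    -- then make both of its coordinates nonzero.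
    have key : ∀ u : V3, Indep (Pi.single 0 1) u (Pi.single 2 1) →
        Indep (Pi.single 1 1) u (Pi.single 2 1) → ¬ Indep (Pi.single 0 1) (Pi.single 1 1) u →
        u = ![1, 1, 0] := by decide
    have h2 := key _ (h0 ▸ h3 ▸ hLd.h023) (h1 ▸ h3 ▸ hLd.h123) fun h => by
      rw [← h0, ← h1] at h
      exact h012 ((indep_map L).1 h)
    have key4 : ∀ u : V3, Indep (Pi.single 0 1) (Pi.single 1 1) u → u = ![u 0, u 1, 1] := by decide
    have h4 := key4 _ (h0 ▸ h1 ▸ hLd.h014)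
    obtain ⟨e₁⟩ := nonempty_recolor (X := prism) prismWall d (productColor (L (d 4))) L fun i => by
      fin_cases i
      · exact (show (![1, 0, 0] : V3) = Pi.single 0 1 by decide).trans h0.symm
      · exact (show (![0, 1, 0] : V3) = Pi.single 1 1 by decide).trans h1.symm
      · exact h2.symm
      · exact (show (![0, 0, 1] : V3) = Pi.single 2 1 by decide).trans h3.symm
      · exact h4.symm
    obtain ⟨e₂⟩ := nonempty_productCover_homeomorph (L (d 4))
    exact ⟨e₁.trans e₂⟩

theorem isCorner_prism {d : Fin 5 → V3} (h0 : d 0 = Pi.single 0 1) (h1 : d 1 = Pi.single 1 1)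
    (h3 : d 3 = Pi.single 2 1) : IsCorner prism (wallSpanOn prism prismWall d) where
  isCompact := isCompact_prism
  nonneg x hx i := by
    obtain ⟨hx0, hx1, hx2, hx3, hx4⟩ := hx
    fin_cases i
    exacts [hx0, hx1, hx3]
  mem x hx hl := by
    rw [l1, Fin.sum_univ_three, abs_of_nonneg (hx 0), abs_of_nonneg (hx 1),
      abs_of_nonneg (hx 2)] at hl
    exact ⟨hx 0, hx 1, by linarith [hx 2], hx 2, by linarith [hx 0, hx 1]⟩
  stab x hl g := by
    obtain ⟨x, hx0, hx1, hx2, hx3, hx4⟩ := x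
    dsimp only at hl
    rw [l1, Fin.sum_univ_three, abs_of_nonneg hx0, abs_of_nonneg hx1, abs_of_nonneg hx3] at hl
    refine stab_of_walls ![0, 1, 3] (fun i => ?_) (fun j => ?_) g
    · fin_cases i
      exacts [h0, h1, h3]
    · simp only [Fin.exists_fin_succ, IsEmpty.exists_iff]
      fin_cases j <;> simp [prismWall]
      · intro h
        linarith
      · intro h
        linarith

end Prism

end SmallCovers

/-! ### Vertices and colorings of the triangular prism -/

namespace SmallCovers

open RealProjectiveSpace

section Vertices

variable {n : ℕ} {ι κ : Type*} {P : ConvexPolytope 3 ι} {Q : ConvexPolytope 3 κ}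

/-- The colors of the three facets through a vertex `w` of a combinatorially equivalent polytope
are independent. -/
theorem indep_of_vertex {c : ι → V3} (hc : P.IsColoring c) (σ : ι ≃ κ)
    (e : P.carrier ≃ₜ Q.carrier) (he : ∀ x i, σ i ∈ Q.act (e x) ↔ i ∈ P.act x) {w : E 3}
    (hw : w ∈ Q.carrier) (f : Fin 3 → κ) (hf : Function.Injective f) (hfw : ∀ a, f a ∈ Q.act w)
    (hpin : ∀ y, (∀ a, f a ∈ Q.act y) → y = w) :
    Indep (c (σ.symm (f 0))) (c (σ.symm (f 1))) (c (σ.symm (f 2))) := by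
  rw [indep_iff]
  convert hc.linearIndependent σ e he hw (fun y _ h => hpin y fun a => h (hfw a)) f hf hfw using 1
  ext a
  fin_cases a <;> rfl

end Vertices

section Prism

/-- The facets through the vertices of the prism. -/
def prismTriple : Fin 6 → Fin 3 → Fin 5 :=
  ![![0, 1, 3], ![0, 2, 3], ![1, 2, 3], ![0, 1, 4], ![0, 2, 4], ![1, 2, 4]]

/-- The vertices of the prism. -/
noncomputable def prismVertex : Fin 6 → E 3 :=
  ![!₂[0, 0, 0], !₂[0, 1, 0], !₂[1, 0, 0], !₂[0, 0, 1], !₂[0, 1, 1], !₂[1, 0, 1]]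

theorem prismVertex_mem (a : Fin 6) : prismVertex a ∈ prism := by
  fin_cases a <;> simp [prism, prismVertex]

theorem prismWall_eq_zero_iff_eq_vertex (a : Fin 6) (y : E 3) :
    (∀ k, prismWall (prismTriple a k) y = 0) ↔ y = prismVertex a := by
  constructor
  · intro h
    have h0 := h 0
    have h1 := h 1
    have h2 := h 2
    ext i
    fin_cases a <;> simp [prismTriple, prismWall] at h0 h1 h2 <;>
      fin_cases i <;> simp [prismVertex] <;> linarith
  · rintro rfl k
    fin_cases a <;> fin_cases k <;> simp [prismTriple, prismWall, prismVertex]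

theorem isPrismColoring_of_isColoring {ι : Type*} {P : ConvexPolytope 3 ι} {c : ι → V3}
    (hc : P.IsColoring c) (σ : ι ≃ Fin 5) (e : P.carrier ≃ₜ triangularPrism.carrier)
    (he : ∀ x i, σ i ∈ triangularPrism.act (e x) ↔ i ∈ P.act x) :
    IsPrismColoring fun i => c (σ.symm i) := by
  have key : ∀ a, Indep (c (σ.symm (prismTriple a 0))) (c (σ.symm (prismTriple a 1)))
      (c (σ.symm (prismTriple a 2))) := fun a => by
    refine indep_of_vertex hc σ e he (w := prismVertex a)
      (carrier_triangularPrism ▸ prismVertex_mem a) (prismTriple a) ?_ (fun k => ?_) fun y hy => ?_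
    · revert a
      decide
    · exact prismWall_eq_zero_iff.1 ((prismWall_eq_zero_iff_eq_vertex a _).2 rfl k)
    · exact (prismWall_eq_zero_iff_eq_vertex a y).1 fun k => prismWall_eq_zero_iff.2 (hy k)
  exact ⟨key 0, key 1, key 2, key 3, key 4, key 5⟩

/-- The small covers of the polytopes equivalent to the triangular prism. -/
theorem smallCover_cases_of_combEquiv_prism {ι : Type*} [Finite ι] (P : ConvexPolytope 3 ι)
    {c : ι → V3} (hc : P.IsColoring c) (h : P.CombEquiv triangularPrism) :
    IsConnectedSum 3 (P.SmallCover c) (RealProjectiveSpace 3) (RealProjectiveSpace 3) ∨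
      Nonempty (P.SmallCover c ≃ₜ Circle × RealProjectiveSpace 2) := by
  obtain ⟨σ, e, he⟩ := h.exists_homeomorph
  obtain ⟨g⟩ := P.nonempty_smallCover_homeomorph c σ
    (e.trans (Homeomorph.setCongr carrier_triangularPrism)) (fun i x => prismWall i x.1)
    (fun i => c (σ.symm i)) (LinearEquiv.refl _ _)
    (fun x i => prismWall_eq_zero_iff.trans (he x i)) (fun i => by simp)
  rcases prismCover_cases (isPrismColoring_of_isColoring hc σ e he) with h1 | ⟨⟨f⟩⟩
  · exact Or.inl (h1.congr_left g.symm)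
  · exact Or.inr ⟨g.trans f⟩

end Prism

/-! ### The truncated prism and its hidden symmetry -/

section TruncatedPrism

/-- The functions defining the facets of the truncated prism. -/
noncomputable def truncWall : Fin 6 → E 3 → ℝ :=
  ![fun x => x 0, fun x => x 1, fun x => 1 - x 0 - x 1, fun x => x 2, fun x => 1 - x 2,
    fun x => 1 / 2 - x 2 + x 0 + x 1]

theorem truncWall_eq (i : Fin 6) (x : E 3) :
    truncWall i x = truncatedPrism.offset i - inner ℝ (truncatedPrism.normal i) x := by
  fin_cases i <;> simp [truncWall, truncatedPrism, inner_eq] <;> ring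

theorem mem_carrier_truncatedPrism {x : E 3} :
    x ∈ truncatedPrism.carrier ↔ ∀ i, 0 ≤ truncWall i x :=
  forall_congr' fun i => by rw [truncWall_eq, sub_nonneg]

theorem truncWall_eq_zero_iff {i : Fin 6} {x : E 3} :
    truncWall i x = 0 ↔ i ∈ truncatedPrism.act x := by
  rw [truncWall_eq, sub_eq_zero, eq_comm]
  rfl

/-- The facets through the vertices of the truncated prism. -/
def truncTriple : Fin 8 → Fin 3 → Fin 6 :=
  ![![0, 1, 5], ![0, 4, 5], ![1, 4, 5], ![0, 2, 4], ![1, 2, 4], ![0, 1, 3], ![0, 2, 3], ![1, 2, 3]]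

/-- The vertices of the truncated prism. -/
noncomputable def truncVertex : Fin 8 → E 3 :=
  ![!₂[0, 0, 1 / 2], !₂[0, 1 / 2, 1], !₂[1 / 2, 0, 1], !₂[0, 1, 1], !₂[1, 0, 1], !₂[0, 0, 0],
    !₂[0, 1, 0], !₂[1, 0, 0]]

theorem truncVertex_mem (a : Fin 8) : truncVertex a ∈ truncatedPrism.carrier := by
  rw [mem_carrier_truncatedPrism]
  intro i
  fin_cases a <;> fin_cases i <;> simp [truncWall, truncVertex] <;> norm_num

theorem truncWall_vertex (a : Fin 8) (i : Fin 6) :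
    truncWall i (truncVertex a) = 0 ↔ ∃ k, truncTriple a k = i := by
  fin_cases a <;> fin_cases i <;> first
    | exact iff_of_true (by simp [truncWall, truncVertex] <;> norm_num) (by decide)
    | exact iff_of_false (by simp [truncWall, truncVertex] <;> norm_num) (by decide)

theorem eq_truncVertex {a : Fin 8} {y : E 3} (h : ∀ k, truncWall (truncTriple a k) y = 0) :
    y = truncVertex a := by
  have h0 := h 0
  have h1 := h 1
  have h2 := h 2
  ext i
  fin_cases a <;> simp [truncTriple, truncWall] at h0 h1 h2 <;>
    fin_cases i <;> simp [truncVertex] <;> linarith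

/-- The conditions on the colors of the facets of a truncated prism. -/
def IsTruncColoring (d : Fin 6 → V3) : Prop :=
  ∀ a, Indep (d (truncTriple a 0)) (d (truncTriple a 1)) (d (truncTriple a 2))

theorem isTruncColoring_of_isColoring {ι : Type*} {P : ConvexPolytope 3 ι} {c : ι → V3}
    (hc : P.IsColoring c) (σ : ι ≃ Fin 6) (e : P.carrier ≃ₜ truncatedPrism.carrier)
    (he : ∀ x i, σ i ∈ truncatedPrism.act (e x) ↔ i ∈ P.act x) :
    IsTruncColoring fun i => c (σ.symm i) := fun a => by
  refine indep_of_vertex hc σ e he (truncVertex_mem a) (truncTriple a) ?_ (fun k => ?_)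
    fun y hy => eq_truncVertex fun k => truncWall_eq_zero_iff.2 (hy k)
  · revert a
    decide
  · exact truncWall_eq_zero_iff.1 ((truncWall_vertex a _).2 ⟨k, rfl⟩)

/-- The sets of facets of the truncated prism that have a common vertex. -/
def IsTruncSimplex (S : Finset (Fin 6)) : Prop := ∃ a, ∀ i ∈ S, ∃ k, truncTriple a k = i

instance (S : Finset (Fin 6)) : Decidable (IsTruncSimplex S) := by
  unfold IsTruncSimplex
  infer_instance

/-- The five excluded sets are the minimal sets of facets without a common vertex: three pairs of
disjoint facets, and the two triples at the vertices cut off from a simplex with facets `0, 1, 2,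
4`. -/
theorem isTruncSimplex_of_nonfaces : ∀ S : Finset (Fin 6), ¬ (3 ∈ S ∧ 4 ∈ S) → ¬ (3 ∈ S ∧ 5 ∈ S) →
    ¬ (2 ∈ S ∧ 5 ∈ S) → ¬ (0 ∈ S ∧ 1 ∈ S ∧ 2 ∈ S) → ¬ (0 ∈ S ∧ 1 ∈ S ∧ 4 ∈ S) →
    IsTruncSimplex S := by
  decide

theorem IsTruncSimplex.eq_inter : ∀ S : Finset (Fin 6), IsTruncSimplex S →
    ∀ i, (∀ a, (∀ j ∈ S, ∃ k, truncTriple a k = j) → ∃ k, truncTriple a k = i) → i ∈ S := by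
  decide

/-- Taking midpoints successively intersects the tight sets of the vertices. -/
theorem exists_act_eq_inter (T : Finset (Fin 8)) (hT : T.Nonempty) :
    ∃ x ∈ truncatedPrism.carrier,
      truncatedPrism.act x = {i | ∀ a ∈ T, ∃ k, truncTriple a k = i} := by
  induction hT using Finset.Nonempty.cons_induction with
  | singleton a =>
    refine ⟨truncVertex a, truncVertex_mem a, ?_⟩
    ext i
    rw [← truncWall_eq_zero_iff, truncWall_vertex]
    simp
  | cons a T ha hT ih =>
    obtain ⟨x, hx, hxT⟩ := ih
    refine ⟨_, truncatedPrism.convex_comb_mem (truncVertex_mem a) hx (t := 1 / 2) (by norm_num)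
      (by norm_num), ?_⟩
    rw [truncatedPrism.act_convex_comb (truncVertex_mem a) hx (by norm_num) (by norm_num), hxT]
    ext i
    rw [Set.mem_inter_iff, ← truncWall_eq_zero_iff, truncWall_vertex]
    simp

/-- A tight set contains no minimal nonface, since the corresponding equations contradict the
remaining inequalities. Conversely, a set of facets with a common vertex is the intersection of the
triples of all vertices containing it, and is realized by an iterated midpoint of these vertices. -/
theorem exists_act_truncatedPrism_iff (S : Finset (Fin 6)) :
    (∃ x ∈ truncatedPrism.carrier, truncatedPrism.act x = S) ↔ IsTruncSimplex S := by
  constructor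
  · rintro ⟨x, hx, hS⟩
    have h : ∀ i, i ∈ S ↔ truncWall i x = 0 := fun i => by
      rw [truncWall_eq_zero_iff, hS, Finset.mem_coe]
    have h0 : 0 ≤ x 0 := mem_carrier_truncatedPrism.1 hx 0
    have h1 : 0 ≤ x 1 := mem_carrier_truncatedPrism.1 hx 1
    have h2 : 0 ≤ 1 - x 0 - x 1 := mem_carrier_truncatedPrism.1 hx 2
    have h4 : 0 ≤ 1 - x 2 := mem_carrier_truncatedPrism.1 hx 4
    have h5 : 0 ≤ 1 / 2 - x 2 + x 0 + x 1 := mem_carrier_truncatedPrism.1 hx 5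
    apply isTruncSimplex_of_nonfaces <;> simp only [h] <;> simp [truncWall] <;> intros <;> linarith
  · intro hS
    obtain ⟨x, hx, hxS⟩ := exists_act_eq_inter
      (Finset.univ.filter fun a => ∀ j ∈ S, ∃ k, truncTriple a k = j) (by
        obtain ⟨a, ha⟩ := hS
        exact ⟨a, by simpa using ha⟩)
    refine ⟨x, hx, hxS.trans ?_⟩
    ext i
    constructor
    · intro hi
      exact hS.eq_inter S i fun a ha => hi a (by simpa using ha)
    · intro hi a ha
      exact (Finset.mem_filter.1 ha).2 i hi

/-- A symmetry of the face lattice of the truncated prism. -/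
def truncSwap : Equiv.Perm (Fin 6) := Equiv.swap 3 5 * Equiv.swap 2 4

/-- Viewed as a simplex with two vertices cut off, the polytope has a symmetry exchanging the two
triangles `3` and `5` left by the cuts. It is needed only combinatorially: the coning theorem turns
the permutation of facets into a homeomorphism. -/
theorem exists_truncatedPrism_swap : ∃ r : truncatedPrism.carrier ≃ₜ truncatedPrism.carrier,
    ∀ x i, truncSwap i ∈ truncatedPrism.act (r x) ↔ i ∈ truncatedPrism.act x := by
  refine ConvexPolytope.exists_homeomorph_of_act _ _ truncSwap fun S => ?_
  classical
  have key : ∀ S : Finset (Fin 6), IsTruncSimplex S ↔ IsTruncSimplex (S.image truncSwap) := by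
    decide
  have h1 := exists_act_truncatedPrism_iff S.toFinset
  have h2 := exists_act_truncatedPrism_iff (S.toFinset.image truncSwap)
  rw [Finset.coe_image] at h2
  rw [Set.coe_toFinset] at h1 h2
  rw [h1, h2]
  exact key _

/-- The correspondence between the facets of the truncated prism and those of the prism with its
corner at the origin cut off. -/
noncomputable def truncFacetEquiv : Fin 6 ≃ Option (Fin 5) :=
  Equiv.ofBijective ![some 0, some 1, some 2, some 4, some 3, none] (by decide)

/-- The reflection `z ↦ 1 - z` moves the removed vertex `(0, 0, 1)` to the origin, exchanging top
and bottom, and the truncating inequality becomes `1 / 2 ≤ l1`. -/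
theorem nonempty_truncatedPrism_homeomorph_cut_prism (d : Fin 6 → V3) (d' : Fin 5 → V3)
    (hd : ∀ i, cutColor d' (truncFacetEquiv i) = d i) :
    Nonempty (Glued (wallSpanOn truncatedPrism.carrier truncWall d) ≃ₜ
      Glued (wallSpanOn (IsCorner.cut prism) (cutWall prismWall) (cutColor d'))) := by
  have hl : ∀ x ∈ truncatedPrism.carrier, l1 !₂[x 0, x 1, 1 - x 2] = truncWall 5 x + 1 / 2 := by
    intro x hx
    have h0 : 0 ≤ x 0 := mem_carrier_truncatedPrism.1 hx 0
    have h1 : 0 ≤ x 1 := mem_carrier_truncatedPrism.1 hx 1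
    have h4 : 0 ≤ 1 - x 2 := mem_carrier_truncatedPrism.1 hx 4
    rw [l1, Fin.sum_univ_three]
    change |x 0| + |x 1| + |1 - x 2| = 1 / 2 - x 2 + x 0 + x 1 + 1 / 2
    rw [abs_of_nonneg h0, abs_of_nonneg h1, abs_of_nonneg h4]
    ring
  have hmem : ∀ x ∈ truncatedPrism.carrier, !₂[x 0, x 1, 1 - x 2] ∈ IsCorner.cut prism := by
    intro x hx
    have h := mem_carrier_truncatedPrism.1 hx
    have h2 : 0 ≤ 1 - x 0 - x 1 := h 2
    have h3 : 0 ≤ x 2 := h 3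
    refine ⟨⟨h 0, h 1, ?_, h 4, ?_⟩, ?_⟩
    · change x 0 + x 1 ≤ 1
      linarith
    · change 1 - x 2 ≤ 1
      linarith
    · rw [hl x hx]
      linarith [h 5]
  refine Glued.nonempty_homeomorph_wallSpan _ _ _ _ truncFacetEquiv
    (fun x => ⟨_, hmem x.1 x.2⟩) ?_ ⟨?_, ?_⟩ ?_ hd
  · exact Continuous.subtype_mk (by fun_prop) _
  · intro x y hxy
    have h := congrArg Subtype.val hxy
    have hz : ∀ i, (_ : E 3) i = (_ : E 3) i := fun i => congrArg (fun z : E 3 => z i) h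
    have h0 : x.1 0 = y.1 0 := hz 0
    have h1 : x.1 1 = y.1 1 := hz 1
    have h2 : 1 - x.1 2 = 1 - y.1 2 := hz 2
    refine Subtype.ext (PiLp.ext fun i => ?_)
    fin_cases i
    exacts [h0, h1, sub_right_injective h2]
  · rintro ⟨y, ⟨hy0, hy1, hy2, hy3, hy4⟩, hy5⟩
    rw [l1, Fin.sum_univ_three, abs_of_nonneg hy0, abs_of_nonneg hy1, abs_of_nonneg hy3] at hy5
    refine ⟨⟨!₂[y 0, y 1, 1 - y 2], ?_⟩, Subtype.ext (PiLp.ext fun i => ?_)⟩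
    · rw [mem_carrier_truncatedPrism]
      intro i
      fin_cases i <;> simp [truncWall] <;> linarith
    · fin_cases i
      · rfl
      · rfl
      · exact sub_sub_cancel 1 (y 2)
  · intro x i
    fin_cases i
    · exact Iff.rfl
    · exact Iff.rfl
    · exact Iff.rfl
    · change 1 - (1 - x.1 2) = 0 ↔ x.1 2 = 0
      rw [sub_sub_cancel]
    · exact Iff.rfl
    · change l1 !₂[x.1 0, x.1 1, 1 - x.1 2] - 1 / 2 = 0 ↔ truncWall 5 x.1 = 0
      rw [hl x.1 x.2, add_sub_cancel_right]

/-- If the colors of the facets at the removed vertex of the prism are independent, the small cover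
is obtained from a small cover of the prism by adding a projective space. -/
theorem exists_prismCover_isConnectedSum {d : Fin 6 → V3} (hd : IsTruncColoring d)
    (h : Indep (d 0) (d 1) (d 4)) : ∃ d' : Fin 5 → V3, IsPrismColoring d' ∧
      IsConnectedSum 3 (Glued (wallSpanOn truncatedPrism.carrier truncWall d))
        (Glued (wallSpanOn prism prismWall d')) (RealProjectiveSpace 3) := by
  obtain ⟨L, h0, h1, h4⟩ := h.exists_equiv
  have hLd : ∀ a, Indep (L (d (truncTriple a 0))) (L (d (truncTriple a 1)))
    (L (d (truncTriple a 2))) := fun a => (indep_map L).2 (hd a)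
  have key : ∀ u : V3, Indep (Pi.single 0 1) (Pi.single 1 1) u →
      Indep (Pi.single 0 1) (Pi.single 2 1) u → Indep (Pi.single 1 1) (Pi.single 2 1) u →
      u = 1 := by decide
  have h5 := key _ (h0 ▸ h1 ▸ hLd 0) (h0 ▸ h4 ▸ hLd 1) (h1 ▸ h4 ▸ hLd 2)
  -- The colors of top and bottom are exchanged because the removed vertex is moved to the origin by
  -- a reflection in height.
  let d' : Fin 5 → V3 := ![L (d 0), L (d 1), L (d 2), L (d 4), L (d 3)]
  refine ⟨d', ⟨(indep_map L).2 h, hLd 3, hLd 4, hLd 5, hLd 6, hLd 7⟩, ?_⟩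
  obtain ⟨e₁⟩ := nonempty_recolor (X := truncatedPrism.carrier) truncWall d (fun i => L (d i)) L
    fun _ => rfl
  obtain ⟨e₂⟩ := nonempty_truncatedPrism_homeomorph_cut_prism (fun i => L (d i)) d' fun i => by
    fin_cases i
    exacts [rfl, rfl, rfl, rfl, rfl, h5.symm]
  exact (isConnectedSum_cutWall continuous_prismWall (isCorner_prism h0 h1 h4)).congr_left
    (e₁.trans e₂).symm

/-- Take the colors of facets `0, 2, 4`, which share a vertex, as the basis. If both triples were
dependent, the color of facet `1` would have no component along those of `2` and `4`, hence would
equal the color of facet `0`, contradicting the vertex shared by facets `0, 1, 3`. -/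
theorem IsTruncColoring.indep_or {d : Fin 6 → V3} (hd : IsTruncColoring d) :
    Indep (d 0) (d 1) (d 4) ∨ Indep (d 0) (d 1) (d 2) := by
  obtain ⟨L, h0, h2, h4⟩ := Indep.exists_equiv (hd 3)
  replace h0 : L (d 0) = _ := h0
  replace h2 : L (d 2) = _ := h2
  replace h4 : L (d 4) = _ := h4
  have key : ∀ u w : V3, Indep u (Pi.single 1 1) (Pi.single 2 1) → Indep (Pi.single 0 1) u w →
      Indep (Pi.single 0 1) u (Pi.single 2 1) ∨ Indep (Pi.single 0 1) u (Pi.single 1 1) := by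
    decide
  have h := key (L (d 1)) (L (d 3)) (h2 ▸ h4 ▸ (indep_map L).2 (hd 4))
    (h0 ▸ (indep_map L).2 (hd 5))
  rw [← h0, ← h2, ← h4, indep_map, indep_map] at h
  exact h

/-- The small covers of the polytopes equivalent to the truncated prism. -/
theorem exists_isConnectedSum_of_combEquiv_truncatedPrism {ι : Type*} [Finite ι]
    (P : ConvexPolytope 3 ι) {c : ι → V3} (hc : P.IsColoring c)
    (h : P.CombEquiv truncatedPrism) : ∃ d : Fin 5 → V3, IsPrismColoring d ∧
      IsConnectedSum 3 (P.SmallCover c) (Glued (wallSpanOn prism prismWall d))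
        (RealProjectiveSpace 3) := by
  have key : ∀ (σ : ι ≃ Fin 6) (e : P.carrier ≃ₜ truncatedPrism.carrier),
      (∀ x i, σ i ∈ truncatedPrism.act (e x) ↔ i ∈ P.act x) →
      Indep (c (σ.symm 0)) (c (σ.symm 1)) (c (σ.symm 4)) → ∃ d : Fin 5 → V3, IsPrismColoring d ∧
        IsConnectedSum 3 (P.SmallCover c) (Glued (wallSpanOn prism prismWall d))
          (RealProjectiveSpace 3) := by
    intro σ e he hi
    obtain ⟨d, hd, hs⟩ := exists_prismCover_isConnectedSum
      (isTruncColoring_of_isColoring hc σ e he) hi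
    obtain ⟨g⟩ := P.nonempty_smallCover_homeomorph c σ e (fun i x => truncWall i x.1)
      (fun i => c (σ.symm i)) (LinearEquiv.refl _ _)
      (fun x i => truncWall_eq_zero_iff.trans (he x i)) (fun i => by simp)
    exact ⟨d, hd, hs.congr_left g.symm⟩
  obtain ⟨σ, e, he⟩ := h.exists_homeomorph
  rcases (isTruncColoring_of_isColoring hc σ e he).indep_or with hi | hi
  · exact key σ e he hi
  · obtain ⟨r, hr⟩ := exists_truncatedPrism_swap
    -- The symmetry moves facet `2` to the position of facet `4`, so independence at the other
    -- removed vertex becomes the required hypothesis.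
    refine key (σ.trans truncSwap) (e.trans r) (fun x i => (hr _ _).trans (he x i)) ?_
    exact hi

end TruncatedPrism

end SmallCovers

theorem mainTheorem9 {ι : Type*} [Finite ι] (P : SmallCovers.ConvexPolytope 3 ι)
    (c : ι → (Fin 3 → ZMod 2)) (hc : P.IsColoring c) :
    (P.CombEquiv SmallCovers.triangularPrism →
      SmallCovers.IsConnectedSum 3 (P.SmallCover c)
          (SmallCovers.RealProjectiveSpace 3) (SmallCovers.RealProjectiveSpace 3) ∨
        Nonempty (P.SmallCover c ≃ₜ Circle × SmallCovers.RealProjectiveSpace 2)) ∧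
    (P.CombEquiv SmallCovers.truncatedPrism →
      (∃ (Y : Type) (_ : TopologicalSpace Y),
        SmallCovers.IsConnectedSum 3 Y
            (SmallCovers.RealProjectiveSpace 3) (SmallCovers.RealProjectiveSpace 3) ∧
          SmallCovers.IsConnectedSum 3 (P.SmallCover c) Y (SmallCovers.RealProjectiveSpace 3)) ∨
        SmallCovers.IsConnectedSum 3 (P.SmallCover c)
          (Circle × SmallCovers.RealProjectiveSpace 2) (SmallCovers.RealProjectiveSpace 3)) := by
  refine ⟨SmallCovers.smallCover_cases_of_combEquiv_prism P hc, fun h => ?_⟩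
  obtain ⟨d, hd, hs⟩ := SmallCovers.exists_isConnectedSum_of_combEquiv_truncatedPrism P hc h
  rcases SmallCovers.prismCover_cases hd with h1 | ⟨⟨f⟩⟩
  -- The intermediate summand is the small cover of the standard prism itself.
  · exact Or.inl ⟨_, _, h1, hs⟩
  · exact Or.inr (hs.congr_summand f)
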